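/- **Model.** A *circuit* is a list of gates (a straight-line program) on real-valued wires with exact arithmetic: real constants, $+,-,\times,\div$, square root, sine and cosine of numbers in $[0,2\pi]$, selection according to the sign of a wire, each at cost $1$, and the determinant and the eigenvalues of (the symmetric part of) an $m\times m$ block of wires, each at cost $m^3+1$. Its cost is the sum of the costs of its gates. *Coins* are independent uniform numbers in $[0,1]$ and independent standard normal numbers. Two families $(\mu_n),(\nu_n)$ of distributions on real $n\times n$ matrices are *computationally indistinguishable* if for every family $(\mathcal A_n)$ of circuits of polynomial cost, using polynomially many coins, the difference $$\bigl|\Pr_{M\sim\mu_n}[\mathcal A_n(M)=1]-\Pr_{M\sim\nu_n}[\mathcal A_n(M)=1]\bigr|$$ tends to $0$ faster than any inverse polynomial in $n$. A family of distributions on finite (polynomially long) sequences of reals is *efficiently samplable* if circuits of polynomial cost, given only polynomially many coins, output it exactly. **Kac's walk.** $Q_0=I_n$, and $Q_t=R_{i_t,j_t,\theta_t}Q_{t-1}$, where $(i_t,j_t)$ is uniform among the ordered pairs of distinct indices in $[n]$, $\theta_t$ is uniform in $[0,2\pi)$, all are independent, and $R_{i,j,\theta}$ is the rotation of the plane of $e_i,e_j$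 by $\theta$ (for $n<2$ the walk stands still). For $T:\mathbb N\to\mathbb N$, call Kac's walk *pseudorandom at time $T$* if $T(n)\le n\cdot\mathrm{polylog}(n)$ and the law of $Q_{T(n)}$ is computationally indistinguishable from the Haar measure on $SO(n)$. **Invariance.** A distribution $\mathcal D_n$ on real $n\times n$ matrices is *Haar-invariant* if, for independent $A\sim\mathcal D_n$ and Haar-distributed $O\in SO(n)$, both $OA$ and $AO$ are distributed as $\mathcal D_n$. It is *symmetrically Haar-invariant* if it is carried by the symmetric matrices and $OAO^{-1}$ is distributed as $\mathcal D_n$. **Theorem.** Assume that Kac's walk is pseudorandom at time $T$. Let $\mathcal D=(\mathcal D_n)_n$ be any family of probability distributions on real $n\times n$ matrices such that either every $\mathcal D_n$ is Haar-invariant or every $\mathcal D_n$ is symmetrically Haar-invariant. Then for every $n$ there is a random pair $(M,C)$ of an $n\times n$ matrix and a circuit such that 1. (correctness) for every outcome $(M,C)$ and every $v\in\mathbb R^n$, $C(v)=Mv$; 2. (efficiency) for every outcome, the cost of $C$ is at most $S(n)$, for a function $S(n)\le n\cdot\mathrm{polylog}(n)$; 3. (indistinguishability) the law of $M$ is computationally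 indistinguishable from $\mathcal D$; 4. (sampling) if $\mathcal D$ is efficiently samplable, then so is the law of the pair $(M,C)$, with $C$ written out as a sequence of reals; 5. (form) if the $\mathcal D_n$ are Haar-invariant, $M=O_1DO_2$ with $O_1,D,O_2$ independent, $D$ diagonal, and $O_1,O_2$ distributed as $Q_{T(n)}$; if they are symmetrically Haar-invariant, $M=ODO^{-1}$ with $O,D$ independent, $D$ diagonal, and $O$ distributed as $Q_{T(n)}$. -/

import Mathlib

open MeasureTheory

namespace Trapdoor

noncomputable section

/-! ### Real matrices as a measurable space, and the rotation group -/

instance matrixMeasurableSpace (n : ℕ) : MeasurableSpace (Matrix (Fin n) (Fin n) ℝ) :=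
  inferInstanceAs (MeasurableSpace (Fin n → Fin n → ℝ))

instance matrixBorelSpace (n : ℕ) : BorelSpace (Matrix (Fin n) (Fin n) ℝ) :=
  inferInstanceAs (BorelSpace (Fin n → Fin n → ℝ))

/-- The group `SO(n)`. -/
abbrev SO (n : ℕ) := Matrix.specialOrthogonalGroup (Fin n) ℝ

instance soTopologicalGroup (n : ℕ) : IsTopologicalGroup (SO n) where
  continuous_inv := by
    refine Continuous.subtype_mk (f := fun A : SO n => star (A : Matrix (Fin n) (Fin n) ℝ)) ?_ _
    exact continuous_star.comp continuous_subtype_val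

instance soCompactSpace (n : ℕ) : CompactSpace (SO n) := by
  have hclosed : IsClosed (SO n : Set (Matrix (Fin n) (Fin n) ℝ)) := by
    have h : (SO n : Set (Matrix (Fin n) (Fin n) ℝ)) =
        {A | A * star A = 1} ∩ {A | A.det = 1} := by
      ext A
      simp only [SetLike.mem_coe, Matrix.mem_specialOrthogonalGroup_iff,
        Matrix.mem_orthogonalGroup_iff, Set.mem_inter_iff]
      rfl
    rw [h]
    exact (isClosed_eq (by fun_prop) continuous_const).inter
      (isClosed_eq (by fun_prop) continuous_const)
  have hcompact : IsCompact
      (Set.univ.pi fun _ : Fin n => Set.univ.pi fun _ : Fin n => Set.Icc (-1 : ℝ) 1) :=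
    isCompact_univ_pi fun _ => isCompact_univ_pi fun _ => isCompact_Icc
  refine isCompact_iff_compactSpace.mp (IsCompact.of_isClosed_subset hcompact hclosed ?_)
  intro A hA i _ j _
  have h := entry_norm_bound_of_unitary
    (Matrix.mem_specialOrthogonalGroup_iff.mp hA).1 i j
  rw [Real.norm_eq_abs] at h
  exact abs_le.mp h

/-- The uniform distribution on `SO(n)`: the Haar measure of total mass one. -/
def haarSO (n : ℕ) : Measure (SO n) := Measure.haarMeasure ⊤

/-- The Haar measure of `SO(n)`, as a distribution on `n × n` matrices. -/
def haarMatrix (n : ℕ) : Measure (Matrix (Fin n) (Fin n) ℝ) := (haarSO n).map Subtype.val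

/-- `O * A` and `A * O` are distributed as `A`, for `A ∼ μ` and an independent `O ∼ SO(n)`. -/
def IsHaarInvariant {n : ℕ} (μ : Measure (Matrix (Fin n) (Fin n) ℝ)) : Prop :=
  ((haarSO n).prod μ).map (fun p => (p.1 : Matrix (Fin n) (Fin n) ℝ) * p.2) = μ ∧
  ((haarSO n).prod μ).map (fun p => p.2 * (p.1 : Matrix (Fin n) (Fin n) ℝ)) = μ

/-- `μ` is carried by the symmetric matrices, and `O * A * O⁻¹` is distributed as `A`, for
`A ∼ μ` and an independent `O ∼ SO(n)`. -/
def IsSymmHaarInvariant {n : ℕ} (μ : Measure (Matrix (Fin n) (Fin n) ℝ)) : Prop :=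
  (∀ᵐ A ∂μ, A.IsSymm) ∧
  ((haarSO n).prod μ).map (fun p => (p.1 : Matrix (Fin n) (Fin n) ℝ) * p.2 *
    ((p.1⁻¹ : SO n) : Matrix (Fin n) (Fin n) ℝ)) = μ

/-! ### Kac's random walk -/

/-- The rotation by `θ` of the plane spanned by `e_i, e_j` (for `i ≠ j`). Column `i` is
`cos θ e_i + sin θ e_j`, column `j` is `- sin θ e_i + cos θ e_j`. -/
def planeRotation {n : ℕ} (i j : Fin n) (θ : ℝ) : Matrix (Fin n) (Fin n) ℝ :=
  Matrix.of fun a b =>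
    if b = i then (if a = i then Real.cos θ else if a = j then Real.sin θ else 0)
    else if b = j then (if a = i then -Real.sin θ else if a = j then Real.cos θ else 0)
    else if a = b then 1 else 0

/-- The law of one step: `(i, j)` uniform among the ordered pairs of distinct indices and `θ`
uniform in `[0, 2π)`, independent. For `n < 2` there is no such pair and the walk stands still. -/
def kacStep (n : ℕ) : Measure (Matrix (Fin n) (Fin n) ℝ) :=
  if n < 2 then Measure.dirac 1
  else ((ProbabilityTheory.uniformOn {p : Fin n × Fin n | p.1 ≠ p.2}).prod
      (ProbabilityTheory.cond volume (Set.Ico 0 (2 * Real.pi)))).map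
    fun q => planeRotation q.1.1 q.1.2 q.2

/-- The law of the state `Q_t` of Kac's walk after `t` steps, started at `Q_0 = 1`. -/
def kacWalk (n : ℕ) : ℕ → Measure (Matrix (Fin n) (Fin n) ℝ)
  | 0 => Measure.dirac 1
  | t + 1 => ((kacStep n).prod (kacWalk n t)).map fun p => p.1 * p.2

/-! ### Real circuits

A circuit over the reals is given as a straight-line program: a list of gates, each of which
writes to one of countably many wires (registers) numbered by `ℕ`, all of which hold `0` unless
they carry an input. The arithmetic is exact. There is no rounding gate, and sine and cosine are
available on `[0, 2π]` only. The last two gates are the standard primitives of numerical linear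
algebra on an `m × m` block of wires, charged with cubic cost. -/

inductive Gate
  | const (dst : ℕ) (c : ℝ)
  | add (dst a b : ℕ)
  | sub (dst a b : ℕ)
  | mul (dst a b : ℕ)
  | div (dst a b : ℕ)
  | sqrt (dst a : ℕ)
  | cos (dst a : ℕ)
  | sin (dst a : ℕ)
  | select (dst a b c : ℕ)
  | det (dst base m : ℕ)
  | eig (dst base m k : ℕ)

/-- The `m × m` matrix stored row by row in the wires from `base` on. -/
def block (s : ℕ → ℝ) (base m : ℕ) : Matrix (Fin m) (Fin m) ℝ :=
  Matrix.of fun i j => s (base + i * m + j)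

/-- The `k`-th largest eigenvalue (from `k = 0`, with multiplicity) of the symmetric part of `B`,
and `0` if `m ≤ k`. -/
def symmEigenvalue {m : ℕ} (B : Matrix (Fin m) (Fin m) ℝ) (k : ℕ) : ℝ :=
  if h : ((1 / 2 : ℝ) • (B + B.transpose)).IsHermitian ∧ k < Fintype.card (Fin m) then
    h.1.eigenvalues₀ ⟨k, h.2⟩
  else 0

namespace Gate

/-- The wire a gate writes to. -/
def target : Gate → ℕ
  | const d _ => d
  | add d _ _ => d
  | sub d _ _ => d
  | mul d _ _ => d
  | div d _ _ => d
  | sqrt d _ => d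
  | cos d _ => d
  | sin d _ => d
  | select d _ _ _ => d
  | det d _ _ => d
  | eig d _ _ _ => d

/-- The value a gate writes, from the present values `s` of the wires. -/
def value (s : ℕ → ℝ) : Gate → ℝ
  | const _ c => c
  | add _ a b => s a + s b
  | sub _ a b => s a - s b
  | mul _ a b => s a * s b
  | div _ a b => s a / s b
  | sqrt _ a => Real.sqrt (s a)
  | cos _ a => if 0 ≤ s a ∧ s a ≤ 2 * Real.pi then Real.cos (s a) else 0
  | sin _ a => if 0 ≤ s a ∧ s a ≤ 2 * Real.pi then Real.sin (s a) else 0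
  | select _ a b c => if s a ≤ 0 then s b else s c
  | det _ base m => (block s base m).det
  | eig _ base m k => symmEigenvalue (block s base m) k

def step (s : ℕ → ℝ) (g : Gate) : ℕ → ℝ := Function.update s g.target (g.value s)

def cost : Gate → ℕ
  | det _ _ m => m ^ 3 + 1
  | eig _ _ m _ => m ^ 3 + 1
  | _ => 1

/-- A gate as five real numbers: its kind, its target, and its parameters. -/
def code : Gate → Fin 5 → ℝ
  | const d c => ![0, d, c, 0, 0]
  | add d a b => ![1, d, a, b, 0]
  | sub d a b => ![2, d, a, b, 0]
  | mul d a b => ![3, d, a, b, 0]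
  | div d a b => ![4, d, a, b, 0]
  | sqrt d a => ![5, d, a, 0, 0]
  | cos d a => ![6, d, a, 0, 0]
  | sin d a => ![7, d, a, 0, 0]
  | select d a b c => ![8, d, a, b, c]
  | det d base m => ![9, d, base, m, 0]
  | eig d base m k => ![10, d, base, m, k]

end Gate

abbrev Circuit := List Gate

namespace Circuit

/-- The values of the wires at the end of the computation. -/
def run (C : Circuit) (s : ℕ → ℝ) : ℕ → ℝ := C.foldl Gate.step s

/-- The size of the circuit, which is the time it takes to evaluate it. -/
def cost (C : Circuit) : ℕ := (C.map Gate.cost).sum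

/-- The map `ℝⁿ → ℝⁿ` that a circuit computes: input and output are in the wires `0, …, n - 1`. -/
def apply {n : ℕ} (C : Circuit) (v : Fin n → ℝ) : Fin n → ℝ :=
  fun i => C.run (fun k => if h : k < n then v ⟨k, h⟩ else 0) i

/-- The description of a circuit as a finite sequence of reals (padded with zeros): the number of
gates, followed by the codes of the gates. -/
def code (C : Circuit) : ℕ → ℝ
  | 0 => (C.length : ℝ)
  | k + 1 => if h : k / 5 < C.length then
      (C.get ⟨k / 5, h⟩).code ⟨k % 5, Nat.mod_lt _ (by norm_num)⟩ else 0

end Circuit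

/-! ### Inputs, random coins, and asymptotics -/

/-- The entries of a matrix, row by row. -/
def entries {n : ℕ} (A : Matrix (Fin n) (Fin n) ℝ) : ℕ → ℝ := fun k =>
  if h : k < n * n then
    A (finProdFinEquiv.symm ⟨k, h⟩).1 (finProdFinEquiv.symm ⟨k, h⟩).2
  else 0

/-- `x 0, …, x (m - 1), y 0, y 1, …` -/
def concat (m : ℕ) (x y : ℕ → ℝ) : ℕ → ℝ := fun k => if k < m then x k else y (k - m)

/-- The law of `r` independent pairs, each of a uniform number in `[0, 1]` and an independent
standard normal one. -/
def coins (r : ℕ) : Measure (Fin r → ℝ × ℝ) :=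
  Measure.pi fun _ =>
    (volume.restrict (Set.Icc (0 : ℝ) 1)).prod (ProbabilityTheory.gaussianReal 0 1)

/-- The coins in the order uniform, normal, uniform, normal, … -/
def tape {r : ℕ} (c : Fin r → ℝ × ℝ) : ℕ → ℝ := fun k =>
  if h : k / 2 < r then (if k % 2 = 0 then (c ⟨k / 2, h⟩).1 else (c ⟨k / 2, h⟩).2) else 0

def PolyBounded (f : ℕ → ℕ) : Prop := ∃ p : Polynomial ℕ, ∀ n, f n ≤ p.eval n

/-- `T n ≤ n * polylog n`. -/
def IsQuasilinear (T : ℕ → ℕ) : Prop :=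
  ∃ c k : ℕ, ∀ n ≥ 2, T n ≤ c * n * Nat.log 2 n ^ k

/-! ### Computational indistinguishability and efficient sampling -/

/-- The probability that the circuit `C`, given a matrix drawn from `μ` and `r` coins, outputs
`1` (in wire `0`). -/
def acceptProb {n : ℕ} (C : Circuit) (r : ℕ) (μ : Measure (Matrix (Fin n) (Fin n) ℝ)) : ℝ :=
  (μ.prod (coins r)).real {p | C.run (concat (n * n) (entries p.1) (tape p.2)) 0 = 1}

/-- No probabilistic distinguisher of polynomial size has a non-negligible advantage. -/
def Indistinguishable (μ ν : ∀ n : ℕ, Measure (Matrix (Fin n) (Fin n) ℝ)) : Prop :=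
  ∀ (𝒜 : ℕ → Circuit) (r : ℕ → ℕ), PolyBounded (fun n => (𝒜 n).cost) → PolyBounded r →
    Asymptotics.SuperpolynomialDecay Filter.atTop (fun n : ℕ => (n : ℝ))
      (fun n => |acceptProb (𝒜 n) (r n) (μ n) - acceptProb (𝒜 n) (r n) (ν n)|)

/-- There are circuits of polynomial size which, given polynomially many coins and nothing else,
output a polynomially long sequence (in the first wires) of law `μ n`. -/
def EfficientlySamplable (μ : ℕ → Measure (ℕ → ℝ)) : Prop :=
  ∃ (S : ℕ → Circuit) (r N : ℕ → ℕ),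
    PolyBounded (fun n => (S n).cost) ∧ PolyBounded r ∧ PolyBounded N ∧
    ∀ n, μ n = (coins (r n)).map fun c => concat (N n) ((S n).run (tape c)) 0

/-! ### Trapdoored matrices -/

/-- A distribution over pairs `(M, C)` of a matrix and a circuit that multiplies vectors by it,
given by a random pair on a probability space. -/
structure TrapdooredMatrices (n : ℕ) where
  Ω : Type
  [measurableSpace : MeasurableSpace Ω]
  P : Measure Ω
  [isProbabilityMeasure : IsProbabilityMeasure P]
  M : Ω → Matrix (Fin n) (Fin n) ℝ
  C : Ω → Circuit
  measurable_M : Measurable M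
  measurable_C : Measurable fun ω => (C ω).code
  correct : ∀ ω v, (C ω).apply v = (M ω).mulVec v

attribute [instance] TrapdooredMatrices.measurableSpace TrapdooredMatrices.isProbabilityMeasure

namespace TrapdooredMatrices

/-- The law of the matrix. -/
def matrixLaw {n : ℕ} (F : TrapdooredMatrices n) : Measure (Matrix (Fin n) (Fin n) ℝ) :=
  F.P.map F.M

/-- The joint law of the matrix and the trapdoor circuit, both written out as reals. -/
def pairLaw {n : ℕ} (F : TrapdooredMatrices n) : Measure (ℕ → ℝ) :=
  F.P.map fun ω => concat (n * n) (entries (F.M ω)) (F.C ω).code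

/-- `M = O₁ * Δ * O₂` with `O₁, Δ, O₂` independent, `Δ` diagonal, and `O₁`, `O₂` distributed as
Kac's walk after `t` steps. -/
def IsKacTwoSided {n : ℕ} (F : TrapdooredMatrices n) (t : ℕ) : Prop :=
  ∃ O₁ Δ O₂ : F.Ω → Matrix (Fin n) (Fin n) ℝ,
    Measurable O₁ ∧ Measurable Δ ∧ Measurable O₂ ∧
    F.P.map (fun ω => (O₁ ω, Δ ω, O₂ ω)) =
      (kacWalk n t).prod ((F.P.map Δ).prod (kacWalk n t)) ∧
    ∀ ω, (Δ ω).IsDiag ∧ F.M ω = O₁ ω * Δ ω * O₂ ω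

/-- `M = O * Δ * O⁻¹` with `O, Δ` independent, `Δ` diagonal, and `O` distributed as Kac's walk
after `t` steps. -/
def IsKacConjugate {n : ℕ} (F : TrapdooredMatrices n) (t : ℕ) : Prop :=
  ∃ O Δ : F.Ω → Matrix (Fin n) (Fin n) ℝ,
    Measurable O ∧ Measurable Δ ∧
    F.P.map (fun ω => (O ω, Δ ω)) = (kacWalk n t).prod (F.P.map Δ) ∧
    ∀ ω, IsUnit (O ω).det ∧ (Δ ω).IsDiag ∧ F.M ω = O ω * Δ ω * (O ω)⁻¹

end TrapdooredMatrices

/-- `F` is a family of trapdoored matrices over the distributions `μ n`, with multiplication in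
time `n * polylog n`. It is efficiently samplable as soon as the distributions `μ n` are. -/
def IsTrapdooredFamilyFor (F : ∀ n, TrapdooredMatrices n)
    (μ : ∀ n : ℕ, Measure (Matrix (Fin n) (Fin n) ℝ)) : Prop :=
  (∃ S : ℕ → ℕ, IsQuasilinear S ∧ ∀ n ω, ((F n).C ω).cost ≤ S n) ∧
  Indistinguishable (fun n => (F n).matrixLaw) μ ∧
  (EfficientlySamplable (fun n => (μ n).map entries) →
    EfficientlySamplable (fun n => (F n).pairLaw))

/-- After `T n = n * polylog n` steps, the state of Kac's walk is computationally
indistinguishable from the Haar measure on `SO(n)`. -/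
def KacPseudorandom (T : ℕ → ℕ) : Prop :=
  IsQuasilinear T ∧ Indistinguishable (fun n => kacWalk n (T n)) haarMatrix

end

end Trapdoor

/-! ### Circuits and a calculus of computable functions. -/

namespace Trapdoor

noncomputable section

/-! ### Running circuits -/

/-! Let `A` be drawn from a Haar-invariant law and write `A = U Σ V` with `U, V` rotations, where
`Σ` carries the singular values and the last one takes the sign of the determinant. By invariance
`A` has the law of `O₁ A O₂ = (O₁ U) Σ (V O₂)` with independent Haar rotations. For each fixed `A`
the factors `O₁ U` and `V O₂` are again independent and Haar, so the law is exactly that of `O₁ Σ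
O₂` with `Σ` independent of both rotations (`IsHaarInvariant.eq_map`). In the symmetric case the
spectral theorem gives `O Δ Oᵀ` (`IsSymmHaarInvariant.eq_map`). Since `U` and `V` are needed only
for fixed `A`, inside a Fubini integral, they never have to be chosen measurably. Only the sorted
eigenvalues must be measurable, and these are Lipschitz.

The trapdoored matrix replaces each Haar factor by Kac's walk. Multiplying a vector by it takes `T`
plane rotations, one scaling of the coordinates and, at most, `T` further rotations, hence `O(T +
n)` gates.

Indistinguishability is a hybrid argument, one Haar factor at a time (`Indistinguishable.map_prod`).
The data independent of the factor being replaced may have any distribution: since circuits are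
nonuniform, values that do at least as well as the average can be hardwired as constants, and matrix
products cost only polynomially much. No sampler for the distribution is needed here.

Sampling must be exact, without rounding. A single uniform coin `u` drives a whole step of the walk:
with `K` the number of index pairs, the subinterval of length `1/K` containing `u` selects the pair,
and the position of `u` inside it gives the angle, independently (`map_stepIndex_stepAngle`). The
diagonal part comes from a sample of the given distribution through the eigenvalue and determinant
gates.

To avoid wire bookkeeping, `Reach` and `Easy` speak of sets of real functions of a parameter
(matrix, coins, seed) that are obtained from one another by gates. `Easy.exists_circuit` compiles
such a derivation into one circuit that works for all values of the parameter, and `Easy.measurable`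
turns it into measurability. -/

theorem Circuit.run_append (C D : Circuit) (s : ℕ → ℝ) : (C ++ D).run s = D.run (C.run s) :=
  List.foldl_append

theorem Circuit.cost_append (C D : Circuit) : (C ++ D).cost = C.cost + D.cost := by
  simp [Circuit.cost]

theorem Circuit.cost_cons (g : Gate) (C : Circuit) :
    Circuit.cost (g :: C) = g.cost + C.cost := by
  simp [Circuit.cost]

theorem Circuit.cost_nil : Circuit.cost [] = 0 := rfl

theorem Gate.one_le_cost (g : Gate) : 1 ≤ g.cost := by
  cases g <;> simp [Gate.cost]

theorem Circuit.length_le_cost (C : Circuit) : C.length ≤ C.cost := by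
  induction C with
  | nil => simp
  | cons g C ih =>
    rw [Circuit.cost_cons, List.length_cons]
    have := g.one_le_cost
    omega

theorem Gate.step_target (g : Gate) (s : ℕ → ℝ) : g.step s g.target = g.value s := by
  simp [Gate.step]

theorem Gate.step_of_ne (g : Gate) (s : ℕ → ℝ) {w : ℕ} (h : w ≠ g.target) : g.step s w = s w := by
  simp [Gate.step, h]

/-! ### A calculus of efficiently computable functions -/

variable {α β : Type*}

/-- The functions that are in `fs` or constant. -/
def withConsts (fs : Set (α → ℝ)) : Set (α → ℝ) := fs ∪ Set.range fun (c : ℝ) (_ : α) => c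

theorem subset_withConsts (fs : Set (α → ℝ)) : fs ⊆ withConsts fs := Set.subset_union_left

theorem const_mem_withConsts (fs : Set (α → ℝ)) (c : ℝ) : (fun _ => c) ∈ withConsts fs :=
  Or.inr ⟨c, rfl⟩

theorem withConsts_mono {fs gs : Set (α → ℝ)} (h : fs ⊆ gs) : withConsts fs ⊆ withConsts gs :=
  Set.union_subset_union_left _ h

theorem withConsts_subset_withConsts {fs gs : Set (α → ℝ)} (h : fs ⊆ withConsts gs) :
    withConsts fs ⊆ withConsts gs :=
  Set.union_subset h Set.subset_union_right

/-- `Reach fs c gs`: starting from the functions `fs`, the functions `gs` are obtained by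
applying gates of total cost about `c` to functions obtained before and to constants. -/
inductive Reach (fs : Set (α → ℝ)) : ℕ → Set (α → ℝ) → Prop
  | refl : Reach fs 0 fs
  | gate {c : ℕ} {gs : Set (α → ℝ)} (h : Reach fs c gs) (g : Gate) (s : α → ℕ → ℝ)
      (hs : ∀ w, (fun a => s a w) ∈ withConsts gs) :
      Reach fs (c + 4 * g.cost) (insert (fun a => g.value (s a)) gs)

theorem Reach.trans {fs gs hs : Set (α → ℝ)} {c d : ℕ} (h : Reach fs c gs) (h' : Reach gs d hs) :
    Reach fs (c + d) hs := by
  induction h' with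
  | refl => exact h
  | gate _ g s h's ih => rw [← add_assoc]; exact .gate ih g s h's

theorem Reach.subset {fs gs : Set (α → ℝ)} {c : ℕ} (h : Reach fs c gs) : fs ⊆ gs := by
  induction h with
  | refl => exact subset_rfl
  | gate _ _ _ _ ih => exact ih.trans (Set.subset_insert _ _)

/-- The functions `gs` can be computed from the functions `fs` at cost about `c`. -/
def Easy (fs : Set (α → ℝ)) (c : ℕ) (gs : Set (α → ℝ)) : Prop :=
  ∃ c' ≤ c, ∃ hs, gs ⊆ withConsts hs ∧ Reach fs c' hs

theorem Easy.of_subset {fs gs : Set (α → ℝ)} (h : gs ⊆ withConsts fs) (c : ℕ) : Easy fs c gs :=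
  ⟨0, Nat.zero_le _, fs, h, .refl⟩

theorem Easy.mono {fs gs gs' : Set (α → ℝ)} {c c' : ℕ} (h : Easy fs c gs)
    (hg : gs' ⊆ withConsts gs) (hc : c ≤ c') : Easy fs c' gs' := by
  obtain ⟨d, hd, hs, h1, h2⟩ := h
  exact ⟨d, hd.trans hc, hs, hg.trans (withConsts_subset_withConsts h1), h2⟩

theorem Easy.mono_cost {fs gs : Set (α → ℝ)} {c c' : ℕ} (h : Easy fs c gs) (hc : c ≤ c') :
    Easy fs c' gs := h.mono (subset_withConsts _) hc

/-- The same gates are replayed from `hs`: their operands stay available there, up to constants,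
which are free. Since `hs` itself is retained, computations can be chained and can share results. -/
theorem Reach.of_subset_withConsts {fs gs hs : Set (α → ℝ)} {c : ℕ} (h : Reach fs c gs)
    (hsub : fs ⊆ withConsts hs) : ∃ ks, gs ⊆ withConsts ks ∧ hs ⊆ ks ∧ Reach hs c ks := by
  induction h with
  | refl => exact ⟨hs, hsub, subset_rfl, .refl⟩
  | @gate c gs h g s h's ih =>
    obtain ⟨ks, h1, h2, h3⟩ := ih
    refine ⟨_, ?_, h2.trans (Set.subset_insert _ _),
      .gate h3 g s fun w => withConsts_subset_withConsts h1 (h's w)⟩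
    rintro f (rfl | hf)
    · exact subset_withConsts _ (Set.mem_insert _ _)
    · exact withConsts_mono (Set.subset_insert _ _) (h1 hf)

/-- The second computation is replayed from everything the first one reached, so `gs` is paid for
only once. -/
theorem Easy.trans {fs gs hs : Set (α → ℝ)} {c d : ℕ} (h : Easy fs c gs)
    (h' : Easy (fs ∪ gs) d hs) : Easy fs (c + d) (gs ∪ hs) := by
  obtain ⟨c', hc, X, hX, hR⟩ := h
  obtain ⟨d', hd, Y, hY, hR'⟩ := h'
  obtain ⟨Z, h1, h2, h3⟩ := hR'.of_subset_withConsts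
    (Set.union_subset (hR.subset.trans (subset_withConsts _)) hX)
  exact ⟨c' + d', add_le_add hc hd, Z,
    Set.union_subset (hX.trans (withConsts_mono h2)) (hY.trans (withConsts_subset_withConsts h1)),
    hR.trans h3⟩

/-- Enlarging the set of given functions. -/
theorem Easy.weaken {fs fs' gs : Set (α → ℝ)} {c : ℕ} (h : Easy fs c gs)
    (hf : fs ⊆ withConsts fs') : Easy fs' c gs := by
  obtain ⟨c', hc, X, hX, hR⟩ := h
  obtain ⟨Z, h1, -, h3⟩ := hR.of_subset_withConsts hf
  exact ⟨c', hc, Z, hX.trans (withConsts_subset_withConsts h1), h3⟩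

theorem Easy.union {fs gs hs : Set (α → ℝ)} {c d : ℕ} (h : Easy fs c gs)
    (h' : Easy fs d hs) : Easy fs (c + d) (gs ∪ hs) :=
  h.trans (h'.weaken (Set.subset_union_left.trans (subset_withConsts _)))

/-- `Easy.trans`, forgetting the intermediate functions. -/
theorem Easy.comp {fs gs hs : Set (α → ℝ)} {c d : ℕ} (h : Easy fs c gs)
    (h' : Easy gs d hs) : Easy fs (c + d) hs :=
  (h.trans (h'.weaken (Set.subset_union_right.trans (subset_withConsts _)))).mono
    (Set.subset_union_right.trans (subset_withConsts _)) le_rfl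

theorem Easy.biUnion {ι : Type*} (t : Finset ι) {fs : Set (α → ℝ)} {gs : ι → Set (α → ℝ)} {c : ℕ}
    (h : ∀ i ∈ t, Easy fs c (gs i)) : Easy fs (t.card * c) (⋃ i ∈ t, gs i) := by
  classical
  induction t using Finset.induction_on with
  | empty => exact Easy.of_subset (by simp) _
  | insert i t hi ih =>
    rw [Finset.set_biUnion_insert, Finset.card_insert_of_notMem hi, Nat.succ_mul, add_comm]
    exact (h i (Finset.mem_insert_self _ _)).union
      (ih fun j hj => h j (Finset.mem_insert_of_mem hj))

theorem Easy.iUnion {ι : Type*} [Fintype ι] {fs : Set (α → ℝ)} {gs : ι → Set (α → ℝ)} {c : ℕ}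
    (h : ∀ i, Easy fs c (gs i)) : Easy fs (Fintype.card ι * c) (⋃ i, gs i) := by
  have := Easy.biUnion Finset.univ fun i _ => h i
  simpa using this

theorem Easy.range {ι : Type*} [Fintype ι] {fs : Set (α → ℝ)} {f : ι → α → ℝ} {c : ℕ}
    (h : ∀ i, Easy fs c {f i}) : Easy fs (Fintype.card ι * c) (Set.range f) := by
  have := Easy.iUnion h
  rwa [Set.iUnion_singleton_eq_range] at this

theorem Easy.mem {fs : Set (α → ℝ)} {f : α → ℝ} (h : f ∈ withConsts fs) (c : ℕ) :
    Easy fs c {f} := Easy.of_subset (Set.singleton_subset_iff.mpr h) c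

theorem Easy.const (fs : Set (α → ℝ)) (r : ℝ) (c : ℕ) : Easy fs c {fun _ => r} :=
  Easy.mem (const_mem_withConsts _ _) c

theorem Easy.gate {fs gs : Set (α → ℝ)} {c : ℕ} (h : Easy fs c gs) (g : Gate) (s : α → ℕ → ℝ)
    (hs : ∀ w, (fun a => s a w) ∈ withConsts gs) :
    Easy fs (c + 4 * g.cost) {fun a => g.value (s a)} := by
  obtain ⟨c', hc, X, hX, hR⟩ := h
  exact ⟨_, Nat.add_le_add_right hc _, _,
    Set.singleton_subset_iff.mpr (subset_withConsts _ (Set.mem_insert _ _)),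
    .gate hR g s fun w => withConsts_subset_withConsts hX (hs w)⟩

theorem Easy.unary {fs : Set (α → ℝ)} {c : ℕ} {f : α → ℝ} (hf : Easy fs c {f}) (g : Gate)
    (hg : g.cost = 1) : Easy fs (c + 4) {fun a => g.value fun _ => f a} := by
  have := hf.gate g (fun a _ => f a) fun w => subset_withConsts _ rfl
  rwa [hg] at this

theorem Easy.binary {fs : Set (α → ℝ)} {c d : ℕ} {f₁ f₂ : α → ℝ} (h₁ : Easy fs c {f₁})
    (h₂ : Easy fs d {f₂}) (g : Gate) (hg : g.cost = 1) :
    Easy fs (c + d + 4) {fun a => g.value fun w => if w = 0 then f₁ a else f₂ a} := by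
  have := (h₁.union h₂).gate g (fun a w => if w = 0 then f₁ a else f₂ a) fun w => by
    apply subset_withConsts
    by_cases hw : w = 0
    · left; simp [hw]
    · right; simp [hw]
  rwa [hg] at this

theorem Easy.add {fs : Set (α → ℝ)} {c d : ℕ} {f₁ f₂ : α → ℝ} (h₁ : Easy fs c {f₁})
    (h₂ : Easy fs d {f₂}) : Easy fs (c + d + 4) {fun a => f₁ a + f₂ a} :=
  h₁.binary h₂ (.add 0 0 1) rfl

theorem Easy.sub {fs : Set (α → ℝ)} {c d : ℕ} {f₁ f₂ : α → ℝ} (h₁ : Easy fs c {f₁})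
    (h₂ : Easy fs d {f₂}) : Easy fs (c + d + 4) {fun a => f₁ a - f₂ a} :=
  h₁.binary h₂ (.sub 0 0 1) rfl

theorem Easy.mul {fs : Set (α → ℝ)} {c d : ℕ} {f₁ f₂ : α → ℝ} (h₁ : Easy fs c {f₁})
    (h₂ : Easy fs d {f₂}) : Easy fs (c + d + 4) {fun a => f₁ a * f₂ a} :=
  h₁.binary h₂ (.mul 0 0 1) rfl

theorem Easy.neg {fs : Set (α → ℝ)} {c : ℕ} {f : α → ℝ} (h : Easy fs c {f}) :
    Easy fs (c + 4) {fun a => -f a} := by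
  have := (Easy.const fs 0 0).sub h
  simpa using this

theorem Easy.sqrt {fs : Set (α → ℝ)} {c : ℕ} {f : α → ℝ} (h : Easy fs c {f}) :
    Easy fs (c + 4) {fun a => Real.sqrt (f a)} :=
  h.unary (.sqrt 0 0) rfl

/-- The range condition is needed because the gate writes `0` for arguments outside `[0, 2π]`. -/
theorem Easy.cos {fs : Set (α → ℝ)} {c : ℕ} {f : α → ℝ} (h : Easy fs c {f})
    (h0 : ∀ a, 0 ≤ f a ∧ f a ≤ 2 * Real.pi) : Easy fs (c + 4) {fun a => Real.cos (f a)} := by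
  have := h.unary (.cos 0 0) rfl
  simpa [Gate.value, h0] using this

theorem Easy.sin {fs : Set (α → ℝ)} {c : ℕ} {f : α → ℝ} (h : Easy fs c {f})
    (h0 : ∀ a, 0 ≤ f a ∧ f a ≤ 2 * Real.pi) : Easy fs (c + 4) {fun a => Real.sin (f a)} := by
  have := h.unary (.sin 0 0) rfl
  simpa [Gate.value, h0] using this

theorem Easy.select {fs : Set (α → ℝ)} {c d e : ℕ} {f₁ f₂ f₃ : α → ℝ} (h₁ : Easy fs c {f₁})
    (h₂ : Easy fs d {f₂}) (h₃ : Easy fs e {f₃}) :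
    Easy fs (c + d + e + 4) {fun a => if f₁ a ≤ 0 then f₂ a else f₃ a} := by
  have := ((h₁.union h₂).union h₃).gate (.select 0 0 1 2)
    (fun a w => if w = 0 then f₁ a else if w = 1 then f₂ a else f₃ a) fun w => by
    apply subset_withConsts
    by_cases hw : w = 0
    · left; left; simp [hw]
    · by_cases hw1 : w = 1
      · left; right; simp [hw1]
      · right; simp [hw, hw1]
  simpa [Gate.value, Gate.cost] using this

theorem Easy.sum {ι : Type*} (t : Finset ι) {fs : Set (α → ℝ)} {c : ℕ} {f : ι → α → ℝ}
    (h : ∀ i ∈ t, Easy fs c {f i}) : Easy fs (t.card * (c + 4)) {fun a => ∑ i ∈ t, f i a} := by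
  classical
  induction t using Finset.induction_on with
  | empty => simpa using Easy.const fs 0 0
  | insert i t hi ih =>
    simp only [Finset.sum_insert hi, Finset.card_insert_of_notMem hi]
    refine ((h i (Finset.mem_insert_self _ _)).add
      (ih fun j hj => h j (Finset.mem_insert_of_mem hj))).mono_cost (le_of_eq ?_)
    ring

/-- Everything that happens while a circuit runs on available wires. -/
theorem Easy.run (C : Circuit) {fs : Set (α → ℝ)} {s : α → ℕ → ℝ}
    (hs : ∀ w, (fun a => s a w) ∈ withConsts fs) :
    Easy fs (4 * C.cost) (Set.range fun w a => C.run (s a) w) := by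
  induction C generalizing fs s with
  | nil => exact Easy.of_subset (Set.range_subset_iff.mpr hs) _
  | cons g C ih =>
    have h1 : Easy fs (0 + 4 * g.cost) {fun a => g.value (s a)} :=
      (Easy.of_subset (subset_withConsts _) 0).gate g s hs
    refine (h1.trans (ih (s := fun a => g.step (s a)) fun w => ?_)).mono
      (Set.subset_union_right.trans (subset_withConsts _)) ?_
    · by_cases hw : w = g.target
      · subst hw
        simp only [Gate.step_target]
        exact subset_withConsts _ (Or.inr rfl)
      · simp only [Gate.step_of_ne _ _ hw]
        exact withConsts_mono Set.subset_union_left (hs w)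
    · rw [Circuit.cost_cons]; omega

/-- Whatever is computed by gates from measurable functions is measurable. This later yields the
measurability of the trapdoored matrix and of the code of its circuit. -/
theorem Reach.measurable [MeasurableSpace α] {fs gs : Set (α → ℝ)} {c : ℕ}
    (hval : ∀ g : Gate, Measurable fun s : ℕ → ℝ => g.value s)
    (h : Reach fs c gs) (hf : ∀ f ∈ fs, Measurable f) : ∀ f ∈ gs, Measurable f := by
  induction h with
  | refl => exact hf
  | gate h g s hs ih =>
    rintro f (rfl | hf')
    · refine (hval g).comp (measurable_pi_lambda _ fun w => ?_)
      rcases hs w with h' | ⟨c, h'⟩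
      · exact ih _ h'
      · rw [← h']; exact measurable_const
    · exact ih _ hf'

theorem Easy.measurable [MeasurableSpace α] {fs gs : Set (α → ℝ)} {c : ℕ}
    (hval : ∀ g : Gate, Measurable fun s : ℕ → ℝ => g.value s)
    (h : Easy fs c gs) (hf : ∀ f ∈ fs, Measurable f) : ∀ f ∈ gs, Measurable f := by
  obtain ⟨c', -, X, hX, hR⟩ := h
  intro f hfg
  rcases hX hfg with h' | ⟨c, h'⟩
  · exact hR.measurable hval hf _ h'
  · rw [← h']; exact measurable_const

/-! ### Realizing computable functions by circuits -/

/-- Copying available functions to consecutive wires. -/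
theorem exists_load {s : α → ℕ → ℝ} {W W' : ℕ} {f : ℕ → α → ℝ}
    (hf : ∀ q, (∃ w < W, ∀ a, s a w = f q a) ∨ ∃ c : ℝ, (fun _ => c) = f q) (hW : W ≤ W') (N : ℕ) :
    ∃ C : Circuit, C.cost = N ∧ ∀ a, (∀ q < N, C.run (s a) (W' + q) = f q a) ∧
      ∀ w < W', C.run (s a) w = s a w := by
  induction N with
  | zero => exact ⟨[], rfl, fun a => ⟨by simp, fun _ _ => rfl⟩⟩
  | succ N ih =>
    obtain ⟨C, hC, h⟩ := ih
    obtain ⟨g, hg, hgt, hgv⟩ : ∃ g : Gate, g.cost = 1 ∧ g.target = W' + N ∧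
        ∀ a, g.value (C.run (s a)) = f N a := by
      rcases hf N with ⟨w, hw, h'⟩ | ⟨c, h'⟩
      -- A selection between two equal operands serves as a copy gate.
      · refine ⟨.select (W' + N) w w w, rfl, rfl, fun a => ?_⟩
        simp only [Gate.value, ite_self]
        rw [(h a).2 w (hw.trans_le hW), h']
      · exact ⟨.const (W' + N) c, rfl, rfl, fun a => by rw [← h']; rfl⟩
    refine ⟨C ++ [g], by rw [Circuit.cost_append, hC, Circuit.cost_cons, hg]; rfl, fun a => ?_⟩
    have hrun : (C ++ [g]).run (s a) = g.step (C.run (s a)) := Circuit.run_append _ _ _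
    rw [hrun]
    refine ⟨fun q hq => ?_, fun w hw => ?_⟩
    · rcases Nat.lt_succ_iff_lt_or_eq.mp hq with hq | rfl
      · rw [Gate.step_of_ne _ _ (by omega), (h a).1 q hq]
      · rw [← hgt, Gate.step_target, hgv]
    · rw [Gate.step_of_ne _ _ (by omega), (h a).2 w hw]

/-- Moving a block of wires to the beginning. -/
theorem exists_move (W N : ℕ) :
    ∃ C : Circuit, C.cost = N ∧ ∀ s : ℕ → ℝ, ∀ q < N, C.run s q = s (W + q) := by
  -- Copying in increasing order is safe even if the two blocks overlap: the wires from `k` on, in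
  -- particular the next source `W + k`, are still untouched.
  suffices ∀ k, ∃ C : Circuit, C.cost = k ∧ ∀ s : ℕ → ℝ, (∀ q < k, C.run s q = s (W + q)) ∧
      ∀ q ≥ k, C.run s q = s q by
    obtain ⟨C, hC, h⟩ := this N
    exact ⟨C, hC, fun s => (h s).1⟩
  intro k
  induction k with
  | zero => exact ⟨[], rfl, fun s => ⟨by simp, fun _ _ => rfl⟩⟩
  | succ k ih =>
    obtain ⟨C, hC, h⟩ := ih
    refine ⟨C ++ [Gate.select k (W + k) (W + k) (W + k)],
      by rw [Circuit.cost_append, hC]; rfl, fun s => ?_⟩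
    have hrun : (C ++ [Gate.select k (W + k) (W + k) (W + k)]).run s =
      (Gate.select k (W + k) (W + k) (W + k)).step (C.run s) := Circuit.run_append _ _ _
    rw [hrun]
    refine ⟨fun q hq => ?_, fun q hq => ?_⟩
    · rcases Nat.lt_succ_iff_lt_or_eq.mp hq with hq | rfl
      · rw [Gate.step_of_ne _ _ (by simp [Gate.target]; omega), (h s).1 q hq]
      · refine (Gate.step_target (.select q (W + q) (W + q) (W + q)) _).trans ?_
        simp only [Gate.value, ite_self]
        exact (h s).2 _ (by omega)
    · rw [Gate.step_of_ne _ _ (by simp [Gate.target]; omega), (h s).2 q (by omega)]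

/-- Every gate can be made to read its operands from consecutive wires. -/
theorem Gate.exists_relocate (g : Gate) (W : ℕ) : ∃ (N : ℕ) (ρ : ℕ → ℕ) (g' : Gate),
    N + g'.cost ≤ 4 * g.cost ∧ g'.target = W + N ∧
    ∀ s t : ℕ → ℝ, (∀ q < N, s (W + q) = t (ρ q)) → g'.value s = g.value t := by
  have hblock : ∀ (m base : ℕ) (s t : ℕ → ℝ),
      (∀ q < m * m, s (W + q) = t (base + q)) → block s W m = block t base m := by
    intro m base s t h
    ext i j
    have : (i : ℕ) * m + j < m * m := by
      have hi := i.2; have hj := j.2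
      nlinarith
    simpa [block, add_assoc] using h (i * m + j) this
  -- The factor `4` in `Reach.gate` pays for copying the operands and for the gate. It is attained
  -- by `select`, with three operands; the block gates copy only `m²` wires.
  have hm : ∀ m : ℕ, m * m + (m ^ 3 + 1) ≤ 4 * (m ^ 3 + 1) := by
    intro m
    have : m * m ≤ m ^ 3 := by
      rw [← sq]
      rcases Nat.eq_zero_or_pos m with rfl | h
      · simp
      · exact Nat.pow_le_pow_right h (by norm_num)
    omega
  cases g with
  | const d c => exact ⟨0, id, .const W c, by simp [Gate.cost], rfl, fun s t _ => rfl⟩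
  | sqrt d a =>
    refine ⟨1, fun _ => a, .sqrt (W + 1) W, by simp [Gate.cost], rfl, fun s t h => ?_⟩
    have h0 := h 0 (by norm_num)
    simp_all [Gate.value]
  | cos d a =>
    refine ⟨1, fun _ => a, .cos (W + 1) W, by simp [Gate.cost], rfl, fun s t h => ?_⟩
    have h0 := h 0 (by norm_num)
    simp_all [Gate.value]
  | sin d a =>
    refine ⟨1, fun _ => a, .sin (W + 1) W, by simp [Gate.cost], rfl, fun s t h => ?_⟩
    have h0 := h 0 (by norm_num)
    simp_all [Gate.value]
  | add d a b =>
    refine ⟨2, fun q => if q = 0 then a else b, .add (W + 2) W (W + 1), by simp [Gate.cost], rfl,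
      fun s t h => ?_⟩
    have h0 := h 0 (by norm_num)
    have h1 := h 1 (by norm_num)
    simp_all [Gate.value]
  | sub d a b =>
    refine ⟨2, fun q => if q = 0 then a else b, .sub (W + 2) W (W + 1), by simp [Gate.cost], rfl,
      fun s t h => ?_⟩
    have h0 := h 0 (by norm_num)
    have h1 := h 1 (by norm_num)
    simp_all [Gate.value]
  | mul d a b =>
    refine ⟨2, fun q => if q = 0 then a else b, .mul (W + 2) W (W + 1), by simp [Gate.cost], rfl,
      fun s t h => ?_⟩
    have h0 := h 0 (by norm_num)
    have h1 := h 1 (by norm_num)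
    simp_all [Gate.value]
  | div d a b =>
    refine ⟨2, fun q => if q = 0 then a else b, .div (W + 2) W (W + 1), by simp [Gate.cost], rfl,
      fun s t h => ?_⟩
    have h0 := h 0 (by norm_num)
    have h1 := h 1 (by norm_num)
    simp_all [Gate.value]
  | select d a b c =>
    refine ⟨3, fun q => if q = 0 then a else if q = 1 then b else c,
      .select (W + 3) W (W + 1) (W + 2), by simp [Gate.cost], rfl, fun s t h => ?_⟩
    have h0 := h 0 (by norm_num)
    have h1 := h 1 (by norm_num)
    have h2 := h 2 (by norm_num)
    simp_all [Gate.value]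
  | det d base m =>
    refine ⟨m * m, fun q => base + q, .det (W + m * m) W m, hm m, rfl, fun s t h => ?_⟩
    simp only [Gate.value, hblock m base s t h]
  | eig d base m k =>
    refine ⟨m * m, fun q => base + q, .eig (W + m * m) W m k, hm m, rfl, fun s t h => ?_⟩
    simp only [Gate.value, hblock m base s t h]

/-- All wires in use lie below `W`. Operands and results are written from `W` on, so no earlier
value is overwritten. -/
theorem Reach.exists_circuit {fs gs : Set (α → ℝ)} {c : ℕ} (h : Reach fs c gs)
    {init : α → ℕ → ℝ} {W₀ : ℕ} (hfs : ∀ f ∈ fs, ∃ w < W₀, ∀ a, init a w = f a) :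
    ∃ (C : Circuit) (W : ℕ), C.cost ≤ c ∧ ∀ f ∈ gs, ∃ w < W, ∀ a, C.run (init a) w = f a := by
  induction h with
  | refl => exact ⟨[], W₀, le_rfl, hfs⟩
  | @gate c gs h g s hs ih =>
    obtain ⟨C, W, hC, hW⟩ := ih
    obtain ⟨N, ρ, g', hcost, htar, hval⟩ := g.exists_relocate W
    obtain ⟨L, hL, hload⟩ := exists_load (s := fun a => C.run (init a)) (W := W)
      (f := fun q a => s a (ρ q)) (fun q => (hs (ρ q)).imp (hW _) id) le_rfl N
    have hrun : ∀ a, (C ++ L ++ [g']).run (init a) = g'.step (L.run (C.run (init a))) := fun a => by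
      rw [Circuit.run_append, Circuit.run_append]; rfl
    refine ⟨C ++ L ++ [g'], W + N + 1, ?_, ?_⟩
    · rw [Circuit.cost_append, Circuit.cost_append, hL, Circuit.cost_cons, Circuit.cost_nil]
      omega
    · rintro f (rfl | hf)
      · refine ⟨W + N, by omega, fun a => ?_⟩
        rw [hrun, ← htar, Gate.step_target]
        exact hval _ _ (hload a).1
      · obtain ⟨w, hw, hwf⟩ := hW f hf
        refine ⟨w, by omega, fun a => ?_⟩
        rw [hrun, Gate.step_of_ne _ _ (by omega), (hload a).2 w hw, hwf]

/-- The term `2 * N` pays for collecting the outputs in consecutive free wires and for moving that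
block to the front. -/
theorem Easy.exists_circuit {init : α → ℕ → ℝ} {W₀ : ℕ} (h0 : ∀ a, ∀ w ≥ W₀, init a w = 0)
    {fs : Set (α → ℝ)} (hfs : ∀ f ∈ fs, ∃ w, ∀ a, init a w = f a) {c : ℕ} {out : α → ℕ → ℝ}
    (h : Easy fs c (Set.range fun k a => out a k)) (N : ℕ) :
    ∃ C : Circuit, C.cost ≤ c + 2 * N ∧ ∀ a, ∀ k < N, C.run (init a) k = out a k := by
  obtain ⟨c', hc, gs, hgs, hR⟩ := h
  -- All input wires from `W₀` on hold `0`, so the single wire `W₀` stands for all of them and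
  -- finitely many wires suffice.
  obtain ⟨C, W, hC, hW⟩ := hR.exists_circuit (init := init) (W₀ := W₀ + 1) fun f hf => by
    obtain ⟨w, hw⟩ := hfs f hf
    by_cases hlt : w ≤ W₀
    · exact ⟨w, by omega, hw⟩
    · exact ⟨W₀, by omega, fun a => by rw [← hw, h0 a W₀ le_rfl, h0 a w (by omega)]⟩
  obtain ⟨L, hL, hload⟩ := exists_load (s := fun a => C.run (init a)) (W := W)
    (f := fun k a => out a k) (fun k => (hgs ⟨k, rfl⟩).imp (hW _) id) le_rfl N
  obtain ⟨D, hD, hmove⟩ := exists_move W N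
  refine ⟨C ++ L ++ D, ?_, fun a k hk => ?_⟩
  · rw [Circuit.cost_append, Circuit.cost_append]; omega
  · rw [Circuit.run_append, Circuit.run_append, hmove _ k hk]
    exact (hload a).1 k hk

/-! ### Matrices of functions -/

/-- The entries of a matrix that depends on a parameter. -/
def entryFns {m n : Type*} (X : α → Matrix m n ℝ) : Set (α → ℝ) :=
  Set.range fun (p : m × n) a => X a p.1 p.2

theorem mem_entryFns {m n : Type*} (X : α → Matrix m n ℝ) (i : m) (j : n) :
    (fun a => X a i j) ∈ entryFns X := ⟨(i, j), rfl⟩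

theorem entryFns_const {m n : Type*} (B : Matrix m n ℝ) (fs : Set (α → ℝ)) :
    entryFns (fun _ : α => B) ⊆ withConsts fs := by
  rintro _ ⟨p, rfl⟩
  exact const_mem_withConsts _ _

theorem entryFns_transpose {m n : Type*} (X : α → Matrix m n ℝ) :
    entryFns (fun a => (X a).transpose) = entryFns X := by
  ext f
  constructor <;> rintro ⟨p, rfl⟩ <;> exact ⟨p.swap, rfl⟩

theorem Easy.matrix_mul {n : ℕ} {fs : Set (α → ℝ)} {X Y : α → Matrix (Fin n) (Fin n) ℝ}
    (hX : entryFns X ⊆ withConsts fs) (hY : entryFns Y ⊆ withConsts fs) :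
    Easy fs (8 * n ^ 3) (entryFns fun a => X a * Y a) := by
  -- Each entry is a sum of `n` products, at `4` for each product and `4` for each addition.
  refine (Easy.range (c := n * 8) fun p => ?_).mono_cost (le_of_eq ?_)
  · have := Easy.sum Finset.univ fun k (_ : k ∈ (Finset.univ : Finset (Fin n))) =>
      (Easy.mem (hX (mem_entryFns X p.1 k)) 0).mul (Easy.mem (hY (mem_entryFns Y k p.2)) 0)
    simpa [Matrix.mul_apply] using this
  · simp; ring

end

end Trapdoor

/-! ### Lipschitz continuity of sorted eigenvalues, and measurability of circuits. -/

namespace Trapdoor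

noncomputable section

open Matrix

/-! ### Eigenvalues of the symmetric part -/

theorem isHermitian_symmPart {m : ℕ} (B : Matrix (Fin m) (Fin m) ℝ) :
    ((1 / 2 : ℝ) • (B + B.transpose)).IsHermitian := by
  ext i j
  simp; ring

theorem symmEigenvalue_eq {m : ℕ} (B : Matrix (Fin m) (Fin m) ℝ) (k : Fin m) :
    symmEigenvalue B k =
      (isHermitian_symmPart B).eigenvalues₀ (Fin.cast (Fintype.card_fin m).symm k) := by
  have hk : (k : ℕ) < Fintype.card (Fin m) := by simp
  rw [symmEigenvalue, dif_pos ⟨isHermitian_symmPart B, hk⟩]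
  rfl

theorem symmEigenvalue_antitone {m : ℕ} (B : Matrix (Fin m) (Fin m) ℝ) :
    Antitone fun k : Fin m => symmEigenvalue B k := by
  intro i j hij
  simp only [symmEigenvalue_eq]
  exact (isHermitian_symmPart B).eigenvalues₀_antitone hij

theorem exists_orthogonal_symmEigenvalue {m : ℕ} (B : Matrix (Fin m) (Fin m) ℝ) :
    ∃ W ∈ Matrix.orthogonalGroup (Fin m) ℝ, (1 / 2 : ℝ) • (B + Bᵀ) =
      W * Matrix.diagonal (fun k : Fin m => symmEigenvalue B k) * Wᵀ := by
  set hH := isHermitian_symmPart B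
  -- The spectral theorem uses `eigenvalues`, whose indexing goes through an arbitrary bijection;
  -- `e` translates it to the decreasing order of `symmEigenvalue`.
  let e : Fin m ≃ Fin m := (finCongr (Fintype.card_fin m).symm).trans
    (Fintype.equivOfCardEq (Fintype.card_fin _))
  have he : ∀ k, hH.eigenvalues (e k) = symmEigenvalue B k := by
    intro k
    rw [symmEigenvalue_eq, Matrix.IsHermitian.eigenvalues]
    simp [e]
  let V : Matrix (Fin m) (Fin m) ℝ := hH.eigenvectorUnitary
  have hV : V * Vᵀ = 1 := (Matrix.mem_orthogonalGroup_iff _ _).mp hH.eigenvectorUnitary.2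
  refine ⟨V.submatrix id e, ?_, ?_⟩
  · rw [Matrix.mem_orthogonalGroup_iff]
    change V.submatrix id e * (V.submatrix id e)ᵀ = 1
    rw [Matrix.transpose_submatrix, Matrix.submatrix_mul_equiv, hV]
    simp
  · have hs : (1 / 2 : ℝ) • (B + Bᵀ) = V * Matrix.diagonal hH.eigenvalues * Vᵀ := by
      have := hH.spectral_theorem
      rw [Unitary.conjStarAlgAut_apply] at this
      exact this
    have hd : Matrix.diagonal (fun k : Fin m => symmEigenvalue B k) =
        (Matrix.diagonal hH.eigenvalues).submatrix e e := by
      rw [Matrix.submatrix_diagonal_equiv]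
      congr 1
      ext k
      exact (he k).symm
    rw [hs, hd, Matrix.transpose_submatrix, Matrix.submatrix_mul_equiv, Matrix.submatrix_mul_equiv]
    simp

theorem dotProduct_conj_diagonal {m : ℕ} (W : Matrix (Fin m) (Fin m) ℝ) (d x : Fin m → ℝ) :
    x ⬝ᵥ (W * Matrix.diagonal d * Wᵀ) *ᵥ x = ∑ i, d i * (Wᵀ *ᵥ x) i ^ 2 := by
  rw [← Matrix.mulVec_mulVec, ← Matrix.mulVec_mulVec, Matrix.dotProduct_mulVec,
    ← Matrix.mulVec_transpose]
  simp only [dotProduct, Matrix.mulVec_diagonal]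
  exact Finset.sum_congr rfl fun i _ => by ring

/-- Weyl's inequality by the Courant–Fischer dimension count. Some nonzero `x` is orthogonal to the
eigenvectors of `B` of index above `k` and to those of `B'` of index below `k`. On this `x` the form
of `B` is at least its `k`-th eigenvalue times `|x|²`, and the form of `B'` at most its own. -/
theorem symmEigenvalue_sub_le {m : ℕ} (B B' : Matrix (Fin m) (Fin m) ℝ) (k : Fin m) (δ : ℝ)
    (h : ∀ i j, |B i j - B' i j| ≤ δ) : symmEigenvalue B k - symmEigenvalue B' k ≤ m * δ := by
  obtain ⟨W, hW, hB⟩ := exists_orthogonal_symmEigenvalue B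
  obtain ⟨W', hW', hB'⟩ := exists_orthogonal_symmEigenvalue B'
  have hnorm : ∀ U ∈ Matrix.orthogonalGroup (Fin m) ℝ, ∀ x : Fin m → ℝ,
      ∑ i, (Uᵀ *ᵥ x) i ^ 2 = ∑ i, x i ^ 2 := by
    intro U hU x
    have h1 := dotProduct_conj_diagonal U 1 x
    have h2 : U * Matrix.diagonal 1 * Uᵀ = 1 := by
      rw [show Matrix.diagonal (1 : Fin m → ℝ) = 1 from Matrix.diagonal_one, mul_one]
      exact (Matrix.mem_orthogonalGroup_iff _ _).mp hU
    rw [h2, Matrix.one_mulVec] at h1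
    simp only [Pi.one_apply, one_mul] at h1
    rw [← h1]
    simp [dotProduct, sq]
  -- These are `m - 1` linear conditions, one for each index other than `k`, so the kernel is
  -- nontrivial.
  let L : (Fin m → ℝ) →ₗ[ℝ] ({i : Fin m // i ≠ k} → ℝ) :=
    LinearMap.pi fun i => if k < i.1 then LinearMap.proj i.1 ∘ₗ Wᵀ.mulVecLin
      else LinearMap.proj i.1 ∘ₗ W'ᵀ.mulVecLin
  have hker : LinearMap.ker L ≠ ⊥ := by
    apply LinearMap.ker_ne_bot_of_finrank_lt
    have := k.2
    simp [Fintype.card_subtype_compl]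
    omega
  obtain ⟨x, hx, hx0⟩ := Submodule.exists_mem_ne_zero_of_ne_bot hker
  have hLx : ∀ i : Fin m, i ≠ k → (if k < i then (Wᵀ *ᵥ x) i else (W'ᵀ *ᵥ x) i) = 0 := by
    intro i hi
    have := congrFun (LinearMap.mem_ker.mp hx) ⟨i, hi⟩
    simp only [L, LinearMap.pi_apply] at this
    split_ifs at this ⊢ <;> exact this
  have hpos : 0 < ∑ i, x i ^ 2 := by
    obtain ⟨i, hi⟩ := Function.ne_iff.mp hx0
    exact Finset.sum_pos' (fun _ _ => sq_nonneg _) ⟨i, Finset.mem_univ _, by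
      have : x i ≠ 0 := hi
      positivity⟩
  have h1 : symmEigenvalue B k * ∑ i, x i ^ 2 ≤ x ⬝ᵥ ((1 / 2 : ℝ) • (B + Bᵀ)) *ᵥ x := by
    rw [hB, dotProduct_conj_diagonal, ← hnorm W hW x, Finset.mul_sum]
    refine Finset.sum_le_sum fun i _ => ?_
    rcases le_or_gt i k with hik | hik
    · exact mul_le_mul_of_nonneg_right (symmEigenvalue_antitone B hik) (sq_nonneg _)
    · have := hLx i hik.ne'
      rw [if_pos hik] at this
      simp [this]
  have h2 : x ⬝ᵥ ((1 / 2 : ℝ) • (B' + B'ᵀ)) *ᵥ x ≤ symmEigenvalue B' k * ∑ i, x i ^ 2 := by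
    rw [hB', dotProduct_conj_diagonal, ← hnorm W' hW' x, Finset.mul_sum]
    refine Finset.sum_le_sum fun i _ => ?_
    rcases le_or_gt k i with hik | hik
    · exact mul_le_mul_of_nonneg_right (symmEigenvalue_antitone B' hik) (sq_nonneg _)
    · have := hLx i hik.ne
      rw [if_neg hik.not_gt] at this
      simp [this]
  -- The factor `m` arises from bounding `|xᵢ xⱼ|` by `(xᵢ² + xⱼ²) / 2` and summing over all pairs.
  have h3 : x ⬝ᵥ ((1 / 2 : ℝ) • (B + Bᵀ)) *ᵥ x - x ⬝ᵥ ((1 / 2 : ℝ) • (B' + B'ᵀ)) *ᵥ x ≤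
      m * δ * ∑ i, x i ^ 2 := by
    have hexp : ∀ D : Matrix (Fin m) (Fin m) ℝ, x ⬝ᵥ ((1 / 2 : ℝ) • (D + Dᵀ)) *ᵥ x =
        ∑ i, ∑ j, x i * ((1 / 2) * (D i j + D j i)) * x j := by
      intro D
      simp only [dotProduct, Matrix.mulVec, Finset.mul_sum]
      refine Finset.sum_congr rfl fun i _ => Finset.sum_congr rfl fun j _ => ?_
      simp [Matrix.smul_apply, Matrix.add_apply]
      ring
    rw [hexp, hexp, ← Finset.sum_sub_distrib]
    have hterm : ∀ i j, x i * ((1 / 2) * (B i j + B j i)) * x j -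
        x i * ((1 / 2) * (B' i j + B' j i)) * x j ≤ δ * ((x i ^ 2 + x j ^ 2) / 2) := by
      intro i j
      have hb : |(1 / 2) * (B i j - B' i j) + (1 / 2) * (B j i - B' j i)| ≤ δ := by
        have h1 := abs_le.mp (h i j)
        have h2 := abs_le.mp (h j i)
        rw [abs_le]; constructor <;> linarith
      calc _ = ((1 / 2) * (B i j - B' i j) + (1 / 2) * (B j i - B' j i)) * (x i * x j) := by ring
        _ ≤ |(1 / 2) * (B i j - B' i j) + (1 / 2) * (B j i - B' j i)| * |x i * x j| := by
            rw [← abs_mul]; exact le_abs_self _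
        _ ≤ δ * ((x i ^ 2 + x j ^ 2) / 2) := by
            have : |x i * x j| ≤ (x i ^ 2 + x j ^ 2) / 2 := by
              rw [abs_le]
              constructor <;> nlinarith [sq_nonneg (x i - x j), sq_nonneg (x i + x j)]
            exact mul_le_mul hb this (abs_nonneg _) ((abs_nonneg _).trans hb)
    calc _ ≤ ∑ i, ∑ j, δ * ((x i ^ 2 + x j ^ 2) / 2) := by
          refine Finset.sum_le_sum fun i _ => ?_
          rw [← Finset.sum_sub_distrib]
          exact Finset.sum_le_sum fun j _ => hterm i j
      _ = m * δ * ∑ i, x i ^ 2 := by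
          simp only [← Finset.mul_sum, ← Finset.sum_div, Finset.sum_add_distrib, Finset.sum_const,
            Finset.card_univ, Fintype.card_fin, nsmul_eq_mul]
          ring
  have h4 : (symmEigenvalue B k - symmEigenvalue B' k) * ∑ i, x i ^ 2 ≤
      m * δ * ∑ i, x i ^ 2 := by rw [sub_mul]; linarith
  exact le_of_mul_le_mul_right h4 hpos

/-- For `k < m`, the preceding inequality in both directions makes the eigenvalue `m`-Lipschitz for
the sup distance of entries, hence continuous. -/
theorem measurable_symmEigenvalue (m k : ℕ) :
    Measurable fun B : Matrix (Fin m) (Fin m) ℝ => symmEigenvalue B k := by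
  by_cases hk : k < m
  · have : LipschitzWith m fun B : Fin m → Fin m → ℝ =>
        symmEigenvalue (Matrix.of B) ((⟨k, hk⟩ : Fin m) : ℕ) := by
      refine LipschitzWith.of_dist_le_mul fun B B' => ?_
      have hd : ∀ i j, |B i j - B' i j| ≤ dist B B' := fun i j =>
        (dist_le_pi_dist (B i) (B' i) j).trans (dist_le_pi_dist B B' i)
      rw [Real.dist_eq, abs_le]
      constructor
      · have := symmEigenvalue_sub_le (Matrix.of B') (Matrix.of B) ⟨k, hk⟩ (dist B B')
          fun i j => by simpa [abs_sub_comm] using hd i j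
        push_cast
        linarith
      · exact symmEigenvalue_sub_le (Matrix.of B) (Matrix.of B') ⟨k, hk⟩ (dist B B') hd
    exact this.continuous.measurable
  · have : (fun B : Matrix (Fin m) (Fin m) ℝ => symmEigenvalue B k) = fun _ => 0 := by
      ext B
      exact dif_neg fun h => hk (by simpa using h.2)
    rw [this]
    exact measurable_const

/-! ### Measurability of circuits -/

theorem measurable_block (base m : ℕ) : Measurable fun s : ℕ → ℝ => block s base m :=
  measurable_pi_lambda _ fun _ => measurable_pi_lambda _ fun _ => measurable_pi_apply _

theorem Gate.measurable_value (g : Gate) : Measurable fun s : ℕ → ℝ => g.value s := by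
  have hp : ∀ a : ℕ, Measurable fun s : ℕ → ℝ => s a := fun a => measurable_pi_apply a
  have hI : ∀ a : ℕ, MeasurableSet {s : ℕ → ℝ | 0 ≤ s a ∧ s a ≤ 2 * Real.pi} := fun a =>
    (measurableSet_le measurable_const (hp a)).inter (measurableSet_le (hp a) measurable_const)
  cases g with
  | const d c => exact measurable_const
  | add d a b => exact (hp a).add (hp b)
  | sub d a b => exact (hp a).sub (hp b)
  | mul d a b => exact (hp a).mul (hp b)
  | div d a b => exact (hp a).div (hp b)
  | sqrt d a => exact (hp a).sqrt
  | cos d a => exact Measurable.ite (hI a) (Real.measurable_cos.comp (hp a)) measurable_const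
  | sin d a => exact Measurable.ite (hI a) (Real.measurable_sin.comp (hp a)) measurable_const
  | select d a b c =>
    exact Measurable.ite (measurableSet_le (hp a) measurable_const) (hp b) (hp c)
  | det d base m =>
    have hdet : Continuous fun A : Matrix (Fin m) (Fin m) ℝ => A.det := continuous_id.matrix_det
    exact hdet.measurable.comp (measurable_block base m)
  | eig d base m k => exact (measurable_symmEigenvalue m k).comp (measurable_block base m)

theorem Circuit.measurable_run (C : Circuit) : Measurable C.run := by
  induction C with
  | nil => exact measurable_id
  | cons g C ih =>
    refine ih.comp (measurable_pi_lambda _ fun w => ?_)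
    by_cases hw : w = g.target
    · subst hw
      simpa only [Gate.step_target] using g.measurable_value
    · simpa only [Gate.step_of_ne _ _ hw] using measurable_pi_apply w

end

end Trapdoor

/-! ### Matrix decompositions with rotations instead of orthogonal matrices. -/

namespace Trapdoor

noncomputable section

open Matrix

/-! ### Spectral and singular value decompositions over the rotation group -/

theorem det_mul_self_of_mem_orthogonalGroup {n : ℕ} {W : Matrix (Fin n) (Fin n) ℝ}
    (hW : W ∈ Matrix.orthogonalGroup (Fin n) ℝ) : W.det * W.det = 1 := by
  have h : W * Wᵀ = 1 := (Matrix.mem_orthogonalGroup_iff _ _).mp hW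
  have := congrArg Matrix.det h
  rwa [Matrix.det_mul, Matrix.det_one, Matrix.det_transpose] at this

/-- Multiplying the last column by the determinant makes the determinant `1`. The signs are recorded
explicitly so that a diagonal factor can absorb them. -/
theorem exists_signs_mem_SO {n : ℕ} {W : Matrix (Fin n) (Fin n) ℝ}
    (hW : W ∈ Matrix.orthogonalGroup (Fin n) ℝ) :
    ∃ ε : Fin n → ℝ, (∀ i : Fin n, (i : ℕ) + 1 ≠ n → ε i = 1) ∧ (∀ i, ε i * ε i = 1) ∧
      (∀ i : Fin n, (i : ℕ) + 1 = n → ε i = W.det) ∧ W * Matrix.diagonal ε ∈ SO n := by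
  have hdet := det_mul_self_of_mem_orthogonalGroup hW
  have hsq : ∀ i : Fin n, (if (i : ℕ) + 1 = n then W.det else 1) *
      (if (i : ℕ) + 1 = n then W.det else 1) = 1 := fun i => by
    split_ifs
    · exact hdet
    · norm_num
  refine ⟨fun i => if (i : ℕ) + 1 = n then W.det else 1, fun i hi => if_neg hi, hsq,
    fun i hi => if_pos hi, ?_⟩
  have horth : Matrix.diagonal (fun i : Fin n => if (i : ℕ) + 1 = n then W.det else 1) ∈
      Matrix.orthogonalGroup (Fin n) ℝ := by
    rw [Matrix.mem_orthogonalGroup_iff]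
    rw [Matrix.diagonal_transpose, Matrix.diagonal_mul_diagonal]
    simp only [hsq]
    exact Matrix.diagonal_one
  refine Matrix.mem_specialOrthogonalGroup_iff.mpr ⟨mul_mem hW horth, ?_⟩
  rw [Matrix.det_mul, Matrix.det_diagonal]
  cases n with
  | zero => simp
  | succ n =>
    rw [Fin.prod_univ_castSucc, Finset.prod_eq_one fun i _ => if_neg (by simp; omega)]
    simpa using hdet

theorem SO.coe_inv {n : ℕ} (O : SO n) :
    ((O⁻¹ : SO n) : Matrix (Fin n) (Fin n) ℝ) = (O : Matrix (Fin n) (Fin n) ℝ)ᵀ := rfl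

/-- The eigenvalues of a symmetric matrix, as a diagonal matrix. -/
def eigDiag {n : ℕ} (A : Matrix (Fin n) (Fin n) ℝ) : Matrix (Fin n) (Fin n) ℝ :=
  Matrix.diagonal fun k => symmEigenvalue A k

/-- Conjugating a diagonal matrix by a diagonal sign matrix does not change it, so the sign
correction costs nothing. -/
theorem exists_SO_eigDiag {n : ℕ} {A : Matrix (Fin n) (Fin n) ℝ} (hA : A.IsSymm) :
    ∃ O : SO n, A = (O : Matrix (Fin n) (Fin n) ℝ) * eigDiag A *
      (O : Matrix (Fin n) (Fin n) ℝ)ᵀ := by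
  obtain ⟨W, hW, h⟩ := exists_orthogonal_symmEigenvalue A
  obtain ⟨ε, -, hε, -, hSO⟩ := exists_signs_mem_SO hW
  refine ⟨⟨_, hSO⟩, ?_⟩
  have hA' : (1 / 2 : ℝ) • (A + Aᵀ) = A := by
    rw [hA.eq, ← two_smul ℝ A, smul_smul]
    norm_num
  rw [hA'] at h
  have hd : Matrix.diagonal ε * eigDiag A * Matrix.diagonal ε = eigDiag A := by
    rw [eigDiag, Matrix.diagonal_mul_diagonal, Matrix.diagonal_mul_diagonal]
    congr 1
    ext i
    rw [mul_right_comm, hε, one_mul]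
  change A = W * Matrix.diagonal ε * eigDiag A * (W * Matrix.diagonal ε)ᵀ
  rw [Matrix.transpose_mul, Matrix.diagonal_transpose]
  calc A = W * eigDiag A * Wᵀ := h
    _ = W * (Matrix.diagonal ε * eigDiag A * Matrix.diagonal ε) * Wᵀ := by rw [hd]
    _ = _ := by simp only [Matrix.mul_assoc]

/-- The singular values of a matrix in decreasing order, the last one with the sign of the
determinant. -/
def signedSing {n : ℕ} (A : Matrix (Fin n) (Fin n) ℝ) (k : Fin n) : ℝ :=
  if (k : ℕ) + 1 = n then
    if A.det ≤ 0 then -Real.sqrt (symmEigenvalue (Aᵀ * A) k)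
    else Real.sqrt (symmEigenvalue (Aᵀ * A) k)
  else Real.sqrt (symmEigenvalue (Aᵀ * A) k)

def singDiag {n : ℕ} (A : Matrix (Fin n) (Fin n) ℝ) : Matrix (Fin n) (Fin n) ℝ :=
  Matrix.diagonal (signedSing A)

/-- If `V` diagonalizes `AᵀA`, the columns of `A V` are orthogonal with squared lengths the
eigenvalues. The nonzero ones are normalized and completed to an orthonormal basis, which gives `U`.
-/
theorem exists_orthogonal_svd {n : ℕ} (A : Matrix (Fin n) (Fin n) ℝ) :
    ∃ U ∈ Matrix.orthogonalGroup (Fin n) ℝ, ∃ V ∈ Matrix.orthogonalGroup (Fin n) ℝ,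
      A = U * Matrix.diagonal (fun k : Fin n => Real.sqrt (symmEigenvalue (Aᵀ * A) k)) * Vᵀ := by
  obtain ⟨V, hV, h⟩ := exists_orthogonal_symmEigenvalue (Aᵀ * A)
  set l : Fin n → ℝ := fun k => symmEigenvalue (Aᵀ * A) k with hl
  have hS : (1 / 2 : ℝ) • (Aᵀ * A + (Aᵀ * A)ᵀ) = Aᵀ * A := by
    rw [Matrix.transpose_mul, Matrix.transpose_transpose, ← two_smul ℝ (Aᵀ * A), smul_smul]
    norm_num
  rw [hS] at h
  have hV1 : V * Vᵀ = 1 := (Matrix.mem_orthogonalGroup_iff _ _).mp hV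
  have hV2 : Vᵀ * V = 1 := (Matrix.mem_orthogonalGroup_iff' _ _).mp hV
  have hgram : (A * V)ᵀ * (A * V) = Matrix.diagonal l := by
    calc (A * V)ᵀ * (A * V) = Vᵀ * (Aᵀ * A) * V := by
          rw [Matrix.transpose_mul]; simp only [Matrix.mul_assoc]
      _ = (Vᵀ * V) * Matrix.diagonal l * (Vᵀ * V) := by rw [h]; simp only [Matrix.mul_assoc]
      _ = _ := by rw [hV2, one_mul, mul_one]
  have hcol : ∀ i j, ∑ k, (A * V) k i * (A * V) k j = if i = j then l i else 0 := by
    intro i j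
    have := congrFun (congrFun hgram i) j
    rwa [Matrix.mul_apply, Matrix.diagonal_apply] at this
  have hl0 : ∀ i, 0 ≤ l i := by
    intro i
    have := hcol i i
    rw [if_pos rfl] at this
    rw [← this]
    exact Finset.sum_nonneg fun k _ => mul_self_nonneg _
  -- For a zero eigenvalue the convention `0⁻¹ = 0` makes this vector zero; only the other indices
  -- enter the orthonormal family.
  let v : Fin n → EuclideanSpace ℝ (Fin n) := fun i =>
    WithLp.toLp 2 fun k => (Real.sqrt (l i))⁻¹ * (A * V) k i
  have hinner : ∀ i j, inner ℝ (v i) (v j) =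
      (Real.sqrt (l i))⁻¹ * (Real.sqrt (l j))⁻¹ * if i = j then l i else 0 := by
    intro i j
    rw [← hcol, Finset.mul_sum]
    simp only [v, PiLp.inner_apply]
    refine Finset.sum_congr rfl fun k _ => ?_
    simp
    ring
  have hv : Orthonormal ℝ (({i | l i ≠ 0} : Set (Fin n)).domRestrict v) := by
    rw [orthonormal_iff_ite]
    rintro ⟨i, hi⟩ ⟨j, hj⟩
    change inner ℝ (v i) (v j) = _
    rw [hinner]
    by_cases hij : i = j
    · subst hij
      have hpos : 0 < l i := lt_of_le_of_ne (hl0 i) (Ne.symm hi)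
      have := (Real.sqrt_pos.mpr hpos).ne'
      simp only [if_true]
      nth_rewrite 3 [← Real.mul_self_sqrt (hl0 i)]
      field_simp
    · rw [if_neg hij, if_neg (by simpa using hij), mul_zero]
  obtain ⟨b, hb⟩ := hv.exists_orthonormalBasis_extension_of_card_eq (by simp)
  let U : Matrix (Fin n) (Fin n) ℝ := Matrix.of fun k i => b i k
  have hU : U ∈ Matrix.orthogonalGroup (Fin n) ℝ := by
    rw [Matrix.mem_orthogonalGroup_iff']
    ext i j
    have := orthonormal_iff_ite.mp b.orthonormal i j
    rw [PiLp.inner_apply] at this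
    rw [Matrix.one_apply, ← this]
    change (Uᵀ * U) i j = _
    rw [Matrix.mul_apply]
    refine Finset.sum_congr rfl fun k _ => ?_
    simp [U, mul_comm]
  refine ⟨U, hU, V, hV, ?_⟩
  have hAV : A * V = U * Matrix.diagonal fun i => Real.sqrt (l i) := by
    ext k i
    rw [Matrix.mul_diagonal]
    by_cases hi : l i = 0
    · have h0 := hcol i i
      rw [if_pos rfl, hi, Finset.sum_eq_zero_iff_of_nonneg fun _ _ => mul_self_nonneg _] at h0
      simp [hi, mul_self_eq_zero.mp (h0 k (Finset.mem_univ _))]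
    · have hpos : 0 < l i := lt_of_le_of_ne (hl0 i) (Ne.symm hi)
      have := (Real.sqrt_pos.mpr hpos).ne'
      simp only [U, Matrix.of_apply, hb i hi, v]
      field_simp
  rw [← hAV, Matrix.mul_assoc, hV1, mul_one]

/-- Making `U` and `V` rotations changes the sign of the last singular value by `det U * det V`.
This is the sign of `det A` if `A` is invertible, which is the sign built into `signedSing`. -/
theorem exists_SO_singDiag {n : ℕ} (A : Matrix (Fin n) (Fin n) ℝ) :
    ∃ U V : SO n, A = (U : Matrix (Fin n) (Fin n) ℝ) * singDiag A * (V : Matrix (Fin n) (Fin n) ℝ)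
      := by
  obtain ⟨U, hU, V, hV, h⟩ := exists_orthogonal_svd A
  set σ : Fin n → ℝ := fun k => Real.sqrt (symmEigenvalue (Aᵀ * A) k) with hσ
  obtain ⟨ε, hε1, hε, hεU, hSOU⟩ := exists_signs_mem_SO hU
  obtain ⟨η, hη1, hη, hηV, hSOV⟩ := exists_signs_mem_SO hV
  have hdetU := det_mul_self_of_mem_orthogonalGroup hU
  have hdetV := det_mul_self_of_mem_orthogonalGroup hV
  have hprod : 0 ≤ ∏ i, σ i := Finset.prod_nonneg fun _ _ => Real.sqrt_nonneg _
  have hdetA : A.det = U.det * V.det * ∏ i, σ i := by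
    have := congrArg Matrix.det h
    rw [Matrix.det_mul, Matrix.det_mul, Matrix.det_diagonal, Matrix.det_transpose] at this
    rw [this]; ring
  have hsign : U.det * V.det = 1 ∨ U.det * V.det = -1 :=
    mul_self_eq_one_iff.mp (by linear_combination V.det * V.det * hdetU + hdetV)
  have hkey : ∀ i, ε i * signedSing A i * η i = σ i := by
    intro i
    by_cases hi : (i : ℕ) + 1 = n
    · rw [hεU i hi, hηV i hi, signedSing, if_pos hi]
      change U.det * (if A.det ≤ 0 then -σ i else σ i) * V.det = σ i
      by_cases hd : A.det ≤ 0
      · rw [if_pos hd]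
        rcases hsign with hs | hs
        -- Here `det A` is both nonpositive and a product of singular values, so one of these is
        -- zero. The last is the smallest, hence zero, and its sign is irrelevant.
        · rw [hs, one_mul] at hdetA
          obtain ⟨j, -, hj⟩ := Finset.prod_eq_zero_iff.mp (le_antisymm (hdetA ▸ hd) hprod)
          have hle : σ i ≤ σ j := Real.sqrt_le_sqrt (symmEigenvalue_antitone _ (by
            rw [Fin.le_def]; omega))
          have h0 : σ i = 0 := le_antisymm (hj ▸ hle) (Real.sqrt_nonneg _)
          rw [h0]; ring
        · linear_combination -σ i * hs
      · rw [if_neg hd]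
        rcases hsign with hs | hs
        · linear_combination σ i * hs
        · rw [hs] at hdetA
          exact absurd (by rw [hdetA]; linarith) hd
    · rw [hε1 i hi, hη1 i hi, signedSing, if_neg hi, one_mul, mul_one]
  refine ⟨⟨_, hSOU⟩, (⟨_, hSOV⟩ : SO n)⁻¹, ?_⟩
  rw [SO.coe_inv]
  change A = U * Matrix.diagonal ε * singDiag A * (V * Matrix.diagonal η)ᵀ
  rw [Matrix.transpose_mul, Matrix.diagonal_transpose]
  calc A = U * Matrix.diagonal σ * Vᵀ := h
    _ = U * (Matrix.diagonal ε * singDiag A * Matrix.diagonal η) * Vᵀ := by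
      rw [singDiag, Matrix.diagonal_mul_diagonal, Matrix.diagonal_mul_diagonal]
      congr 3
      ext i
      exact (hkey i).symm
    _ = _ := by simp only [Matrix.mul_assoc]

end

end Trapdoor

/-! ### Invariant laws as products of independent Haar and diagonal factors. -/

namespace Trapdoor

noncomputable section

open Matrix

/-- Real `n × n` matrices. -/
abbrev Mat (n : ℕ) := Matrix (Fin n) (Fin n) ℝ

/-! ### Measurable matrix operations -/

theorem measurable_matrix_iff {α : Type*} [MeasurableSpace α] {n : ℕ}
    {X : α → Mat n} : Measurable X ↔ ∀ i j, Measurable fun a => X a i j :=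
  ⟨fun h i j => (measurable_pi_apply j).comp ((measurable_pi_apply i).comp h),
    fun h => measurable_pi_lambda _ fun i => measurable_pi_lambda _ fun j => h i j⟩

theorem measurable_matrix_mul {α : Type*} [MeasurableSpace α] {n : ℕ}
    {X Y : α → Mat n} (hX : Measurable X) (hY : Measurable Y) :
    Measurable fun a => X a * Y a := by
  rw [measurable_matrix_iff] at *
  intro i j
  simp only [Matrix.mul_apply]
  exact Finset.measurable_sum _ fun k _ => (hX i k).mul (hY k j)

theorem measurable_matrix_transpose {α : Type*} [MeasurableSpace α] {n : ℕ}
    {X : α → Mat n} (hX : Measurable X) : Measurable fun a => (X a)ᵀ := by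
  rw [measurable_matrix_iff] at *
  exact fun i j => hX j i

theorem measurable_eigDiag (n : ℕ) :
    Measurable (eigDiag : Mat n → Mat n) := by
  refine measurable_matrix_iff.mpr fun i j => ?_
  simp only [eigDiag, Matrix.diagonal_apply]
  split_ifs
  · exact measurable_symmEigenvalue n _
  · exact measurable_const

theorem measurable_signedSing {n : ℕ} (k : Fin n) :
    Measurable fun A : Mat n => signedSing A k := by
  have hs : Measurable fun A : Mat n =>
      Real.sqrt (symmEigenvalue (Aᵀ * A) k) :=
    ((measurable_symmEigenvalue n k).comp
      (measurable_matrix_mul (measurable_matrix_transpose measurable_id) measurable_id)).sqrt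
  have hdet : Measurable fun A : Mat n => A.det :=
    (continuous_id.matrix_det).measurable
  unfold signedSing
  split_ifs
  · exact Measurable.ite (measurableSet_le hdet measurable_const) hs.neg hs
  · exact hs

theorem measurable_singDiag (n : ℕ) :
    Measurable (singDiag : Mat n → Mat n) := by
  refine measurable_matrix_iff.mpr fun i j => ?_
  simp only [singDiag, Matrix.diagonal_apply]
  split_ifs
  · exact measurable_signedSing i
  · exact measurable_const

/-! ### Invariant distributions in terms of the Haar measure -/

instance isProbabilityMeasure_haarSO (n : ℕ) : IsProbabilityMeasure (haarSO n) :=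
  ⟨by simpa [haarSO] using Measure.haarMeasure_self (K₀ := (⊤ : TopologicalSpace.PositiveCompacts (SO n)))⟩

instance isHaarMeasure_haarSO (n : ℕ) : (haarSO n).IsHaarMeasure := by
  unfold haarSO; infer_instance

/-- A right translate of the Haar measure is again a left Haar measure of mass one, and that measure
is unique. -/
instance isMulRightInvariant_haarSO (n : ℕ) : (haarSO n).IsMulRightInvariant where
  map_mul_right_eq_self g := by
    have : IsProbabilityMeasure ((haarSO n).map (· * g)) :=
      Measure.isProbabilityMeasure_map (continuous_mul_const g).measurable.aemeasurable
    exact Measure.isHaarMeasure_eq_of_isProbabilityMeasure _ _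

instance isProbabilityMeasure_haarMatrix (n : ℕ) : IsProbabilityMeasure (haarMatrix n) :=
  Measure.isProbabilityMeasure_map measurable_subtype_coe.aemeasurable

/-- For fixed symmetric `A = O Δ Oᵀ` one has `Q A Qᵀ = (Q O) Δ (Q O)ᵀ`, and `Q O` is Haar if `Q` is.
Integrating over `A` requires no measurable choice of `O`. -/
theorem IsSymmHaarInvariant.eq_map {n : ℕ} {μ : Measure (Mat n)}
    [IsProbabilityMeasure μ] (h : IsSymmHaarInvariant μ) :
    ((haarMatrix n).prod (μ.map eigDiag)).map (fun p => p.1 * p.2 * p.1ᵀ) = μ := by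
  have hc : Measurable (Subtype.val : SO n → Mat n) := measurable_subtype_coe
  have hm : Measurable fun p : Mat n × Mat n =>
      p.1 * p.2 * p.1ᵀ :=
    measurable_matrix_mul (measurable_matrix_mul measurable_fst measurable_snd)
      (measurable_matrix_transpose measurable_fst)
  have hm1 : Measurable fun p : SO n × Mat n =>
      (p.1 : Mat n) * p.2 * (p.1 : Mat n)ᵀ :=
    measurable_matrix_mul (measurable_matrix_mul (hc.comp measurable_fst) measurable_snd)
      (measurable_matrix_transpose (hc.comp measurable_fst))
  have hm2 : Measurable fun p : SO n × Mat n =>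
      (p.1 : Mat n) * eigDiag p.2 * (p.1 : Mat n)ᵀ :=
    measurable_matrix_mul (measurable_matrix_mul (hc.comp measurable_fst)
      ((measurable_eigDiag n).comp measurable_snd))
      (measurable_matrix_transpose (hc.comp measurable_fst))
  have h2 : ((haarSO n).prod μ).map (fun p => (p.1 : Mat n) * p.2 *
      (p.1 : Mat n)ᵀ) = μ := h.2
  conv_rhs => rw [← h2]
  rw [haarMatrix, Measure.map_prod_map _ _ hc (measurable_eigDiag n),
    Measure.map_map hm (hc.prodMap (measurable_eigDiag n))]
  have hcomp : (fun p : Mat n × Mat n => p.1 * p.2 * p.1ᵀ) ∘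
      Prod.map (Subtype.val : SO n → Mat n) eigDiag =
    fun p : SO n × Mat n => (p.1 : Mat n) * eigDiag p.2 * (p.1 : Mat n)ᵀ := rfl
  rw [hcomp]
  ext E hE
  rw [Measure.map_apply hm2 hE,
    Measure.map_apply hm1 hE, Measure.prod_apply_symm (hm1 hE), Measure.prod_apply_symm (hm2 hE)]
  refine lintegral_congr_ae (h.1.mono fun A hA => ?_)
  obtain ⟨O, hO⟩ := exists_SO_eigDiag hA
  change haarSO n {Q | (Q : Mat n) * eigDiag A *
      (Q : Mat n)ᵀ ∈ E} =
    haarSO n {Q | (Q : Mat n) * A * (Q : Mat n)ᵀ ∈ E}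
  rw [← measure_preimage_mul_right (haarSO n) O]
  congr 1
  ext Q
  simp only [Set.mem_preimage, Set.mem_ofPred_eq]
  conv_rhs => rw [hO]
  rw [show ((Q * O : SO n) : Mat n) = (Q : Mat n) * O
    from rfl, Matrix.transpose_mul]
  simp only [Matrix.mul_assoc]

/-- The two invariances together make `O A O'` distributed as `A`. For fixed `A = U Σ V`,
translation by `U` on the right and by `V` on the left then absorbs both factors into the Haar
rotations. -/
theorem IsHaarInvariant.eq_map {n : ℕ} {μ : Measure (Mat n)}
    [IsProbabilityMeasure μ] (h : IsHaarInvariant μ) :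
    ((haarMatrix n).prod ((μ.map singDiag).prod (haarMatrix n))).map
      (fun p => p.1 * p.2.1 * p.2.2) = μ := by
  have hc : Measurable (Subtype.val : SO n → Mat n) := measurable_subtype_coe
  have hm : Measurable fun p : Mat n × Mat n × Mat n => p.1 * p.2.1 * p.2.2 :=
    measurable_matrix_mul (measurable_matrix_mul measurable_fst measurable_snd.fst)
      measurable_snd.snd
  have hs := measurable_singDiag n
  have hm1 : Measurable fun p : SO n × Mat n × SO n => (p.1 : Mat n) * p.2.1 * (p.2.2 : Mat n) :=
    measurable_matrix_mul (measurable_matrix_mul (hc.comp measurable_fst) measurable_snd.fst)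
      (hc.comp measurable_snd.snd)
  have hm2 : Measurable fun p : SO n × Mat n × SO n => (p.1 : Mat n) * singDiag p.2.1 * (p.2.2 : Mat n) :=
    measurable_matrix_mul (measurable_matrix_mul (hc.comp measurable_fst)
      (hs.comp measurable_snd.fst)) (hc.comp measurable_snd.snd)
  have hmr : Measurable fun p : Mat n × SO n => p.1 * (p.2 : Mat n) :=
    measurable_matrix_mul measurable_fst (hc.comp measurable_snd)
  have hml : Measurable fun p : SO n × Mat n => (p.1 : Mat n) * p.2 :=
    measurable_matrix_mul (hc.comp measurable_fst) measurable_snd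
  have h1 : (μ.prod (haarSO n)).map (fun p => p.1 * (p.2 : Mat n)) = μ := by
    rw [← Measure.prod_swap, Measure.map_map hmr measurable_swap]
    exact h.2
  have h2 : ((haarSO n).prod (μ.prod (haarSO n))).map
      (fun p => (p.1 : Mat n) * p.2.1 * (p.2.2 : Mat n)) = μ := by
    have e := Measure.map_prod_map (haarSO n) (μ.prod (haarSO n)) measurable_id hmr
    rw [Measure.map_id, h1] at e
    conv_rhs => rw [← h.1, e, Measure.map_map hml (measurable_id.prodMap hmr)]
    congr 1
    ext p : 1
    exact Matrix.mul_assoc _ _ _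
  conv_rhs => rw [← h2]
  have : IsProbabilityMeasure (μ.map singDiag) :=
    Measure.isProbabilityMeasure_map hs.aemeasurable
  rw [haarMatrix, Measure.map_prod_map _ _ hs hc, Measure.map_prod_map _ _ hc (hs.prodMap hc),
    Measure.map_map hm (hc.prodMap (hs.prodMap hc))]
  have hcomp : (fun p : Mat n × Mat n × Mat n => p.1 * p.2.1 * p.2.2) ∘
      Prod.map (Subtype.val : SO n → Mat n) (Prod.map singDiag (Subtype.val : SO n → Mat n)) =
    fun p : SO n × Mat n × SO n => (p.1 : Mat n) * singDiag p.2.1 * (p.2.2 : Mat n) := rfl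
  rw [hcomp]
  ext E hE
  rw [Measure.map_apply hm2 hE, Measure.map_apply hm1 hE,
    Measure.prod_apply (hm1 hE), Measure.prod_apply (hm2 hE)]
  -- Fubini with `A` outermost: `U` and `V` depend on `A` and must be fixed before the integration
  -- over the rotations.
  have hslice : ∀ f : Mat n → Mat n, Measurable f →
      ∫⁻ O, (μ.prod (haarSO n)) (Prod.mk O ⁻¹' ((fun p : SO n × Mat n × SO n =>
        (p.1 : Mat n) * f p.2.1 * (p.2.2 : Mat n)) ⁻¹' E)) ∂(haarSO n) =
      ∫⁻ A, ∫⁻ O, haarSO n {O' | (O : Mat n) * f A * (O' : Mat n) ∈ E} ∂(haarSO n) ∂μ := by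
    intro f hf
    have hmf : Measurable fun p : SO n × Mat n × SO n => (p.1 : Mat n) * f p.2.1 * (p.2.2 : Mat n) :=
      measurable_matrix_mul (measurable_matrix_mul (hc.comp measurable_fst)
        (hf.comp measurable_snd.fst)) (hc.comp measurable_snd.snd)
    have hjoint : Measurable fun p : SO n × Mat n => haarSO n {O' | (p.1 : Mat n) * f p.2 * (O' : Mat n) ∈ E} :=
      measurable_measure_prodMk_left (ν := haarSO n)
        (s := (fun q : (SO n × Mat n) × SO n => (q.1.1 : Mat n) * f q.1.2 * (q.2 : Mat n)) ⁻¹' E)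
        (hmf.comp MeasurableEquiv.prodAssoc.measurable hE)
    rw [← lintegral_lintegral_swap hjoint.aemeasurable]
    refine lintegral_congr fun O => ?_
    rw [Measure.prod_apply (measurable_prodMk_left (hmf hE))]
    rfl
  have e1 := hslice id measurable_id
  have e2 := hslice singDiag hs
  refine e2.trans (Eq.trans ?_ e1.symm)
  refine lintegral_congr fun A => ?_
  obtain ⟨U, V, hUV⟩ := exists_SO_singDiag A
  rw [← lintegral_mul_right_eq_self _ U]
  refine lintegral_congr fun O => ?_
  rw [← measure_preimage_mul (haarSO n) V]
  congr 1
  ext Q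
  simp only [Set.mem_preimage, Set.mem_ofPred_eq, id]
  conv_rhs => rw [hUV]
  rw [show ((O * U : SO n) : Mat n) = (O : Mat n) * (U : Mat n) from rfl,
    show ((V * Q : SO n) : Mat n) = (V : Mat n) * (Q : Mat n) from rfl]
  simp only [Matrix.mul_assoc]

end

end Trapdoor

/-! ### Exact generation of Kac's walk from coins. -/

namespace Trapdoor

noncomputable section

open Matrix

/-! ### Generating Kac's walk from uniform numbers -/

/-- The number `k ≤ m` with `k / K < u ≤ (k + 1) / K`, found by comparing `u` with `1 / K, …, m / K`
(and `0` or `m` if `u` is not in this range). -/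
def pick (K : ℕ) (u : ℝ) : ℕ → ℕ
  | 0 => 0
  | m + 1 => if u - ((m : ℝ) + 1) / K ≤ 0 then pick K u m else m + 1

theorem pick_le (K : ℕ) (u : ℝ) (m : ℕ) : pick K u m ≤ m := by
  induction m with
  | zero => exact le_rfl
  | succ m ih =>
    rw [pick]
    split_ifs <;> omega

theorem pick_spec (K : ℕ) (u : ℝ) (m : ℕ) (h0 : 0 < u) (h1 : u ≤ ((m : ℝ) + 1) / K) :
    (pick K u m : ℝ) / K < u ∧ u ≤ ((pick K u m : ℝ) + 1) / K := by
  induction m with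
  | zero => simpa [pick, h0] using h1
  | succ m ih =>
    rw [pick]
    split_ifs with h
    · exact ih (by linarith)
    · push_cast at h1 ⊢
      exact ⟨by linarith, h1⟩

theorem measurable_pick (K m : ℕ) : Measurable fun u => pick K u m := by
  induction m with
  | zero => exact measurable_const
  | succ m ih =>
    simp only [pick]
    exact Measurable.ite (measurableSet_le (measurable_id.sub measurable_const) measurable_const)
      ih measurable_const

/-- The number of ordered pairs of distinct indices. -/
def pairCount (n : ℕ) : ℕ := Fintype.card {p : Fin n × Fin n // p.1 ≠ p.2}

theorem pairCount_le (n : ℕ) : pairCount n ≤ n * n := by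
  refine (Fintype.card_subtype_le _).trans ?_
  simp

theorem pairCount_pos {n : ℕ} (hn : 2 ≤ n) : 0 < pairCount n :=
  Fintype.card_pos_iff.mpr ⟨⟨(⟨0, by omega⟩, ⟨1, by omega⟩), by simp⟩⟩

def pairEquiv (n : ℕ) : {p : Fin n × Fin n // p.1 ≠ p.2} ≃ Fin (pairCount n) := Fintype.equivFin _

/-- An enumeration of the ordered pairs of distinct indices. -/
def pairAt {n : ℕ} (hn : 2 ≤ n) (k : ℕ) : Fin n × Fin n :=
  if h : k < pairCount n then ((pairEquiv n).symm ⟨k, h⟩).1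
  else (⟨0, by omega⟩, ⟨1, by omega⟩)

theorem pairAt_ne {n : ℕ} (hn : 2 ≤ n) (k : ℕ) : (pairAt hn k).1 ≠ (pairAt hn k).2 := by
  unfold pairAt
  split_ifs
  · exact ((pairEquiv n).symm _).2
  · simp

/-- Clamping keeps the angle in `[0, 2π]` for every real `u`, as the sine and cosine gates require
on every outcome and not just almost surely. It is written with the comparisons that `select`
offers. -/
def clampUnit (x : ℝ) : ℝ := if x ≤ 0 then 0 else if x - 1 ≤ 0 then x else 1

theorem clampUnit_mem (x : ℝ) : 0 ≤ clampUnit x ∧ clampUnit x ≤ 1 := by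
  unfold clampUnit
  split_ifs with h1 h2
  · simp
  · constructor <;> linarith
  · simp

theorem clampUnit_of_mem {x : ℝ} (h0 : 0 < x) (h1 : x ≤ 1) : clampUnit x = x := by
  rw [clampUnit, if_neg (not_le.mpr h0), if_pos (by linarith)]

theorem measurable_clampUnit : Measurable clampUnit :=
  Measurable.ite (measurableSet_le measurable_id measurable_const) measurable_const
    (Measurable.ite (measurableSet_le (measurable_id.sub measurable_const) measurable_const)
      measurable_id measurable_const)

/-- The number of the pair of indices of a step of Kac's walk that is driven by `u`. -/
def stepIndex (n : ℕ) (u : ℝ) : ℕ := pick (pairCount n) u (pairCount n - 1)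

/-- The angle of a step of Kac's walk that is driven by `u`. -/
def stepAngle (n : ℕ) (u : ℝ) : ℝ :=
  2 * Real.pi * clampUnit (pairCount n * u - stepIndex n u)

theorem stepAngle_mem (n : ℕ) (u : ℝ) : 0 ≤ stepAngle n u ∧ stepAngle n u ≤ 2 * Real.pi := by
  have h := clampUnit_mem (pairCount n * u - stepIndex n u)
  have hp := Real.pi_pos
  constructor
  · unfold stepAngle; exact mul_nonneg (by positivity) h.1
  · unfold stepAngle; nlinarith

theorem measurable_stepIndex (n : ℕ) : Measurable (stepIndex n) := measurable_pick _ _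

theorem measurable_stepAngle (n : ℕ) : Measurable (stepAngle n) :=
  (measurable_clampUnit.comp ((measurable_id.const_mul _).sub
    ((measurable_of_countable (fun k : ℕ => (k : ℝ))).comp (measurable_stepIndex n)))).const_mul _

/-- The rotation of a step of Kac's walk that is driven by `u`. -/
def stepMat (n : ℕ) (u : ℝ) : Mat n :=
  if hn : 2 ≤ n then
    planeRotation (pairAt hn (stepIndex n u)).1 (pairAt hn (stepIndex n u)).2 (stepAngle n u)
  else 1

theorem measurable_planeRotation {n : ℕ} (i j : Fin n) :
    Measurable fun θ => planeRotation i j θ := by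
  refine measurable_matrix_iff.mpr fun a b => ?_
  simp only [planeRotation, Matrix.of_apply]
  split_ifs
  · exact Real.measurable_cos
  · exact Real.measurable_sin
  · exact measurable_const
  · exact Real.measurable_sin.neg
  · exact Real.measurable_cos
  all_goals exact measurable_const

theorem measurable_planeRotation_uncurry (n : ℕ) :
    Measurable fun q : (Fin n × Fin n) × ℝ => planeRotation q.1.1 q.1.2 q.2 :=
  measurable_from_prod_countable_right fun p => measurable_planeRotation p.1 p.2

theorem stepIndex_spec {n : ℕ} (hn : 2 ≤ n) {u : ℝ} (h0 : 0 < u) (h1 : u ≤ 1) :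
    stepIndex n u < pairCount n ∧
      0 < pairCount n * u - stepIndex n u ∧ pairCount n * u - stepIndex n u ≤ 1 := by
  have hK := pairCount_pos hn
  have hK' : (0 : ℝ) < pairCount n := by exact_mod_cast hK
  have hle := pick_le (pairCount n) u (pairCount n - 1)
  have hcast : ((pairCount n - 1 : ℕ) : ℝ) + 1 = pairCount n := by
    rw [Nat.cast_sub hK]; simp
  have hs := pick_spec (pairCount n) u (pairCount n - 1) h0 (by rwa [hcast, div_self hK'.ne'])
  rw [div_lt_iff₀ hK', le_div_iff₀ hK'] at hs
  exact ⟨by unfold stepIndex; omega, by unfold stepIndex; linarith [hs.1],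
    by unfold stepIndex; linarith [hs.2]⟩

theorem stepIndex_eq_iff {n : ℕ} (hn : 2 ≤ n) {u : ℝ} {k : ℕ} (hk : k < pairCount n) :
    ((0 < u ∧ u ≤ 1) ∧ stepIndex n u = k) ↔
      0 < pairCount n * u - k ∧ pairCount n * u - k ≤ 1 := by
  have hK' : (0 : ℝ) < pairCount n := by exact_mod_cast pairCount_pos hn
  constructor
  · rintro ⟨⟨h0, h1⟩, rfl⟩
    exact (stepIndex_spec hn h0 h1).2
  · rintro ⟨h0, h1⟩
    have hu0 : 0 < u := by
      by_contra h
      have : (pairCount n : ℝ) * u ≤ 0 := mul_nonpos_of_nonneg_of_nonpos hK'.le (not_lt.mp h)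
      have : (0 : ℝ) ≤ k := Nat.cast_nonneg k
      linarith
    have hu1 : u ≤ 1 := by
      by_contra h
      have h2 : (pairCount n : ℝ) * 1 < pairCount n * u := mul_lt_mul_of_pos_left (not_le.mp h) hK'
      have h3 : (k : ℝ) + 1 ≤ pairCount n := by exact_mod_cast hk
      linarith
    refine ⟨⟨hu0, hu1⟩, ?_⟩
    obtain ⟨-, h2, h3⟩ := stepIndex_spec hn hu0 hu1
    have h4 : (stepIndex n u : ℝ) < k + 1 := by linarith
    have h5 : (k : ℝ) < stepIndex n u + 1 := by linarith
    have h4' : stepIndex n u < k + 1 := by exact_mod_cast h4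
    have h5' : k < stepIndex n u + 1 := by exact_mod_cast h5
    omega

/-- With `K = pairCount n`, the angle maps the interval `(k / K, (k + 1) / K]` affinely onto `(0,
2π]` with slope `2πK`. -/
theorem volume_stepIndex_stepAngle {n : ℕ} (hn : 2 ≤ n) {k : ℕ} (hk : k < pairCount n)
    (t : Set ℝ) :
    volume {u : ℝ | ((0 < u ∧ u ≤ 1) ∧ stepIndex n u = k) ∧ stepAngle n u ∈ t} =
      ENNReal.ofReal (2 * Real.pi * pairCount n)⁻¹ * volume (Set.Ioc 0 (2 * Real.pi) ∩ t) := by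
  have hK' : (0 : ℝ) < pairCount n := by exact_mod_cast pairCount_pos hn
  have hp := Real.pi_pos
  have hset : {u : ℝ | ((0 < u ∧ u ≤ 1) ∧ stepIndex n u = k) ∧ stepAngle n u ∈ t} =
      ((2 * Real.pi * pairCount n) * ·) ⁻¹' ((· + -(2 * Real.pi * k)) ⁻¹'
        (Set.Ioc 0 (2 * Real.pi) ∩ t)) := by
    ext u
    have hlin : 2 * Real.pi * pairCount n * u + -(2 * Real.pi * k) =
        2 * Real.pi * (pairCount n * u - k) := by ring
    simp only [Set.mem_ofPred_eq, Set.mem_preimage, Set.mem_inter_iff, Set.mem_Ioc, hlin]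
    rw [stepIndex_eq_iff hn hk]
    have hiff : (0 < pairCount n * u - k ∧ pairCount n * u - k ≤ 1) ↔
        (0 < 2 * Real.pi * (pairCount n * u - k) ∧
          2 * Real.pi * (pairCount n * u - k) ≤ 2 * Real.pi) := by
      refine and_congr ?_ ?_
      · exact (mul_pos_iff_of_pos_left (by positivity)).symm
      · exact (mul_le_iff_le_one_right (by positivity)).symm
    rw [← hiff]
    refine and_congr_right fun h => ?_
    obtain ⟨-, hidx⟩ := (stepIndex_eq_iff hn hk).mpr h
    rw [stepAngle, hidx, clampUnit_of_mem h.1 h.2]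
  rw [hset, Real.volume_preimage_mul_left (by positivity), measure_preimage_add_right,
    abs_of_pos (by positivity)]

theorem measurable_pairAt_stepAngle {n : ℕ} (hn : 2 ≤ n) :
    Measurable fun u => (pairAt hn (stepIndex n u), stepAngle n u) :=
  ((measurable_of_countable (pairAt hn)).comp (measurable_stepIndex n)).prodMk
    (measurable_stepAngle n)

/-- The measure of `{angle ∈ t}` inside the `k`-th subinterval does not depend on `k`. Hence index
and angle are independent and both uniform. -/
theorem map_stepIndex_stepAngle {n : ℕ} (hn : 2 ≤ n) :
    (volume.restrict (Set.Icc (0 : ℝ) 1)).map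
        (fun u => (pairAt hn (stepIndex n u), stepAngle n u)) =
      (ProbabilityTheory.uniformOn {p : Fin n × Fin n | p.1 ≠ p.2}).prod
        (ProbabilityTheory.cond volume (Set.Ico 0 (2 * Real.pi))) := by
  classical
  have hp := Real.pi_pos
  have hK := pairCount_pos hn
  have hm : Measurable fun u => (pairAt hn (stepIndex n u), stepAngle n u) :=
    measurable_pairAt_stepAngle hn
  refine (Measure.prod_eq fun s t hs ht => ?_).symm
  have hU : ProbabilityTheory.uniformOn {p : Fin n × Fin n | p.1 ≠ p.2} s =
      (Finset.univ.filter fun k : Fin (pairCount n) => pairAt hn k ∈ s).card / (pairCount n) := by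
    have h1 : {p : Fin n × Fin n | p.1 ≠ p.2} =
        ((Finset.univ.filter fun p : Fin n × Fin n => p.1 ≠ p.2 : Finset _) : Set _) := by
      ext; simp
    have h2 : s = ((Finset.univ.filter fun p => p ∈ s : Finset (Fin n × Fin n)) : Set _) := by
      ext; simp
    rw [h1]
    nth_rewrite 1 [h2]
    rw [ProbabilityTheory.uniformOn_apply_finset]
    congr 2
    · symm
      refine Finset.card_bij (fun k _ => pairAt hn k) ?_ ?_ ?_
      · intro k hk
        simpa [pairAt_ne] using hk
      · intro k _ l _ hkl
        simp only [pairAt, dif_pos (Fin.is_lt _)] at hkl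
        exact (pairEquiv n).symm.injective (Subtype.ext hkl)
      · intro p hps
        simp only [Finset.mem_inter, Finset.mem_filter, Finset.mem_univ, true_and] at hps
        have hval : pairAt hn (pairEquiv n ⟨p, hps.1⟩) = p := by
          rw [pairAt, dif_pos (Fin.is_lt _)]
          simp
        refine ⟨pairEquiv n ⟨p, hps.1⟩, ?_, hval⟩
        rw [Finset.mem_filter, hval]
        exact ⟨Finset.mem_univ _, hps.2⟩
    · rw [pairCount, Fintype.card_subtype]
  have hC : ProbabilityTheory.cond volume (Set.Ico 0 (2 * Real.pi)) t =
      (ENNReal.ofReal (2 * Real.pi))⁻¹ * volume (Set.Ioc 0 (2 * Real.pi) ∩ t) := by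
    rw [ProbabilityTheory.cond_apply measurableSet_Ico, Real.volume_Ico, sub_zero]
    congr 1
    exact measure_congr (Ico_ae_eq_Ioc.inter (ae_eq_refl t))
  -- `pick` yields intervals closed on the right, so the null point `u = 0` is dropped. The passage
  -- between `(0, 2π]` and `[0, 2π)` in `hC` is likewise a null change.
  rw [Measure.map_apply hm (hs.prod ht), Measure.restrict_congr_set Ioc_ae_eq_Icc.symm,
    Measure.restrict_apply (hm (hs.prod ht))]
  have hunion : (fun u => (pairAt hn (stepIndex n u), stepAngle n u)) ⁻¹' s ×ˢ t ∩ Set.Ioc 0 1 =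
      ⋃ k ∈ (Finset.univ.filter fun k : Fin (pairCount n) => pairAt hn k ∈ s),
        {u : ℝ | ((0 < u ∧ u ≤ 1) ∧ stepIndex n u = k) ∧ stepAngle n u ∈ t} := by
    ext u
    simp only [Set.mem_inter_iff, Set.mem_preimage, Set.mem_prod, Set.mem_Ioc, Set.mem_iUnion,
      Finset.mem_filter, Finset.mem_univ, true_and, Set.mem_ofPred_eq, exists_prop]
    constructor
    · rintro ⟨⟨h1, h2⟩, h3⟩
      exact ⟨⟨_, (stepIndex_spec hn h3.1 h3.2).1⟩, h1, ⟨h3, rfl⟩, h2⟩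
    · rintro ⟨k, h1, ⟨h3, h4⟩, h2⟩
      exact ⟨⟨by rwa [h4], h2⟩, h3⟩
  rw [hunion, measure_biUnion_finset]
  · rw [Finset.sum_congr rfl fun k _ => volume_stepIndex_stepAngle hn k.2 t, Finset.sum_const, hU,
      hC, nsmul_eq_mul, div_eq_mul_inv, mul_assoc, mul_assoc, ← mul_assoc (_⁻¹)]
    congr 2
    have hK' : (0 : ℝ) < pairCount n := by exact_mod_cast hK
    have hp2 : 0 < 2 * Real.pi := by positivity
    rw [← mul_assoc, mul_inv (2 * Real.pi) (pairCount n : ℝ), ENNReal.ofReal_mul (inv_pos.mpr hp2).le, mul_comm,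
      ENNReal.ofReal_inv_of_pos hK', ENNReal.ofReal_inv_of_pos hp2, ENNReal.ofReal_natCast]
  · intro k _ l _ hkl
    refine Set.disjoint_left.mpr fun u hu hu' => hkl (Fin.ext ?_)
    exact hu.1.2.symm.trans hu'.1.2
  · intro k _
    have h1 : MeasurableSet {u : ℝ | 0 < u ∧ u ≤ 1} := measurableSet_Ioc
    exact (h1.inter (measurable_stepIndex n (measurableSet_singleton _))).inter
      (measurable_stepAngle n ht)

/-- The law of a single coin pair. -/
abbrev coinLaw : Measure (ℝ × ℝ) :=
  (volume.restrict (Set.Icc (0 : ℝ) 1)).prod (ProbabilityTheory.gaussianReal 0 1)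

instance isProbabilityMeasure_unitInterval :
    IsProbabilityMeasure (volume.restrict (Set.Icc (0 : ℝ) 1)) := ⟨by simp⟩

instance isProbabilityMeasure_coins (r : ℕ) : IsProbabilityMeasure (coins r) := by
  unfold coins; infer_instance

theorem measurable_stepMat (n : ℕ) : Measurable (stepMat n) := by
  unfold stepMat
  split_ifs with hn
  · exact (measurable_planeRotation_uncurry n).comp
      (measurable_pairAt_stepAngle hn)
  · exact measurable_const

theorem map_stepMat (n : ℕ) : coinLaw.map (fun x => stepMat n x.1) = kacStep n := by
  have h : coinLaw.map (fun x => stepMat n x.1) =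
      (volume.restrict (Set.Icc (0 : ℝ) 1)).map (stepMat n) := by
    have h1 : coinLaw.map Prod.fst = volume.restrict (Set.Icc (0 : ℝ) 1) := by
      rw [Measure.map_fst_prod]; simp
    rw [← h1, Measure.map_map (measurable_stepMat n) measurable_fst]
    rfl
  rw [h, kacStep]
  split_ifs with hn
  · have : stepMat n = fun _ => 1 := by
      ext1 u
      rw [stepMat, dif_neg (by omega)]
    rw [this, Measure.map_const]
    simp
  · have hn' : 2 ≤ n := by omega
    rw [← map_stepIndex_stepAngle hn', Measure.map_map (measurable_planeRotation_uncurry n)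
      (measurable_pairAt_stepAngle hn')]
    congr 1
    ext1 u
    rw [stepMat, dif_pos hn']
    rfl

/-- The state of Kac's walk after `t` steps, driven by `t` coins. -/
def walkMat (n : ℕ) : (t : ℕ) → (Fin t → ℝ × ℝ) → Mat n
  | 0, _ => 1
  | t + 1, c => stepMat n (c 0).1 * walkMat n t (Fin.tail c)

theorem measurable_walkMat (n t : ℕ) : Measurable (walkMat n t) := by
  induction t with
  | zero => exact measurable_const
  | succ t ih =>
    exact measurable_matrix_mul ((measurable_stepMat n).comp (measurable_pi_apply 0).fst)
      (ih.comp (measurable_pi_lambda _ fun k => measurable_pi_apply _))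

/-- Coin `0` drives the leftmost, most recent factor, so splitting it off matches the recursion of
`kacWalk`. -/
theorem map_walkMat (n t : ℕ) : (coins t).map (walkMat n t) = kacWalk n t := by
  induction t with
  | zero =>
    rw [kacWalk]
    have : walkMat n 0 = fun _ => 1 := rfl
    rw [this, Measure.map_const]
    simp
  | succ t ih =>
    have hs : Measurable fun x : ℝ × ℝ => stepMat n x.1 :=
      (measurable_stepMat n).comp measurable_fst
    have hmul : Measurable fun p : Mat n × Mat n => p.1 * p.2 :=
      measurable_matrix_mul measurable_fst measurable_snd
    have hsplit := (measurePreserving_piFinSuccAbove (fun _ : Fin (t + 1) => coinLaw) 0)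
    rw [kacWalk, ← ih, ← map_stepMat, Measure.map_prod_map _ _ hs (measurable_walkMat n t),
      Measure.map_map hmul (hs.prodMap (measurable_walkMat n t))]
    have e : coinLaw.prod (coins t) = (coins (t + 1)).map
        (MeasurableEquiv.piFinSuccAbove (fun _ => ℝ × ℝ) 0) := hsplit.map_eq.symm
    rw [e, Measure.map_map (hmul.comp (hs.prodMap (measurable_walkMat n t)))
      (MeasurableEquiv.measurable _)]
    rfl

instance isProbabilityMeasure_kacWalk (n t : ℕ) : IsProbabilityMeasure (kacWalk n t) := by
  rw [← map_walkMat]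
  exact Measure.isProbabilityMeasure_map (measurable_walkMat n t).aemeasurable

end

end Trapdoor

/-! ### Computing the walk, the diagonal part, and the trapdoor circuits with their codes. -/

namespace Trapdoor

noncomputable section

open Matrix

variable {α β : Type*}

/-! ### Computing Kac's walk and the diagonal parts -/

/-- Table look-up by a chain of comparisons, each one subtraction and one selection. The table `φ`
is arbitrary, so this serves for the index, for the wire numbers of the pair and for the entries of
the rotation. -/
theorem Easy.pick {fs : Set (α → ℝ)} {u : α → ℝ} (hu : u ∈ withConsts fs) (K m : ℕ)
    {φ : ℕ → α → ℝ} (hφ : ∀ k, φ k ∈ withConsts fs) :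
    Easy fs (8 * m) {fun a => φ (Trapdoor.pick K (u a) m) a} := by
  induction m with
  | zero => exact Easy.mem (hφ 0) _
  | succ m ih =>
    have h := (((Easy.mem hu 0).sub (Easy.const fs (((m : ℝ) + 1) / K) 0)).select ih
      (Easy.mem (hφ (m + 1)) 0)).mono_cost (show _ ≤ 8 * (m + 1) by omega)
    convert h using 3 with a
    rw [Trapdoor.pick]
    split_ifs <;> rfl

theorem Easy.stepIndex {fs : Set (α → ℝ)} {u : α → ℝ} (hu : u ∈ withConsts fs) (n : ℕ)
    {φ : ℕ → α → ℝ} (hφ : ∀ k, φ k ∈ withConsts fs) :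
    Easy fs (8 * n ^ 2) {fun a => φ (Trapdoor.stepIndex n (u a)) a} := by
  refine (Easy.pick hu _ _ hφ).mono_cost ?_
  have := pairCount_le n
  rw [sq]
  omega

theorem Easy.stepAngle {fs : Set (α → ℝ)} {u : α → ℝ} (hu : u ∈ withConsts fs) (n : ℕ) :
    Easy fs (8 * n ^ 2 + 24) {fun a => Trapdoor.stepAngle n (u a)} := by
  have h1 := ((Easy.const fs (pairCount n) 0).mul (Easy.mem hu 0)).sub
    (Easy.stepIndex hu n (φ := fun k _ => (k : ℝ)) fun k => const_mem_withConsts _ _)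
  set f : α → ℝ := fun a => pairCount n * u a - Trapdoor.stepIndex n (u a)
  have hf : Easy {f} 0 {f} := Easy.mem (subset_withConsts _ (Set.mem_singleton _)) 0
  have h2 : Easy {f} 16 {fun a => 2 * Real.pi * clampUnit (f a)} :=
    (Easy.const _ (2 * Real.pi) 0).mul (hf.select (Easy.const _ 0 0)
      ((hf.sub (Easy.const _ 1 0)).select hf (Easy.const _ 1 0)))
  exact (h1.comp h2).mono_cost (by omega)

/-- The trigonometric functions of the angle of a step. -/
def trigFns (n : ℕ) (u : α → ℝ) : Set (α → ℝ) :=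
  {fun a => Real.cos (stepAngle n (u a)), fun a => Real.sin (stepAngle n (u a)),
    fun a => -Real.sin (stepAngle n (u a))}

theorem Easy.trigFns {fs : Set (α → ℝ)} {u : α → ℝ} (hu : u ∈ withConsts fs) (n : ℕ) :
    Easy fs (8 * n ^ 2 + 40) (trigFns n u) := by
  set θ : α → ℝ := fun a => Trapdoor.stepAngle n (u a) with hθ
  have h0 : ∀ a, 0 ≤ θ a ∧ θ a ≤ 2 * Real.pi := fun a => stepAngle_mem n (u a)
  have hf : Easy {θ} 0 {θ} := Easy.mem (subset_withConsts _ (Set.mem_singleton _)) 0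
  exact ((Easy.stepAngle hu n).comp
    ((hf.cos h0).union ((hf.sin h0).union (hf.sin h0).neg))).mono_cost (by omega)

theorem planeRotation_mem_trigFns {n : ℕ} (i j : Fin n) (u : α → ℝ) (a b : Fin n) :
    (fun x => planeRotation i j (stepAngle n (u x)) a b) ∈ withConsts (trigFns n u) := by
  simp only [planeRotation, Matrix.of_apply]
  split_ifs
  · exact subset_withConsts _ (Or.inl rfl)
  · exact subset_withConsts _ (Or.inr (Or.inl rfl))
  · exact const_mem_withConsts _ _
  · exact subset_withConsts _ (Or.inr (Or.inr rfl))
  · exact subset_withConsts _ (Or.inl rfl)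
  all_goals exact const_mem_withConsts _ _

/-- Sine and cosine are computed once; each of the `n²` entries is then looked up in a table over
all pairs, whose items are constants or these trigonometric values. -/
theorem Easy.stepMat {fs : Set (α → ℝ)} {u : α → ℝ} (hu : u ∈ withConsts fs) (n : ℕ) :
    Easy fs (8 * n ^ 2 + 40 + 8 * n ^ 4) (entryFns fun a => stepMat n (u a)) := by
  by_cases hn : 2 ≤ n
  · refine ((Easy.trigFns hu n).trans (Easy.range (c := 8 * n ^ 2) fun p => ?_)).mono
      (Set.subset_union_right.trans (subset_withConsts _)) (le_of_eq ?_)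
    · have := Easy.stepIndex (withConsts_mono (Set.subset_union_left (t := Trapdoor.trigFns n u)) hu) n
        (φ := fun k a => planeRotation (pairAt hn k).1 (pairAt hn k).2
          (Trapdoor.stepAngle n (u a)) p.1 p.2)
        fun k => withConsts_mono Set.subset_union_right (planeRotation_mem_trigFns _ _ _ _ _)
      simpa only [Trapdoor.stepMat, dif_pos hn] using this
    · simp; ring
  · simp only [Trapdoor.stepMat, dif_neg hn]
    exact Easy.of_subset (entryFns_const _ _) _

theorem Easy.walkMat {fs : Set (α → ℝ)} (n t : ℕ) {c : α → Fin t → ℝ × ℝ}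
    (hc : ∀ k, (fun a => (c a k).1) ∈ withConsts fs) :
    Easy fs (t * (8 * n ^ 2 + 40 + 8 * n ^ 4 + 8 * n ^ 3))
      (entryFns fun a => walkMat n t (c a)) := by
  induction t with
  | zero => exact Easy.of_subset (entryFns_const _ _) _
  | succ t ih =>
    have h1 := Easy.stepMat (hc 0) n
    have h2 := ih (c := fun a => Fin.tail (c a)) fun k => hc k.succ
    have h3 := (h1.union h2).comp (Easy.matrix_mul
      (Set.subset_union_left.trans (subset_withConsts _))
      (Set.subset_union_right.trans (subset_withConsts _)))
    refine h3.mono_cost (le_of_eq ?_)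
    ring

theorem entries_apply {n : ℕ} (A : Mat n) (i j : Fin n) : entries A (i * n + j) = A i j := by
  have h : (i : ℕ) * n + j < n * n := by
    have hi := i.2; have hj := j.2
    nlinarith
  have h2 : (⟨i * n + j, h⟩ : Fin (n * n)) = finProdFinEquiv (i, j) := by
    ext
    simp [finProdFinEquiv]
    ring
  rw [entries, dif_pos h, h2, Equiv.symm_apply_apply]

theorem entries_mem_withConsts {fs : Set (α → ℝ)} {n : ℕ} {X : α → Mat n}
    (hX : entryFns X ⊆ withConsts fs) (k : ℕ) : (fun a => entries (X a) k) ∈ withConsts fs := by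
  unfold entries
  split_ifs
  · exact hX (mem_entryFns X _ _)
  · exact const_mem_withConsts _ _

theorem block_entries {n : ℕ} (A : Mat n) : block (entries A) 0 n = A := by
  ext i j
  simp [block, entries_apply]

theorem Easy.symmEigenvalue {fs : Set (α → ℝ)} {n : ℕ} {X : α → Mat n}
    (hX : entryFns X ⊆ withConsts fs) (k : ℕ) :
    Easy fs (4 * (n ^ 3 + 1)) {fun a => symmEigenvalue (X a) k} := by
  have h := (Easy.of_subset hX 0).gate (.eig 0 0 n k) (fun a => entries (X a))
    (entries_mem_withConsts (subset_withConsts _))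
  simpa only [Gate.value, block_entries, Gate.cost, zero_add] using h

theorem Easy.det {fs : Set (α → ℝ)} {n : ℕ} {X : α → Mat n}
    (hX : entryFns X ⊆ withConsts fs) : Easy fs (4 * (n ^ 3 + 1)) {fun a => (X a).det} := by
  have h := (Easy.of_subset hX 0).gate (.det 0 0 n) (fun a => entries (X a))
    (entries_mem_withConsts (subset_withConsts _))
  simpa only [Gate.value, block_entries, Gate.cost, zero_add] using h

theorem entryFns_diagonal_subset {n : ℕ} {fs : Set (α → ℝ)} {d : α → Fin n → ℝ}
    (hd : ∀ k, (fun a => d a k) ∈ withConsts fs) :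
    entryFns (fun a => Matrix.diagonal (d a)) ⊆ withConsts fs := by
  rintro _ ⟨⟨i, j⟩, rfl⟩
  simp only [Matrix.diagonal_apply]
  split_ifs
  · exact hd i
  · exact const_mem_withConsts _ _

theorem Easy.eigenvalues {fs : Set (α → ℝ)} {n : ℕ} {X : α → Mat n}
    (hX : entryFns X ⊆ withConsts fs) :
    Easy fs (n * (4 * (n ^ 3 + 1)))
      (Set.range fun (k : Fin n) a => Trapdoor.symmEigenvalue (X a) k) := by
  simpa using Easy.range fun k : Fin n => Easy.symmEigenvalue hX k

theorem Easy.signedSing {fs : Set (α → ℝ)} {n : ℕ} {X : α → Mat n}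
    (hX : entryFns X ⊆ withConsts fs) :
    Easy fs (8 * n ^ 3 + n * (12 * (n ^ 3 + 1) + 16))
      (Set.range fun (k : Fin n) a => signedSing (X a) k) := by
  have h1 : Easy fs (8 * n ^ 3) (entryFns fun a => (X a)ᵀ * X a) :=
    Easy.matrix_mul (by rwa [entryFns_transpose]) hX
  -- Per singular value: one determinant and the same eigenvalue twice (once for each sign), two
  -- roots, a negation and a selection.
  refine (h1.trans (Easy.range (c := 12 * (n ^ 3 + 1) + 16) fun k => ?_)).mono
    (Set.subset_union_right.trans (subset_withConsts _)) (by simp)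
  set gs := fs ∪ entryFns fun a => (X a)ᵀ * X a
  have hdet : Easy gs (4 * (n ^ 3 + 1)) {fun a => (X a).det} :=
    Easy.det (hX.trans (withConsts_mono Set.subset_union_left))
  have hs : Easy gs (4 * (n ^ 3 + 1) + 4)
      {fun a => Real.sqrt (Trapdoor.symmEigenvalue ((X a)ᵀ * X a) k)} :=
    (Easy.symmEigenvalue (Set.subset_union_right.trans (subset_withConsts _)) k).sqrt
  unfold Trapdoor.signedSing
  split_ifs with hk
  · exact (hdet.select hs.neg hs).mono_cost (by omega)
  · exact hs.mono_cost (by omega)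

/-! ### The circuits -/

/-- The circuit multiplies the vector in the first `n` wires by `A`. -/
def Implements {n : ℕ} (C : Circuit) (A : Mat n) : Prop :=
  ∀ s : ℕ → ℝ, (fun i : Fin n => C.run s i) = A *ᵥ fun i => s i

theorem Implements.append {n : ℕ} {C D : Circuit} {A B : Mat n} (hC : Implements C A)
    (hD : Implements D B) : Implements (C ++ D) (B * A) := by
  intro s
  rw [Circuit.run_append, hD, hC, Matrix.mulVec_mulVec]

theorem implements_nil (n : ℕ) : Implements [] (1 : Mat n) := by
  intro s
  rw [Matrix.one_mulVec]
  rfl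

theorem Implements.apply_eq {n : ℕ} {C : Circuit} {A : Mat n} (h : Implements C A)
    (v : Fin n → ℝ) : C.apply v = A *ᵥ v := by
  refine (h _).trans ?_
  simp

/-- Rotating the numbers in the wires `i` and `j` by the angle of cosine `c` and sine `s`. -/
def rotationCircuit (n i j : ℕ) (c s : ℝ) : Circuit :=
  [.const n c, .const (n + 1) s, .mul (n + 2) n i, .mul (n + 3) (n + 1) j,
    .mul (n + 4) (n + 1) i, .mul (n + 5) n j, .sub i (n + 2) (n + 3), .add j (n + 4) (n + 5)]

theorem planeRotation_mulVec {n : ℕ} {i j : Fin n} (hij : i ≠ j) (θ : ℝ) (v : Fin n → ℝ)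
    (k : Fin n) : (planeRotation i j θ *ᵥ v) k =
      if k = j then Real.sin θ * v i + Real.cos θ * v j
      else if k = i then Real.cos θ * v i - Real.sin θ * v j else v k := by
  have h : ∀ b, planeRotation i j θ k b * v b =
      (if b = i then (if k = i then Real.cos θ else if k = j then Real.sin θ else 0) * v i else 0) +
      (if b = j then (if k = i then -Real.sin θ else if k = j then Real.cos θ else 0) * v j else 0) +
      (if b = k then (if k = i ∨ k = j then 0 else v k) else 0) := by
    intro b
    simp only [planeRotation, Matrix.of_apply]
    grind
  simp only [Matrix.mulVec, dotProduct, h, Finset.sum_add_distrib, Finset.sum_ite_eq',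
    Finset.mem_univ, if_true]
  grind

theorem planeRotation_transpose {n : ℕ} (i j : Fin n) (θ : ℝ) :
    (planeRotation i j θ)ᵀ = planeRotation i j (-θ) := by
  ext a b
  simp only [planeRotation, Matrix.of_apply, Matrix.transpose_apply, Real.cos_neg, Real.sin_neg]
  grind

theorem planeRotation_mul_transpose {n : ℕ} {i j : Fin n} (hij : i ≠ j) (θ : ℝ) :
    planeRotation i j θ * (planeRotation i j θ)ᵀ = 1 := by
  rw [planeRotation_transpose]
  refine Matrix.mulVec_injective (funext fun v => funext fun k => ?_)
  rw [← Matrix.mulVec_mulVec, Matrix.one_mulVec]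
  simp only [planeRotation_mulVec hij, Real.cos_neg, Real.sin_neg]
  have h := Real.sin_sq_add_cos_sq θ
  rcases eq_or_ne k j with rfl | hkj
  · simp only [if_true, if_neg hij]
    linear_combination v k * h
  · rcases eq_or_ne k i with rfl | hki
    · simp only [if_true, if_neg hij]
      linear_combination v k * h
    · simp only [if_neg hkj, if_neg hki]

/-- All four products are formed in scratch wires from `n` on before wire `i` or `j` is overwritten.
-/
theorem implements_rotationCircuit {n : ℕ} {i j : Fin n} (hij : i ≠ j) (θ : ℝ) :
    Implements (rotationCircuit n i j (Real.cos θ) (Real.sin θ)) (planeRotation i j θ) := by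
  intro s
  ext k
  rw [planeRotation_mulVec hij]
  have hi := i.2
  have hj := j.2
  have hk := k.2
  simp only [rotationCircuit, Circuit.run, List.foldl, Gate.step, Gate.target, Gate.value,
    Function.update_apply, Fin.ext_iff]
  have h0 : ∀ a < n, (a = n) = False := fun a ha => by simp; omega
  have h1 : ∀ a < n, ∀ c, (a = n + c) = False := fun a ha c => by simp; omega
  have h2 : ∀ a < n, ∀ c, (n + c = a) = False := fun a ha c => by simp; omega
  simp [h0 _ hi, h0 _ hj, h0 _ hk, h1 _ hi, h1 _ hj, h1 _ hk, h2 _ hi]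

theorem implements_rotationCircuit_transpose {n : ℕ} {i j : Fin n} (hij : i ≠ j) (θ : ℝ) :
    Implements (rotationCircuit n i j (Real.cos θ) (-Real.sin θ)) (planeRotation i j θ)ᵀ := by
  have := implements_rotationCircuit hij (-θ)
  rwa [Real.cos_neg, Real.sin_neg, ← planeRotation_transpose] at this

def stepCircuit (n : ℕ) (u : ℝ) : Circuit :=
  if hn : 2 ≤ n then
    rotationCircuit n (pairAt hn (stepIndex n u)).1 (pairAt hn (stepIndex n u)).2
      (Real.cos (stepAngle n u)) (Real.sin (stepAngle n u))
  else []

def stepCircuitTranspose (n : ℕ) (u : ℝ) : Circuit :=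
  if hn : 2 ≤ n then
    rotationCircuit n (pairAt hn (stepIndex n u)).1 (pairAt hn (stepIndex n u)).2
      (Real.cos (stepAngle n u)) (-Real.sin (stepAngle n u))
  else []

theorem implements_stepCircuit (n : ℕ) (u : ℝ) : Implements (stepCircuit n u) (stepMat n u) := by
  unfold stepCircuit stepMat
  split_ifs with hn
  · exact implements_rotationCircuit (pairAt_ne hn _) _
  · exact implements_nil n

theorem implements_stepCircuitTranspose (n : ℕ) (u : ℝ) :
    Implements (stepCircuitTranspose n u) (stepMat n u)ᵀ := by
  unfold stepCircuitTranspose stepMat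
  split_ifs with hn
  · exact implements_rotationCircuit_transpose (pairAt_ne hn _) _
  · rw [Matrix.transpose_one]
    exact implements_nil n

theorem stepMat_mul_transpose (n : ℕ) (u : ℝ) : stepMat n u * (stepMat n u)ᵀ = 1 := by
  unfold stepMat
  split_ifs with hn
  · exact planeRotation_mul_transpose (pairAt_ne hn _) _
  · simp

/-- The rightmost matrix factor acts first, so the order of concatenation is opposite to that of the
product. -/
def walkCircuit (n : ℕ) : (t : ℕ) → (Fin t → ℝ × ℝ) → Circuit
  | 0, _ => []
  | t + 1, c => walkCircuit n t (Fin.tail c) ++ stepCircuit n (c 0).1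

def walkCircuitTranspose (n : ℕ) : (t : ℕ) → (Fin t → ℝ × ℝ) → Circuit
  | 0, _ => []
  | t + 1, c => stepCircuitTranspose n (c 0).1 ++ walkCircuitTranspose n t (Fin.tail c)

theorem implements_walkCircuit (n t : ℕ) (c : Fin t → ℝ × ℝ) :
    Implements (walkCircuit n t c) (walkMat n t c) := by
  induction t with
  | zero => exact implements_nil n
  | succ t ih => exact (ih _).append (implements_stepCircuit n _)

theorem implements_walkCircuitTranspose (n t : ℕ) (c : Fin t → ℝ × ℝ) :
    Implements (walkCircuitTranspose n t c) (walkMat n t c)ᵀ := by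
  induction t with
  | zero =>
    rw [walkMat, Matrix.transpose_one]
    exact implements_nil n
  | succ t ih =>
    rw [walkMat, Matrix.transpose_mul]
    exact (implements_stepCircuitTranspose n _).append (ih _)

theorem walkMat_mul_transpose (n t : ℕ) (c : Fin t → ℝ × ℝ) :
    walkMat n t c * (walkMat n t c)ᵀ = 1 := by
  induction t with
  | zero => simp [walkMat]
  | succ t ih =>
    rw [walkMat, Matrix.transpose_mul, Matrix.mul_assoc, ← Matrix.mul_assoc (walkMat n t _), ih,
      Matrix.one_mul, stepMat_mul_transpose]

theorem cost_stepCircuit_le (n : ℕ) (u : ℝ) : (stepCircuit n u).cost ≤ 8 := by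
  unfold stepCircuit
  split_ifs
  · exact le_rfl
  · exact Nat.zero_le _

theorem cost_stepCircuitTranspose_le (n : ℕ) (u : ℝ) : (stepCircuitTranspose n u).cost ≤ 8 := by
  unfold stepCircuitTranspose
  split_ifs
  · exact le_rfl
  · exact Nat.zero_le _

theorem cost_walkCircuit_le (n t : ℕ) (c : Fin t → ℝ × ℝ) : (walkCircuit n t c).cost ≤ 8 * t := by
  induction t with
  | zero => exact le_rfl
  | succ t ih =>
    rw [walkCircuit, Circuit.cost_append]
    have := ih (Fin.tail c)
    have := cost_stepCircuit_le n (c 0).1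
    omega

theorem cost_walkCircuitTranspose_le (n t : ℕ) (c : Fin t → ℝ × ℝ) :
    (walkCircuitTranspose n t c).cost ≤ 8 * t := by
  induction t with
  | zero => exact le_rfl
  | succ t ih =>
    rw [walkCircuitTranspose, Circuit.cost_append]
    have := ih (Fin.tail c)
    have := cost_stepCircuitTranspose_le n (c 0).1
    omega

def diagonalCircuit {n : ℕ} (d : Fin n → ℝ) (l : List (Fin n)) : Circuit :=
  l.flatMap fun k => [.const n (d k), .mul k k n]

theorem diagonalCircuit_cons {n : ℕ} (d : Fin n → ℝ) (k : Fin n) (l : List (Fin n)) :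
    diagonalCircuit d (k :: l) = [.const n (d k), .mul k k n] ++ diagonalCircuit d l := rfl

theorem cost_diagonalCircuit {n : ℕ} (d : Fin n → ℝ) (l : List (Fin n)) :
    (diagonalCircuit d l).cost = 2 * l.length := by
  induction l with
  | nil => rfl
  | cons k l ih =>
    rw [diagonalCircuit_cons, Circuit.cost_append, ih, List.length_cons, Circuit.cost_cons,
      Circuit.cost_cons, Circuit.cost_nil]
    simp only [Gate.cost]
    omega

/-- The list must be free of repetitions, since a repeated index would be scaled twice. -/
theorem implements_diagonalCircuit_list {n : ℕ} (d : Fin n → ℝ) {l : List (Fin n)}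
    (hl : l.Nodup) :
    Implements (diagonalCircuit d l) (Matrix.diagonal fun k => if k ∈ l then d k else 1) := by
  induction l with
  | nil => simpa [diagonalCircuit] using implements_nil n
  | cons k l ih =>
    rw [List.nodup_cons] at hl
    have h1 : Implements [.const n (d k), .mul k k n]
        (Matrix.diagonal fun i => if i = k then d k else 1) := by
      intro s
      ext i
      rw [Matrix.mulVec_diagonal]
      have hi := i.2
      have hk := k.2
      simp only [Circuit.run, List.foldl, Gate.step, Gate.target, Gate.value,
        Function.update_apply, Fin.ext_iff]
      grind
    have h2 := h1.append (ih hl.2)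
    rw [Matrix.diagonal_mul_diagonal] at h2
    rw [diagonalCircuit_cons]
    have hd : (fun i => (if i ∈ l then d i else 1) * if i = k then d k else 1) =
        fun i => if i ∈ k :: l then d i else 1 := by
      ext i
      simp only [List.mem_cons]
      by_cases hik : i = k
      · subst hik
        simp [hl.1]
      · simp [hik]
    rwa [hd] at h2

theorem implements_diagonalCircuit {n : ℕ} (d : Fin n → ℝ) :
    Implements (diagonalCircuit d (List.finRange n)) (Matrix.diagonal d) := by
  simpa using implements_diagonalCircuit_list d (List.nodup_finRange n)

/-! ### Writing out circuits -/

/-- The circuits `C a` have the same shape, and their parameters can be computed from `fs`. -/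
def EasyCode (fs : Set (α → ℝ)) (c : ℕ) (C : α → Circuit) : Prop :=
  ∃ L : List (α → Gate), (∀ a, C a = L.map fun g => g a) ∧
    Easy fs c {f | ∃ g ∈ L, ∃ q, f = fun a => (g a).code q}

theorem EasyCode.nil (fs : Set (α → ℝ)) (c : ℕ) : EasyCode fs c fun _ : α => [] :=
  ⟨[], fun _ => rfl, Easy.of_subset (by simp) _⟩

theorem EasyCode.append {fs : Set (α → ℝ)} {c d : ℕ} {C D : α → Circuit} (hC : EasyCode fs c C)
    (hD : EasyCode fs d D) : EasyCode fs (c + d) fun a => C a ++ D a := by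
  obtain ⟨L, hL, h⟩ := hC
  obtain ⟨L', hL', h'⟩ := hD
  refine ⟨L ++ L', fun a => by simp only [hL, hL', List.map_append], (h.union h').mono ?_ le_rfl⟩
  refine Set.Subset.trans ?_ (subset_withConsts _)
  rintro f ⟨g, hg, q, rfl⟩
  rcases List.mem_append.mp hg with hg | hg
  · exact Or.inl ⟨g, hg, q, rfl⟩
  · exact Or.inr ⟨g, hg, q, rfl⟩

theorem EasyCode.of_forall {fs : Set (α → ℝ)} (L : List (α → Gate))
    (h : ∀ g ∈ L, ∀ q, (fun a => (g a).code q) ∈ withConsts fs) (c : ℕ) :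
    EasyCode fs c fun a => L.map fun g => g a :=
  ⟨L, fun _ => rfl, Easy.of_subset (by rintro f ⟨g, hg, q, rfl⟩; exact h g hg q) _⟩

theorem EasyCode.mono {fs : Set (α → ℝ)} {c d : ℕ} {C : α → Circuit} (hC : EasyCode fs c C)
    (h : c ≤ d) : EasyCode fs d C :=
  let ⟨L, hL, h'⟩ := hC
  ⟨L, hL, h'.mono_cost h⟩

theorem EasyCode.comp {fs gs : Set (α → ℝ)} {c d : ℕ} {C : α → Circuit} (h : Easy fs c gs)
    (hC : EasyCode gs d C) : EasyCode fs (c + d) C :=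
  let ⟨L, hL, h'⟩ := hC
  ⟨L, hL, h.comp h'⟩

/-- The number of gates does not depend on the parameter, so the leading coordinate and the padding
are constants. -/
theorem EasyCode.code {fs : Set (α → ℝ)} {c : ℕ} {C : α → Circuit} (hC : EasyCode fs c C) :
    Easy fs c (Set.range fun k a => (C a).code k) := by
  obtain ⟨L, hL, h⟩ := hC
  refine h.mono ?_ le_rfl
  rintro _ ⟨k, rfl⟩
  have hlen : ∀ a, (C a).length = L.length := fun a => by rw [hL, List.length_map]
  cases k with
  | zero =>
    simp only [Circuit.code, hlen]
    exact const_mem_withConsts _ _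
  | succ k =>
    simp only [Circuit.code, hlen]
    split_ifs with hk
    · refine subset_withConsts _ ⟨L[k / 5], List.getElem_mem _,
        ⟨k % 5, Nat.mod_lt _ (by norm_num)⟩, funext fun a => ?_⟩
      simp [hL]
    · exact const_mem_withConsts _ _

theorem Circuit.code_eq_zero (C : Circuit) {k : ℕ} (hk : 5 * C.length + 1 ≤ k) : C.code k = 0 := by
  cases k with
  | zero => omega
  | succ k => exact dif_neg (by omega)

/-- The wire numbers `i a` and `j a` are random too: in the code they are real data that must be
computed like the angle. -/
theorem EasyCode.rotationCircuit {fs : Set (α → ℝ)} (n : ℕ) {i j : α → ℕ} {c s : α → ℝ}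
    (hi : (fun a => (i a : ℝ)) ∈ withConsts fs) (hj : (fun a => (j a : ℝ)) ∈ withConsts fs)
    (hc : c ∈ withConsts fs) (hs : s ∈ withConsts fs) :
    EasyCode fs 0 fun a => rotationCircuit n (i a) (j a) (c a) (s a) := by
  refine EasyCode.of_forall [fun a => .const n (c a), fun a => .const (n + 1) (s a),
    fun a => .mul (n + 2) n (i a), fun a => .mul (n + 3) (n + 1) (j a),
    fun a => .mul (n + 4) (n + 1) (i a), fun a => .mul (n + 5) n (j a),
    fun a => .sub (i a) (n + 2) (n + 3), fun a => .add (j a) (n + 4) (n + 5)] ?_ 0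
  simp only [List.forall_mem_cons, List.not_mem_nil, false_imp_iff, implies_true, and_true]
  refine ⟨?_, ?_, ?_, ?_, ?_, ?_, ?_, ?_⟩ <;> intro q <;> fin_cases q <;>
    first
    | exact const_mem_withConsts _ _
    | exact hi
    | exact hj
    | exact hc
    | exact hs

theorem EasyCode.diagonalCircuit {fs : Set (α → ℝ)} {n : ℕ} {d : α → Fin n → ℝ}
    (hd : ∀ k, (fun a => d a k) ∈ withConsts fs) (l : List (Fin n)) :
    EasyCode fs 0 fun a => diagonalCircuit (d a) l := by
  induction l with
  | nil => exact EasyCode.nil _ _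
  | cons k l ih =>
    refine EasyCode.append (c := 0) (d := 0) ?_ ih
    refine EasyCode.of_forall [fun a => .const n (d a k), fun a => .mul k k n] ?_ 0
    simp only [List.forall_mem_cons, List.not_mem_nil, false_imp_iff, implies_true, and_true]
    refine ⟨?_, ?_⟩ <;> intro q <;> fin_cases q <;>
      first
      | exact const_mem_withConsts _ _
      | exact hd k

theorem EasyCode.stepCircuit_aux {fs : Set (α → ℝ)} {u : α → ℝ} (hu : u ∈ withConsts fs) {n : ℕ}
    (hn : 2 ≤ n) {c s : α → ℝ} (hc : c ∈ withConsts (trigFns n u))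
    (hs : s ∈ withConsts (trigFns n u)) :
    EasyCode fs (24 * n ^ 2 + 40) fun a => Trapdoor.rotationCircuit n
      (pairAt hn (stepIndex n (u a))).1 (pairAt hn (stepIndex n (u a))).2 (c a) (s a) := by
  have h1 := Easy.stepIndex hu n (φ := fun k _ => (((pairAt hn k).1 : ℕ) : ℝ))
    fun k => const_mem_withConsts _ _
  have h2 := Easy.stepIndex hu n (φ := fun k _ => (((pairAt hn k).2 : ℕ) : ℝ))
    fun k => const_mem_withConsts _ _
  refine (EasyCode.comp ((h1.union h2).union (Easy.trigFns hu n))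
    (EasyCode.rotationCircuit n ?_ ?_ ?_ ?_)).mono (show _ ≤ _ by omega)
  · exact subset_withConsts _ (Or.inl (Or.inl rfl))
  · exact subset_withConsts _ (Or.inl (Or.inr rfl))
  · exact withConsts_mono Set.subset_union_right hc
  · exact withConsts_mono Set.subset_union_right hs

theorem EasyCode.stepCircuit {fs : Set (α → ℝ)} {u : α → ℝ} (hu : u ∈ withConsts fs) (n : ℕ) :
    EasyCode fs (24 * n ^ 2 + 40) fun a => stepCircuit n (u a) := by
  unfold Trapdoor.stepCircuit
  split_ifs with hn
  · exact EasyCode.stepCircuit_aux hu hn (subset_withConsts _ (Or.inl rfl))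
      (subset_withConsts _ (Or.inr (Or.inl rfl)))
  · exact EasyCode.nil _ _

theorem EasyCode.stepCircuitTranspose {fs : Set (α → ℝ)} {u : α → ℝ} (hu : u ∈ withConsts fs)
    (n : ℕ) : EasyCode fs (24 * n ^ 2 + 40) fun a => stepCircuitTranspose n (u a) := by
  unfold Trapdoor.stepCircuitTranspose
  split_ifs with hn
  · exact EasyCode.stepCircuit_aux hu hn (subset_withConsts _ (Or.inl rfl))
      (subset_withConsts _ (Or.inr (Or.inr rfl)))
  · exact EasyCode.nil _ _

theorem EasyCode.walkCircuit {fs : Set (α → ℝ)} (n t : ℕ) {c : α → Fin t → ℝ × ℝ}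
    (hc : ∀ k, (fun a => (c a k).1) ∈ withConsts fs) :
    EasyCode fs (t * (24 * n ^ 2 + 40)) fun a => walkCircuit n t (c a) := by
  induction t with
  | zero => exact EasyCode.nil _ _
  | succ t ih =>
    exact ((ih (c := fun a => Fin.tail (c a)) fun k => hc k.succ).append
      (EasyCode.stepCircuit (hc 0) n)).mono (by rw [← Nat.succ_mul])

theorem EasyCode.walkCircuitTranspose {fs : Set (α → ℝ)} (n t : ℕ) {c : α → Fin t → ℝ × ℝ}
    (hc : ∀ k, (fun a => (c a k).1) ∈ withConsts fs) :
    EasyCode fs (t * (24 * n ^ 2 + 40)) fun a => walkCircuitTranspose n t (c a) := by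
  induction t with
  | zero => exact EasyCode.nil _ _
  | succ t ih =>
    exact ((EasyCode.stepCircuitTranspose (hc 0) n).append
      (ih (c := fun a => Fin.tail (c a)) fun k => hc k.succ)).mono
        (by rw [add_comm, ← Nat.succ_mul])

end

end Trapdoor

/-! ### Polynomial bounds and the hybrid step for indistinguishability. -/

namespace Trapdoor

noncomputable section

open Matrix

variable {α β : Type*}

/-! ### Polynomial bounds -/

theorem PolyBounded.mono {f g : ℕ → ℕ} (hg : PolyBounded g) (h : ∀ n, f n ≤ g n) :
    PolyBounded f :=
  let ⟨p, hp⟩ := hg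
  ⟨p, fun n => (h n).trans (hp n)⟩

theorem PolyBounded.add {f g : ℕ → ℕ} (hf : PolyBounded f) (hg : PolyBounded g) :
    PolyBounded fun n => f n + g n :=
  let ⟨p, hp⟩ := hf
  let ⟨q, hq⟩ := hg
  ⟨p + q, fun n => by rw [Polynomial.eval_add]; exact add_le_add (hp n) (hq n)⟩

theorem PolyBounded.mul {f g : ℕ → ℕ} (hf : PolyBounded f) (hg : PolyBounded g) :
    PolyBounded fun n => f n * g n :=
  let ⟨p, hp⟩ := hf
  let ⟨q, hq⟩ := hg
  ⟨p * q, fun n => by rw [Polynomial.eval_mul]; exact Nat.mul_le_mul (hp n) (hq n)⟩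

theorem polyBounded_const (c : ℕ) : PolyBounded fun _ => c :=
  ⟨Polynomial.C c, fun n => by simp⟩

theorem polyBounded_id : PolyBounded fun n => n := ⟨Polynomial.X, fun n => by simp⟩

theorem polyBounded_pow (k : ℕ) : PolyBounded fun n => n ^ k :=
  ⟨Polynomial.X ^ k, fun n => by simp⟩

theorem IsQuasilinear.polyBounded {T : ℕ → ℕ} (hT : IsQuasilinear T) : PolyBounded T := by
  obtain ⟨c, k, h⟩ := hT
  -- Quasilinearity says nothing about `n < 2`; these two values are covered by the constant.
  refine PolyBounded.mono (((polyBounded_const (T 0 + T 1)).add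
    (((polyBounded_const c).mul polyBounded_id).mul (polyBounded_pow k)))) fun n => ?_
  rcases lt_or_ge n 2 with hn | hn
  · interval_cases n <;> omega
  · refine (h n hn).trans (le_trans ?_ (Nat.le_add_left _ _))
    exact Nat.mul_le_mul_left _ (Nat.pow_le_pow_left (Nat.log_le_self 2 n) k)

/-! ### Composition with a map -/

theorem Reach.precomp {fs gs : Set (α → ℝ)} {c : ℕ} (h : Reach fs c gs) (φ : β → α) :
    Reach ((· ∘ φ) '' fs) c ((· ∘ φ) '' gs) := by
  induction h with
  | refl => exact .refl
  | gate h g s hs ih =>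
    rw [Set.image_insert_eq]
    refine .gate ih g (fun b => s (φ b)) fun w => ?_
    rcases hs w with h' | ⟨c, h'⟩
    · exact Or.inl ⟨_, h', rfl⟩
    · exact Or.inr ⟨c, funext fun b => congrFun h' (φ b)⟩

theorem Easy.precomp {fs gs : Set (α → ℝ)} {c : ℕ} (h : Easy fs c gs) (φ : β → α) :
    Easy ((· ∘ φ) '' fs) c ((· ∘ φ) '' gs) := by
  obtain ⟨c', hc, X, hX, hR⟩ := h
  refine ⟨c', hc, _, ?_, hR.precomp φ⟩
  rintro _ ⟨f, hf, rfl⟩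
  rcases hX hf with h' | ⟨c, rfl⟩
  · exact Or.inl ⟨_, h', rfl⟩
  · exact Or.inr ⟨c, rfl⟩

theorem image_comp_entryFns {m n : Type*} (X : α → Matrix m n ℝ) (φ : β → α) :
    (· ∘ φ) '' entryFns X = entryFns fun b => X (φ b) := by
  rw [entryFns, ← Set.range_comp]
  rfl

/-! ### The acceptance probability -/

theorem measurable_entries (n : ℕ) : Measurable (entries : Mat n → ℕ → ℝ) := by
  refine measurable_pi_lambda _ fun k => ?_
  unfold entries
  split_ifs
  · exact measurable_matrix_iff.mp measurable_id _ _
  · exact measurable_const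

theorem measurable_tape (r : ℕ) : Measurable (tape : (Fin r → ℝ × ℝ) → ℕ → ℝ) := by
  refine measurable_pi_lambda _ fun k => ?_
  unfold tape
  split_ifs
  · exact (measurable_pi_apply _).fst
  · exact (measurable_pi_apply _).snd
  · exact measurable_const

theorem measurable_concat [MeasurableSpace α] (m : ℕ) {x y : α → ℕ → ℝ} (hx : Measurable x)
    (hy : Measurable y) : Measurable fun a => concat m (x a) (y a) := by
  refine measurable_pi_lambda _ fun k => ?_
  unfold concat
  split_ifs
  · exact (measurable_pi_apply k).comp hx
  · exact (measurable_pi_apply _).comp hy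

/-- The probability that a circuit accepts a given matrix. -/
def acceptProbAt {n : ℕ} (C : Circuit) (r : ℕ) (A : Mat n) : ℝ :=
  (coins r).real {c | C.run (concat (n * n) (entries A) (tape c)) 0 = 1}

theorem measurableSet_accept (n : ℕ) (C : Circuit) (r : ℕ) :
    MeasurableSet {p : Mat n × (Fin r → ℝ × ℝ) |
      C.run (concat (n * n) (entries p.1) (tape p.2)) 0 = 1} := by
  have h : Measurable fun p : Mat n × (Fin r → ℝ × ℝ) =>
      C.run (concat (n * n) (entries p.1) (tape p.2)) 0 :=
    (measurable_pi_apply 0).comp (C.measurable_run.comp (measurable_concat _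
      ((measurable_entries n).comp measurable_fst) ((measurable_tape r).comp measurable_snd)))
  exact h (measurableSet_singleton 1)

theorem measurable_acceptProbAt {n : ℕ} (C : Circuit) (r : ℕ) :
    Measurable (acceptProbAt C r : Mat n → ℝ) :=
  (measurable_measure_prodMk_left (measurableSet_accept n C r)).ennreal_toReal

theorem acceptProbAt_mem {n : ℕ} (C : Circuit) (r : ℕ) (A : Mat n) :
    0 ≤ acceptProbAt C r A ∧ acceptProbAt C r A ≤ 1 :=
  ⟨measureReal_nonneg, measureReal_le_one⟩

theorem acceptProb_eq_integral {n : ℕ} (C : Circuit) (r : ℕ) (μ : Measure (Mat n))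
    [IsProbabilityMeasure μ] : acceptProb C r μ = ∫ A, acceptProbAt C r A ∂μ := by
  have hE := measurableSet_accept n C r
  rw [acceptProb, measureReal_def, Measure.prod_apply hE, ← integral_toReal]
  · rfl
  · exact (measurable_measure_prodMk_left hE).aemeasurable
  · exact Filter.Eventually.of_forall fun A => measure_lt_top _ _

theorem integrable_acceptProbAt_comp [MeasurableSpace α] {n : ℕ} (C : Circuit) (r : ℕ)
    (μ : Measure α) [IsProbabilityMeasure μ] {f : α → Mat n} (hf : Measurable f) :
    Integrable (fun a => acceptProbAt C r (f a)) μ := by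
  refine Integrable.of_bound ((measurable_acceptProbAt C r).comp hf).aestronglyMeasurable 1
    (Filter.Eventually.of_forall fun a => ?_)
  rw [Real.norm_eq_abs, abs_le]
  have := acceptProbAt_mem C r (f a)
  constructor <;> linarith

theorem acceptProb_map [MeasurableSpace α] {n : ℕ} (C : Circuit) (r : ℕ) (μ : Measure α)
    [IsProbabilityMeasure μ] {f : α → Mat n} (hf : Measurable f) :
    acceptProb C r (μ.map f) = ∫ a, acceptProbAt C r (f a) ∂μ := by
  have := Measure.isProbabilityMeasure_map (μ := μ) hf.aemeasurable
  rw [acceptProb_eq_integral, integral_map hf.aemeasurable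
    (measurable_acceptProbAt C r).aestronglyMeasurable]

/-- Running a distinguisher on a transformed matrix. -/
theorem exists_precomp_circuit {n κ : ℕ} {f : Mat n → Mat n}
    (hf : Easy (entryFns (id : Mat n → Mat n)) κ (entryFns f)) (C : Circuit) (r : ℕ) :
    ∃ D : Circuit, D.cost ≤ κ + 4 * C.cost + 2 ∧ ∀ A : Mat n,
      acceptProbAt D r A = acceptProbAt C r (f A) := by
  let init : Mat n × (Fin r → ℝ × ℝ) → ℕ → ℝ := fun p => concat (n * n) (entries p.1) (tape p.2)
  set fs : Set (Mat n × (Fin r → ℝ × ℝ) → ℝ) := Set.range fun w p => init p w with hfs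
  have hinit : ∀ p, ∀ w ≥ n * n + 2 * r, init p w = 0 := by
    intro p w hw
    simp only [init, concat, if_neg (show ¬ w < n * n by omega), tape,
      dif_neg (show ¬ (w - n * n) / 2 < r by omega)]
  have h1 : Easy fs κ (entryFns fun p : Mat n × (Fin r → ℝ × ℝ) => f p.1) := by
    have := hf.precomp (Prod.fst : Mat n × (Fin r → ℝ × ℝ) → Mat n)
    rw [image_comp_entryFns, image_comp_entryFns] at this
    refine this.weaken (Set.Subset.trans ?_ (subset_withConsts _))
    rintro _ ⟨⟨i, j⟩, rfl⟩
    refine ⟨i * n + j, funext fun p => ?_⟩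
    have hlt : (i : ℕ) * n + j < n * n := by
      have hi := i.2; have hj := j.2
      nlinarith
    simp only [init, concat, if_pos hlt, entries_apply]
    rfl
  have h2 := Easy.run C (fs := fs ∪ entryFns fun p : Mat n × (Fin r → ℝ × ℝ) => f p.1)
    (s := fun p => concat (n * n) (entries (f p.1)) (tape p.2)) fun w => by
      unfold concat
      split_ifs with hw
      · exact withConsts_mono Set.subset_union_right
          (entries_mem_withConsts (subset_withConsts _) w)
      · refine subset_withConsts _ (Or.inl ⟨w, funext fun p => ?_⟩)
        simp only [init, concat, if_neg hw]
  have h3 : Easy fs (κ + 4 * C.cost) (Set.range fun (w : ℕ) (p : Mat n × (Fin r → ℝ × ℝ)) =>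
      C.run (concat (n * n) (entries (f p.1)) (tape p.2)) w) :=
    (h1.trans h2).mono (Set.subset_union_right.trans (subset_withConsts _)) le_rfl
  obtain ⟨D, hD, hrun⟩ := h3.exists_circuit hinit (by rintro _ ⟨w, rfl⟩; exact ⟨w, fun _ => rfl⟩) 1
  refine ⟨D, hD, fun A => ?_⟩
  unfold acceptProbAt
  congr 1
  ext c
  have := hrun (A, c) 0 one_pos
  simp only [Set.mem_ofPred_eq]
  rw [← this]

/-! ### Indistinguishability -/

theorem Indistinguishable.trans {μ ν ρ : ∀ n : ℕ, Measure (Mat n)}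
    (h : Indistinguishable μ ν) (h' : Indistinguishable ν ρ) : Indistinguishable μ ρ := by
  intro 𝒜 r h𝒜 hr
  refine ((h 𝒜 r h𝒜 hr).add (h' 𝒜 r h𝒜 hr)).trans_abs_le fun n => ?_
  rw [abs_abs]
  exact (abs_sub_le _ _ _).trans (le_abs_self _)

/-- Indistinguishability is preserved if a matrix is combined, by an efficiently computable
function, with independent data of arbitrary distribution: the best choice of these data can be
built into the distinguisher. -/
theorem Indistinguishable.map_prod {μ ν : ∀ n : ℕ, Measure (Mat n)}
    [∀ n, IsProbabilityMeasure (μ n)] [∀ n, IsProbabilityMeasure (ν n)]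
    (h : Indistinguishable μ ν) {β : ℕ → Type*} [∀ n, MeasurableSpace (β n)]
    (π : ∀ n, Measure (β n)) [∀ n, IsProbabilityMeasure (π n)] {f : ∀ n, Mat n × β n → Mat n}
    (hf : ∀ n, Measurable (f n)) {κ : ℕ → ℕ} (hκ : PolyBounded κ)
    (heasy : ∀ n b, Easy (entryFns (id : Mat n → Mat n)) (κ n) (entryFns fun A => f n (A, b))) :
    Indistinguishable (fun n => ((μ n).prod (π n)).map (f n))
      (fun n => ((ν n).prod (π n)).map (f n)) := by
  intro 𝒜 r h𝒜 hr
  -- The datum `b` enters `D n b` only through constants of the circuit, and the cost bound is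
  -- uniform in `b`.
  choose! D hD hacc using fun n b => exists_precomp_circuit (heasy n b) (𝒜 n) (r n)
  have hdiff : ∀ n, ∃ b : β n,
      |acceptProb (𝒜 n) (r n) (((μ n).prod (π n)).map (f n)) -
        acceptProb (𝒜 n) (r n) (((ν n).prod (π n)).map (f n))| ≤
      |acceptProb (D n b) (r n) (μ n) - acceptProb (D n b) (r n) (ν n)| := by
    intro n
    have hint : ∀ ρ : Measure (Mat n), IsProbabilityMeasure ρ →
        Integrable (fun b => acceptProb (D n b) (r n) ρ) (π n) ∧
        acceptProb (𝒜 n) (r n) ((ρ.prod (π n)).map (f n)) =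
          ∫ b, acceptProb (D n b) (r n) ρ ∂(π n) := by
      intro ρ hρ
      have hi := integrable_acceptProbAt_comp (𝒜 n) (r n) (ρ.prod (π n)) (hf n)
      have he : ∀ b, acceptProb (D n b) (r n) ρ =
          ∫ A, acceptProbAt (𝒜 n) (r n) (f n (A, b)) ∂ρ := fun b => by
        rw [acceptProb_eq_integral]
        exact integral_congr_ae (Filter.Eventually.of_forall (hacc n b))
      simp only [he]
      refine ⟨hi.integral_prod_right, ?_⟩
      rw [acceptProb_map _ _ _ (hf n), integral_prod_symm _ hi]
    obtain ⟨hi1, he1⟩ := hint (μ n) inferInstance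
    obtain ⟨hi2, he2⟩ := hint (ν n) inferInstance
    rw [he1, he2, ← integral_sub hi1 hi2]
    -- Some `b` achieves at least the average absolute advantage. A maximum need not exist.
    obtain ⟨b, hb⟩ := exists_integral_le (hi1.sub hi2).abs
    exact ⟨b, abs_integral_le_integral_abs.trans hb⟩
  choose b hb using hdiff
  refine (h (fun n => D n (b n)) r ?_ hr).trans_abs_le fun n => ?_
  · exact PolyBounded.mono ((hκ.add ((polyBounded_const 4).mul h𝒜)).add (polyBounded_const 2))
      fun n => hD n (b n)
  · rw [abs_abs, abs_abs]
    exact hb n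

end

end Trapdoor

/-! ### Seeds, and sampling the pair of matrix and circuit from coins. -/

namespace Trapdoor

noncomputable section

open Matrix

/-! ### Trapdoored matrices from coins and a random matrix -/

/-- The randomness of the construction: the coins of two walks, and a matrix. -/
abbrev Seed (n t : ℕ) := (Fin t → ℝ × ℝ) × Mat n × (Fin t → ℝ × ℝ)

def seedLaw {n : ℕ} (t : ℕ) (μ : Measure (Mat n)) : Measure (Seed n t) :=
  (coins t).prod (μ.prod (coins t))

instance isProbabilityMeasure_seedLaw {n : ℕ} (t : ℕ) (μ : Measure (Mat n))
    [IsProbabilityMeasure μ] : IsProbabilityMeasure (seedLaw t μ) := by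
  unfold seedLaw; infer_instance

/-- The numbers that the construction uses. -/
def seedFns (n t : ℕ) : Set (Seed n t → ℝ) :=
  entryFns (fun ω : Seed n t => ω.2.1) ∪
    (Set.range (fun (k : Fin t) (ω : Seed n t) => (ω.1 k).1) ∪
      Set.range fun (k : Fin t) (ω : Seed n t) => (ω.2.2 k).1)

theorem measurable_of_mem_seedFns {n t : ℕ} : ∀ f ∈ seedFns n t, Measurable f := by
  rintro f (⟨p, rfl⟩ | ⟨k, rfl⟩ | ⟨k, rfl⟩)
  · exact measurable_matrix_iff.mp measurable_snd.fst _ _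
  · exact ((measurable_pi_apply k).comp measurable_fst).fst
  · exact ((measurable_pi_apply k).comp measurable_snd.snd).fst

theorem entryFns_subset_seedFns (n t : ℕ) :
    entryFns (fun ω : Seed n t => ω.2.1) ⊆ withConsts (seedFns n t) :=
  Set.subset_union_left.trans (subset_withConsts _)

theorem left_coin_mem_seedFns {n t : ℕ} (k : Fin t) :
    (fun ω : Seed n t => (ω.1 k).1) ∈ withConsts (seedFns n t) :=
  subset_withConsts _ (Or.inr (Or.inl ⟨k, rfl⟩))

theorem right_coin_mem_seedFns {n t : ℕ} (k : Fin t) :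
    (fun ω : Seed n t => (ω.2.2 k).1) ∈ withConsts (seedFns n t) :=
  subset_withConsts _ (Or.inr (Or.inr ⟨k, rfl⟩))

/-- Matrices and circuits that are computed from a seed. -/
def trapdooredOfSeed {n t κ κ' : ℕ} (μ : Measure (Mat n)) [IsProbabilityMeasure μ]
    (M : Seed n t → Mat n) (C : Seed n t → Circuit) (hM : Easy (seedFns n t) κ (entryFns M))
    (hC : EasyCode (seedFns n t) κ' C) (h : ∀ ω, Implements (C ω) (M ω)) :
    TrapdooredMatrices n where
  Ω := Seed n t
  P := seedLaw t μ
  M := M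
  C := C
  measurable_M := measurable_matrix_iff.mpr fun i j =>
    hM.measurable Gate.measurable_value measurable_of_mem_seedFns _ (mem_entryFns M i j)
  measurable_C := measurable_pi_lambda _ fun k =>
    hC.code.measurable Gate.measurable_value measurable_of_mem_seedFns _ ⟨k, rfl⟩
  correct ω v := (h ω).apply_eq v

/-! ### Sampling -/

theorem map_coins_add (a b : ℕ) :
    (coins (a + b)).map (fun c => ((fun k => c (Fin.castAdd b k) : Fin a → ℝ × ℝ),
      (fun k => c (Fin.natAdd a k) : Fin b → ℝ × ℝ))) = (coins a).prod (coins b) := by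
  have happ : Measurable fun p : (Fin a → ℝ × ℝ) × (Fin b → ℝ × ℝ) => Fin.append p.1 p.2 := by
    refine measurable_pi_lambda _ fun k => ?_
    refine Fin.addCases (fun i => ?_) (fun i => ?_) k
    · simp only [Fin.append_left]
      exact (measurable_pi_apply i).comp measurable_fst
    · simp only [Fin.append_right]
      exact (measurable_pi_apply i).comp measurable_snd
  have hsplit : Measurable fun c : Fin (a + b) → ℝ × ℝ =>
      ((fun k => c (Fin.castAdd b k) : Fin a → ℝ × ℝ),
        (fun k => c (Fin.natAdd a k) : Fin b → ℝ × ℝ)) :=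
    (measurable_pi_lambda _ fun k => measurable_pi_apply _).prodMk
      (measurable_pi_lambda _ fun k => measurable_pi_apply _)
  have h : coins (a + b) = ((coins a).prod (coins b)).map fun p => Fin.append p.1 p.2 := by
    refine Measure.pi_eq fun s hs => ?_
    rw [Measure.map_apply happ (MeasurableSet.univ_pi hs)]
    have : (fun p : (Fin a → ℝ × ℝ) × (Fin b → ℝ × ℝ) => Fin.append p.1 p.2) ⁻¹'
        Set.univ.pi s = (Set.univ.pi fun k => s (Fin.castAdd b k)) ×ˢ
          (Set.univ.pi fun k => s (Fin.natAdd a k)) := by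
      ext p
      simp only [Set.mem_preimage, Set.mem_univ_pi, Set.mem_prod]
      constructor
      · intro h
        exact ⟨fun k => by simpa using h (Fin.castAdd b k), fun k => by simpa using h (Fin.natAdd a k)⟩
      · rintro ⟨h1, h2⟩ k
        refine Fin.addCases (fun i => ?_) (fun i => ?_) k
        · simpa using h1 i
        · simpa using h2 i
    rw [this, Measure.prod_prod, coins, coins, Measure.pi_pi, Measure.pi_pi, Fin.prod_univ_add]
  rw [h, Measure.map_map hsplit happ]
  convert Measure.map_id using 2
  ext1 p
  simp

/-- The matrix with the given entries. -/
def ofEntries (n : ℕ) (x : ℕ → ℝ) : Mat n := Matrix.of fun i j => x (i * n + j)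

theorem ofEntries_entries {n : ℕ} (A : Mat n) : ofEntries n (entries A) = A := by
  ext i j
  exact entries_apply A i j

theorem measurable_ofEntries (n : ℕ) : Measurable (ofEntries n) :=
  measurable_matrix_iff.mpr fun _ _ => measurable_pi_apply _

theorem tape_two_mul {r : ℕ} (c : Fin r → ℝ × ℝ) (k : Fin r) : tape c (2 * k) = (c k).1 := by
  have h : 2 * (k : ℕ) / 2 = k := by omega
  simp [tape]

theorem tape_eq_zero {r : ℕ} (c : Fin r → ℝ × ℝ) {k : ℕ} (hk : 2 * r ≤ k) : tape c k = 0 :=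
  dif_neg (by omega)

/-- The wires of a tape. -/
def tapeFns (r : ℕ) : Set ((Fin r → ℝ × ℝ) → ℝ) := Set.range fun k c => tape c k

theorem coin_fst_mem_tapeFns {r : ℕ} (k : Fin r) :
    (fun c : Fin r → ℝ × ℝ => (c k).1) ∈ tapeFns r :=
  ⟨2 * k, funext fun c => tape_two_mul c k⟩

theorem tape_comp_mem_tapeFns {r r' : ℕ} (e : Fin r' → Fin r) (w : ℕ) :
    (fun c : Fin r → ℝ × ℝ => tape (fun k => c (e k)) w) ∈ withConsts (tapeFns r) := by
  unfold tape
  split_ifs with h1 h2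
  · exact subset_withConsts _ (coin_fst_mem_tapeFns _)
  · refine subset_withConsts _ ⟨2 * (e ⟨w / 2, h1⟩ : ℕ) + 1, funext fun c => ?_⟩
    have h : (2 * (e ⟨w / 2, h1⟩ : ℕ) + 1) / 2 = e ⟨w / 2, h1⟩ := by omega
    simp [tape, h]
  · exact const_mem_withConsts _ _

/-- The seed that is computed from coins, given a sampler for the matrix. -/
def seedOfCoins {n : ℕ} (t r N : ℕ) (S : Circuit) (c : Fin (t + (r + t)) → ℝ × ℝ) : Seed n t :=
  (fun k => c (Fin.castAdd _ k),
    ofEntries n (concat N (S.run (tape fun k => c (Fin.natAdd t (Fin.castAdd t k)))) 0),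
    fun k => c (Fin.natAdd t (Fin.natAdd r k)))

/-- Disjoint batches of `t`, `r` and `t` coins are independent. The law of the matrix is recovered
from that of its entries because `ofEntries` inverts `entries`. -/
theorem map_seedOfCoins {n t r N : ℕ} {S : Circuit} {μ : Measure (Mat n)} [IsProbabilityMeasure μ]
    (h : μ.map entries = (coins r).map fun c => concat N (S.run (tape c)) 0) :
    (coins (t + (r + t))).map (seedOfCoins t r N S) = seedLaw t μ ∧
      Measurable (seedOfCoins t r N S : _ → Seed n t) := by
  have hout : Measurable fun c : Fin r → ℝ × ℝ => concat N (S.run (tape c)) 0 :=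
    measurable_concat _ (S.measurable_run.comp (measurable_tape r)) measurable_const
  have hA : Measurable fun c : Fin r → ℝ × ℝ =>
      ofEntries n (concat N (S.run (tape c)) 0) := (measurable_ofEntries n).comp hout
  have hμ : μ = (coins r).map fun c => ofEntries n (concat N (S.run (tape c)) 0) := by
    have := congrArg (Measure.map (ofEntries n)) h
    rw [Measure.map_map (measurable_ofEntries n) (measurable_entries n),
      Measure.map_map (measurable_ofEntries n) hout] at this
    have hid : ofEntries n ∘ entries = (id : Mat n → Mat n) := funext ofEntries_entries
    rwa [hid, Measure.map_id] at this
  have hs1 : Measurable fun c : Fin (t + (r + t)) → ℝ × ℝ =>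
      ((fun k => c (Fin.castAdd _ k) : Fin t → ℝ × ℝ),
        (fun k => c (Fin.natAdd t k) : Fin (r + t) → ℝ × ℝ)) :=
    (measurable_pi_lambda _ fun k => measurable_pi_apply _).prodMk
      (measurable_pi_lambda _ fun k => measurable_pi_apply _)
  have hs2 : Measurable fun c : Fin (r + t) → ℝ × ℝ =>
      ((fun k => c (Fin.castAdd _ k) : Fin r → ℝ × ℝ),
        (fun k => c (Fin.natAdd r k) : Fin t → ℝ × ℝ)) :=
    (measurable_pi_lambda _ fun k => measurable_pi_apply _).prodMk
      (measurable_pi_lambda _ fun k => measurable_pi_apply _)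
  have e1 : (coins (r + t)).map (fun c => (ofEntries n (concat N (S.run (tape
      fun k => c (Fin.castAdd t k))) 0), fun k => c (Fin.natAdd r k))) = μ.prod (coins t) := by
    have e := Measure.map_prod_map (coins r) (coins t) hA measurable_id
    rw [Measure.map_id, ← hμ] at e
    rw [e, ← map_coins_add r t, Measure.map_map (hA.prodMap measurable_id) hs2]
    rfl
  have hm2 : Measurable fun c : Fin (r + t) → ℝ × ℝ => (ofEntries n (concat N (S.run (tape
      fun k => c (Fin.castAdd t k))) 0), fun k => c (Fin.natAdd r k)) :=
    (hA.prodMap measurable_id).comp hs2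
  refine ⟨?_, (measurable_id.prodMap hm2).comp hs1⟩
  have e := Measure.map_prod_map (coins t) (coins (r + t)) measurable_id hm2
  rw [Measure.map_id, e1] at e
  rw [seedLaw, e, ← map_coins_add t (r + t), Measure.map_map (measurable_id.prodMap hm2) hs1]
  rfl

theorem easy_seedOfCoins (n t r N : ℕ) (S : Circuit) :
    Easy (tapeFns (t + (r + t))) (4 * S.cost)
      ((· ∘ (seedOfCoins t r N S : _ → Seed n t)) '' seedFns n t) := by
  refine (Easy.run S (s := fun c : Fin (t + (r + t)) → ℝ × ℝ =>
    tape fun k => c (Fin.natAdd t (Fin.castAdd t k)))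
    fun w => tape_comp_mem_tapeFns _ w).trans (Easy.of_subset (gs := _ '' _) ?_ 0) |>.mono
      (Set.subset_union_right.trans (subset_withConsts _)) le_rfl
  rintro _ ⟨f, (⟨p, rfl⟩ | ⟨k, rfl⟩ | ⟨k, rfl⟩), rfl⟩
  -- Entries beyond the output length `N` of the sampler are the constant `0` by padding.
  · by_cases hlt : (p.1 : ℕ) * n + p.2 < N
    · refine subset_withConsts _ (Or.inr ⟨p.1 * n + p.2, funext fun c => ?_⟩)
      simp [seedOfCoins, ofEntries, concat, hlt]
    · refine Or.inr ⟨0, funext fun c => ?_⟩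
      simp [seedOfCoins, ofEntries, concat, hlt]
  · exact subset_withConsts _ (Or.inl (coin_fst_mem_tapeFns _))
  · exact subset_withConsts _ (Or.inl (coin_fst_mem_tapeFns _))

theorem easy_output {n t κ κ' : ℕ} {M : Seed n t → Mat n} {C : Seed n t → Circuit}
    (hM : Easy (seedFns n t) κ (entryFns M)) (hC : EasyCode (seedFns n t) κ' C) :
    Easy (seedFns n t) (κ + κ')
      (Set.range fun k ω => concat (n * n) (entries (M ω)) (C ω).code k) := by
  refine (hM.union hC.code).mono ?_ le_rfl
  rintro _ ⟨k, rfl⟩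
  simp only [concat]
  split_ifs
  · exact withConsts_mono Set.subset_union_left (entries_mem_withConsts (subset_withConsts _) k)
  · exact subset_withConsts _ (Or.inr ⟨_, rfl⟩)

/-- The construction from a seed is efficiently samplable if the random matrix is. -/
theorem efficientlySamplable_pairLaw {T κ κ' ℓ : ℕ → ℕ} (hT : PolyBounded T) (hκ : PolyBounded κ)
    (hκ' : PolyBounded κ') (hℓ : PolyBounded ℓ) (μ : ∀ n : ℕ, Measure (Mat n))
    [∀ n, IsProbabilityMeasure (μ n)] {M : ∀ n, Seed n (T n) → Mat n}
    {C : ∀ n, Seed n (T n) → Circuit} (hM : ∀ n, Easy (seedFns n (T n)) (κ n) (entryFns (M n)))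
    (hC : ∀ n, EasyCode (seedFns n (T n)) (κ' n) (C n))
    (h : ∀ n ω, Implements (C n ω) (M n ω)) (hcost : ∀ n ω, (C n ω).cost ≤ ℓ n)
    (hμ : EfficientlySamplable fun n => (μ n).map entries) :
    EfficientlySamplable fun n =>
      (trapdooredOfSeed (μ n) (M n) (C n) (hM n) (hC n) (h n)).pairLaw := by
  obtain ⟨S, r, N, hS, hr, hN, hlaw⟩ := hμ
  have hex : ∀ n, ∃ D : Circuit, D.cost ≤ (4 * (S n).cost + (κ n + κ' n)) +
      2 * (n * n + (5 * ℓ n + 1)) ∧ ∀ c, ∀ k < n * n + (5 * ℓ n + 1), D.run (tape c) k =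
        concat (n * n) (entries (M n (seedOfCoins (T n) (r n) (N n) (S n) c)))
          (C n (seedOfCoins (T n) (r n) (N n) (S n) c)).code k := by
    intro n
    have h1 := (easy_seedOfCoins n (T n) (r n) (N n) (S n)).comp
      ((easy_output (hM n) (hC n)).precomp (seedOfCoins (T n) (r n) (N n) (S n)))
    rw [← Set.range_comp] at h1
    exact Easy.exists_circuit (out := fun c k =>
      concat (n * n) (entries (M n (seedOfCoins (T n) (r n) (N n) (S n) c)))
          (C n (seedOfCoins (T n) (r n) (N n) (S n) c)).code k)
      (fun c w hw => tape_eq_zero c hw) (by rintro _ ⟨w, rfl⟩; exact ⟨w, fun _ => rfl⟩) h1 _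
  choose D hD hrun using hex
  -- The output consists of `n²` entries, the gate count and five reals per gate. The number of
  -- gates is at most the cost, hence at most `ℓ n`, and everything beyond is zero.
  refine ⟨D, fun n => T n + (r n + T n), fun n => n * n + (5 * ℓ n + 1), ?_, hT.add (hr.add hT),
    ?_, fun n => ?_⟩
  · have hlen := (polyBounded_id.mul polyBounded_id).add
      (((polyBounded_const 5).mul hℓ).add (polyBounded_const 1))
    exact PolyBounded.mono ((((polyBounded_const 4).mul hS).add (hκ.add hκ')).add
      ((polyBounded_const 2).mul hlen)) hD
  · exact (polyBounded_id.mul polyBounded_id).add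
      (((polyBounded_const 5).mul hℓ).add (polyBounded_const 1))
  · obtain ⟨e, he⟩ := map_seedOfCoins (t := T n) (hlaw n)
    have hout : Measurable fun ω => concat (n * n) (entries (M n ω)) (C n ω).code :=
      measurable_pi_lambda _ fun k => (easy_output (hM n) (hC n)).measurable
        Gate.measurable_value measurable_of_mem_seedFns _ ⟨k, rfl⟩
    change (seedLaw (T n) (μ n)).map
      (fun ω => concat (n * n) (entries (M n ω)) (C n ω).code) = _
    rw [← e, Measure.map_map hout he]
    congr 1
    ext c k
    by_cases hk : k < n * n + (5 * ℓ n + 1)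
    · rw [concat, if_pos hk, hrun n c k hk]
      rfl
    · rw [concat, if_neg hk]
      have hlen := (Circuit.length_le_cost _).trans
        (hcost n (seedOfCoins (T n) (r n) (N n) (S n) c))
      change concat _ _ _ k = 0
      rw [concat, if_neg (by omega), Circuit.code_eq_zero _ (by omega)]

end

end Trapdoor

/-! ### The two constructions and the proof of the theorem. -/

namespace Trapdoor

noncomputable section

open Matrix

/-! ### The laws of the factors -/

theorem map_seedLaw_triple {n : ℕ} (t : ℕ) (μ : Measure (Mat n)) [IsProbabilityMeasure μ]
    {f : Mat n → Mat n} (hf : Measurable f) :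
    (seedLaw t μ).map (fun ω => (walkMat n t ω.1, f ω.2.1, walkMat n t ω.2.2)) =
      (kacWalk n t).prod ((μ.map f).prod (kacWalk n t)) := by
  have := Measure.isProbabilityMeasure_map (μ := μ) hf.aemeasurable
  have hw := measurable_walkMat n t
  rw [← map_walkMat, Measure.map_prod_map _ _ hf hw, Measure.map_prod_map _ _ hw (hf.prodMap hw)]
  rfl

theorem map_seedLaw_pair {n : ℕ} (t : ℕ) (μ : Measure (Mat n)) [IsProbabilityMeasure μ]
    {f : Mat n → Mat n} (hf : Measurable f) :
    (seedLaw t μ).map (fun ω => (walkMat n t ω.1, f ω.2.1)) = (kacWalk n t).prod (μ.map f) := by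
  have hw := measurable_walkMat n t
  have h1 : (μ.prod (coins t)).map Prod.fst = μ := by
    rw [Measure.map_fst_prod]; simp
  have e := Measure.map_prod_map (coins t) (μ.prod (coins t)) hw (hf.comp measurable_fst)
  rw [← Measure.map_map hf measurable_fst, h1, map_walkMat] at e
  exact e.symm

theorem map_seedLaw_middle {n : ℕ} (t : ℕ) (μ : Measure (Mat n)) [IsProbabilityMeasure μ]
    {f : Mat n → Mat n} (hf : Measurable f) :
    (seedLaw t μ).map (fun ω => f ω.2.1) = μ.map f := by
  have := Measure.isProbabilityMeasure_map (μ := μ) hf.aemeasurable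
  have hm : Measurable fun ω : Seed n t => (walkMat n t ω.1, f ω.2.1) :=
    ((measurable_walkMat n t).comp measurable_fst).prodMk (hf.comp measurable_snd.fst)
  have e := congrArg (Measure.map Prod.snd) (map_seedLaw_pair t μ hf)
  rw [Measure.map_map measurable_snd hm, Measure.map_snd_prod] at e
  rw [measure_univ, one_smul] at e
  exact e

/-- This brings the right factor to the first place, the only one that `Indistinguishable.map_prod`
can replace. -/
theorem map_prod_rotate {n : ℕ} (μ ν ρ : Measure (Mat n)) [IsProbabilityMeasure μ]
    [IsProbabilityMeasure ν] [IsProbabilityMeasure ρ] :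
    (μ.prod (ν.prod ρ)).map (fun p => p.1 * p.2.1 * p.2.2) =
      (ρ.prod (μ.prod ν)).map fun p => p.2.1 * p.2.2 * p.1 := by
  have h1 : Measurable fun p : Mat n × Mat n × Mat n => p.1 * p.2.1 * p.2.2 :=
    measurable_matrix_mul (measurable_matrix_mul measurable_fst measurable_snd.fst)
      measurable_snd.snd
  have h2 : Measurable fun p : Mat n × Mat n × Mat n => p.2.1 * p.2.2 * p.1 :=
    measurable_matrix_mul (measurable_matrix_mul measurable_snd.fst measurable_snd.snd)
      measurable_fst
  rw [← Measure.prodAssoc_prod, Measure.map_map h1 MeasurableEquiv.prodAssoc.measurable,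
    ← Measure.prod_swap (μ := μ.prod ν), Measure.map_map h2 measurable_swap]
  rfl

/-! ### Indistinguishability of the products -/

/-- The hybrid is Haar on the left and the walk on the right. In each of the two replacements, the
product of the other two factors is a hardwired constant matrix. -/
theorem indistinguishable_twoSided {T : ℕ → ℕ}
    (hT : Indistinguishable (fun n => kacWalk n (T n)) haarMatrix)
    (lam : ∀ n : ℕ, Measure (Mat n)) [∀ n, IsProbabilityMeasure (lam n)] :
    Indistinguishable
      (fun n => ((kacWalk n (T n)).prod ((lam n).prod (kacWalk n (T n)))).map
        fun p => p.1 * p.2.1 * p.2.2)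
      (fun n => ((haarMatrix n).prod ((lam n).prod (haarMatrix n))).map
        fun p => p.1 * p.2.1 * p.2.2) := by
  have hκ : PolyBounded fun n => 8 * n ^ 3 := (polyBounded_const 8).mul (polyBounded_pow 3)
  have h1 := hT.map_prod (fun n => (lam n).prod (kacWalk n (T n)))
    (f := fun n p => p.1 * p.2.1 * p.2.2)
    (fun n => measurable_matrix_mul (measurable_matrix_mul measurable_fst measurable_snd.fst)
      measurable_snd.snd) hκ fun n b => by
        simp only [Matrix.mul_assoc]
        exact Easy.matrix_mul (subset_withConsts _) (entryFns_const _ _)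
  have h2 := hT.map_prod (fun n => (haarMatrix n).prod (lam n))
    (f := fun n p => p.2.1 * p.2.2 * p.1)
    (fun n => measurable_matrix_mul (measurable_matrix_mul measurable_snd.fst measurable_snd.snd)
      measurable_fst) hκ fun n b =>
        Easy.matrix_mul (entryFns_const (b.1 * b.2) _) (subset_withConsts _)
  simp only [← map_prod_rotate] at h2
  exact h1.trans h2

/-- The two outer factors come from the same rotation, so a single replacement suffices: conjugation
of a hardwired matrix is two matrix products. The transpose is used instead of the inverse to make
this easy. -/
theorem indistinguishable_conjugate {T : ℕ → ℕ}
    (hT : Indistinguishable (fun n => kacWalk n (T n)) haarMatrix)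
    (lam : ∀ n : ℕ, Measure (Mat n)) [∀ n, IsProbabilityMeasure (lam n)] :
    Indistinguishable
      (fun n => ((kacWalk n (T n)).prod (lam n)).map fun p => p.1 * p.2 * p.1ᵀ)
      (fun n => ((haarMatrix n).prod (lam n)).map fun p => p.1 * p.2 * p.1ᵀ) := by
  refine hT.map_prod lam (f := fun n p => p.1 * p.2 * p.1ᵀ)
    (fun n => measurable_matrix_mul (measurable_matrix_mul measurable_fst measurable_snd)
      (measurable_matrix_transpose measurable_fst))
    (((polyBounded_const 8).mul (polyBounded_pow 3)).add
      ((polyBounded_const 8).mul (polyBounded_pow 3))) fun n b => ?_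
  have h1 : Easy (entryFns (id : Mat n → Mat n)) (8 * n ^ 3) (entryFns fun A : Mat n => A * b) :=
    Easy.matrix_mul (subset_withConsts _) (entryFns_const _ _)
  refine (h1.trans (Easy.matrix_mul (Set.subset_union_right.trans (subset_withConsts _)) ?_)).mono
    (Set.subset_union_right.trans (subset_withConsts _)) le_rfl
  rw [entryFns_transpose]
  exact Set.subset_union_left.trans (subset_withConsts _)

/-! ### The two constructions -/

def walkCost (n t : ℕ) : ℕ := t * (8 * n ^ 2 + 40 + 8 * n ^ 4 + 8 * n ^ 3)

def walkCodeCost (n t : ℕ) : ℕ := t * (24 * n ^ 2 + 40)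

def singCost (n : ℕ) : ℕ := 8 * n ^ 3 + n * (12 * (n ^ 3 + 1) + 16)

theorem polyBounded_walkCost {T : ℕ → ℕ} (hT : PolyBounded T) :
    PolyBounded fun n => walkCost n (T n) :=
  hT.mul (((((polyBounded_const 8).mul (polyBounded_pow 2)).add (polyBounded_const 40)).add
    ((polyBounded_const 8).mul (polyBounded_pow 4))).add
      ((polyBounded_const 8).mul (polyBounded_pow 3)))

theorem polyBounded_walkCodeCost {T : ℕ → ℕ} (hT : PolyBounded T) :
    PolyBounded fun n => walkCodeCost n (T n) :=
  hT.mul (((polyBounded_const 24).mul (polyBounded_pow 2)).add (polyBounded_const 40))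

theorem polyBounded_singCost : PolyBounded singCost :=
  ((polyBounded_const 8).mul (polyBounded_pow 3)).add (polyBounded_id.mul
    (((polyBounded_const 12).mul ((polyBounded_pow 3).add (polyBounded_const 1))).add
      (polyBounded_const 16)))

/-- The product of the first walk, the diagonal matrix with entries `d A`, and a third matrix. -/
def productMat {n t : ℕ} (d : Mat n → Fin n → ℝ) (R : Seed n t → Mat n) (ω : Seed n t) : Mat n :=
  walkMat n t ω.1 * Matrix.diagonal (d ω.2.1) * R ω

def productCircuit {n t : ℕ} (d : Mat n → Fin n → ℝ) (R : Seed n t → Circuit) (ω : Seed n t) :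
    Circuit :=
  R ω ++ diagonalCircuit (d ω.2.1) (List.finRange n) ++ walkCircuit n t ω.1

theorem implements_product {n t : ℕ} (d : Mat n → Fin n → ℝ) {R : Seed n t → Mat n}
    {C : Seed n t → Circuit} (h : ∀ ω, Implements (C ω) (R ω)) (ω : Seed n t) :
    Implements (productCircuit d C ω) (productMat d R ω) := by
  rw [productMat, Matrix.mul_assoc]
  exact ((h ω).append (implements_diagonalCircuit _)).append (implements_walkCircuit n t ω.1)

theorem cost_productCircuit_le {n t : ℕ} (d : Mat n → Fin n → ℝ) {C : Seed n t → Circuit}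
    (h : ∀ ω, (C ω).cost ≤ 8 * t) (ω : Seed n t) :
    (productCircuit d C ω).cost ≤ 16 * t + 2 * n := by
  rw [productCircuit, Circuit.cost_append, Circuit.cost_append, cost_diagonalCircuit,
    List.length_finRange]
  have h1 := h ω
  have h2 := cost_walkCircuit_le n t ω.1
  omega

theorem easy_productMat {n t κ κ' : ℕ} {d : Mat n → Fin n → ℝ} {R : Seed n t → Mat n}
    (hd : Easy (seedFns n t) κ (Set.range fun k (ω : Seed n t) => d ω.2.1 k))
    (hR : Easy (seedFns n t) κ' (entryFns R)) :
    Easy (seedFns n t) (walkCost n t + κ + κ' + 16 * n ^ 3) (entryFns (productMat d R)) := by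
  have h0 := ((Easy.walkMat n t (c := fun ω : Seed n t => ω.1) left_coin_mem_seedFns).union
    hd).union hR
  have h1 := h0.trans ((Easy.matrix_mul (fs := seedFns n t ∪
      (entryFns (fun ω : Seed n t => walkMat n t ω.1) ∪
      Set.range (fun k (ω : Seed n t) => d ω.2.1 k) ∪ entryFns R))
    (X := fun ω : Seed n t => walkMat n t ω.1) (Y := fun ω => Matrix.diagonal (d ω.2.1))
    (fun f hf => subset_withConsts _ (Or.inr (Or.inl (Or.inl hf))))
    (entryFns_diagonal_subset fun k =>
      subset_withConsts _ (Or.inr (Or.inl (Or.inr ⟨k, rfl⟩))))))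
  have h2 := h1.comp (Easy.matrix_mul
    (X := fun ω : Seed n t => walkMat n t ω.1 * Matrix.diagonal (d ω.2.1)) (Y := R)
    (fun f hf => subset_withConsts _ (Or.inr hf))
    (fun f hf => subset_withConsts _ (Or.inl (Or.inr hf))))
  exact h2.mono_cost (by unfold walkCost; omega)

theorem easyCode_productCircuit {n t κ κ' : ℕ} {d : Mat n → Fin n → ℝ} {C : Seed n t → Circuit}
    (hd : Easy (seedFns n t) κ (Set.range fun k (ω : Seed n t) => d ω.2.1 k))
    (hC : EasyCode (seedFns n t) κ' C) :
    EasyCode (seedFns n t) (κ' + κ + walkCodeCost n t) (productCircuit d C) :=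
  (hC.append (EasyCode.comp hd (EasyCode.diagonalCircuit (d := fun ω : Seed n t => d ω.2.1)
    (fun k => subset_withConsts _ (Set.mem_range_self k)) (List.finRange n)))).append
      (EasyCode.walkCircuit n t left_coin_mem_seedFns)

theorem isQuasilinear_cost {T : ℕ → ℕ} (hT : IsQuasilinear T) :
    IsQuasilinear fun n => 16 * T n + 2 * n := by
  obtain ⟨c, k, h⟩ := hT
  refine ⟨16 * c + 2, k, fun n hn => ?_⟩
  have h1 := h n hn
  -- For `n ≥ 2` the logarithm is at least `1`, so the linear term is absorbed into the quasilinear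
  -- one.
  have h2 : 1 ≤ Nat.log 2 n ^ k := Nat.one_le_pow _ _ (Nat.log_pos (by norm_num) hn)
  have h3 : n * 1 ≤ n * Nat.log 2 n ^ k := Nat.mul_le_mul_left n h2
  calc 16 * T n + 2 * n ≤ 16 * (c * n * Nat.log 2 n ^ k) + 2 * (n * Nat.log 2 n ^ k) := by omega
    _ = (16 * c + 2) * n * Nat.log 2 n ^ k := by ring

/-- The seed contains a sample of `μ n`, of which only the signed singular values are kept. Thus a
sampler for `μ n`, when there is one, gives a sampler for the pair. -/
theorem exists_twoSided {T : ℕ → ℕ} (hT : KacPseudorandom T) (μ : ∀ n : ℕ, Measure (Mat n))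
    [∀ n, IsProbabilityMeasure (μ n)] (hμ : ∀ n, IsHaarInvariant (μ n)) :
    ∃ F : ∀ n, TrapdooredMatrices n,
      IsTrapdooredFamilyFor F μ ∧ ∀ n, (F n).IsKacTwoSided (T n) := by
  have hTp := hT.1.polyBounded
  have hd : ∀ n, Easy (seedFns n (T n)) (singCost n)
      (Set.range fun k (ω : Seed n (T n)) => signedSing ω.2.1 k) := fun n =>
    Easy.signedSing (entryFns_subset_seedFns n (T n))
  have hM : ∀ n, Easy (seedFns n (T n)) _ (entryFns (productMat signedSing
      fun ω : Seed n (T n) => walkMat n (T n) ω.2.2)) := fun n =>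
    easy_productMat (hd n) (Easy.walkMat n (T n) right_coin_mem_seedFns)
  have hC : ∀ n, EasyCode (seedFns n (T n)) _ (productCircuit signedSing
      fun ω : Seed n (T n) => walkCircuit n (T n) ω.2.2) := fun n =>
    easyCode_productCircuit (hd n) (EasyCode.walkCircuit n (T n) right_coin_mem_seedFns)
  have himp : ∀ n (ω : Seed n (T n)), Implements (productCircuit signedSing
      (fun ω : Seed n (T n) => walkCircuit n (T n) ω.2.2) ω) (productMat signedSing
      (fun ω : Seed n (T n) => walkMat n (T n) ω.2.2) ω) := fun n =>
    implements_product _ fun ω => implements_walkCircuit n (T n) ω.2.2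
  have hcost : ∀ n (ω : Seed n (T n)), (productCircuit signedSing
      (fun ω : Seed n (T n) => walkCircuit n (T n) ω.2.2) ω).cost ≤ 16 * T n + 2 * n := fun n =>
    cost_productCircuit_le _ fun ω => cost_walkCircuit_le n (T n) ω.2.2
  have hlam : ∀ n, IsProbabilityMeasure ((μ n).map singDiag) := fun n =>
    Measure.isProbabilityMeasure_map (measurable_singDiag n).aemeasurable
  have hmul : ∀ n, Measurable fun p : Mat n × Mat n × Mat n => p.1 * p.2.1 * p.2.2 := fun n =>
    measurable_matrix_mul (measurable_matrix_mul measurable_fst measurable_snd.fst)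
      measurable_snd.snd
  have htriple : ∀ n, Measurable fun ω : Seed n (T n) =>
      (walkMat n (T n) ω.1, singDiag ω.2.1, walkMat n (T n) ω.2.2) := fun n =>
    ((measurable_walkMat n _).comp measurable_fst).prodMk
      (((measurable_singDiag n).comp measurable_snd.fst).prodMk
        ((measurable_walkMat n _).comp measurable_snd.snd))
  refine ⟨fun n => trapdooredOfSeed (μ n) _ _ (hM n) (hC n) (himp n),
    ⟨⟨_, isQuasilinear_cost hT.1, hcost⟩, ?_, fun hs => ?_⟩, fun n => ?_⟩
  · have h := indistinguishable_twoSided hT.2 fun n => (μ n).map singDiag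
    -- The Haar side collapses to `μ` itself, and the Kac side becomes the law of a function of the
    -- seed.
    simp only [(hμ _).eq_map, ← map_seedLaw_triple _ _ (measurable_singDiag _)] at h
    simp only [Measure.map_map (hmul _) (htriple _)] at h
    exact h
  · exact efficientlySamplable_pairLaw hTp
      (((polyBounded_walkCost hTp).add polyBounded_singCost).add (polyBounded_walkCost hTp) |>.add
        ((polyBounded_const 16).mul (polyBounded_pow 3)))
      (((polyBounded_walkCodeCost hTp).add polyBounded_singCost).add
        (polyBounded_walkCodeCost hTp))
      (((polyBounded_const 16).mul hTp).add ((polyBounded_const 2).mul polyBounded_id))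
      μ hM hC himp hcost hs
  · refine ⟨fun ω => walkMat n (T n) ω.1, fun ω => singDiag ω.2.1,
      fun ω => walkMat n (T n) ω.2.2, (htriple n).fst, (htriple n).snd.fst, (htriple n).snd.snd,
      ?_, fun ω => ⟨Matrix.isDiag_diagonal _, rfl⟩⟩
    have e := map_seedLaw_triple (T n) (μ n) (measurable_singDiag n)
    rw [← map_seedLaw_middle (T n) (μ n) (measurable_singDiag n)] at e
    exact e

/-- Both outer factors use the first batch of coins: the right one is the transposed walk, whose
circuit runs the inverse rotations in the opposite order. -/
theorem exists_conjugate {T : ℕ → ℕ} (hT : KacPseudorandom T) (μ : ∀ n : ℕ, Measure (Mat n))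
    [∀ n, IsProbabilityMeasure (μ n)] (hμ : ∀ n, IsSymmHaarInvariant (μ n)) :
    ∃ F : ∀ n, TrapdooredMatrices n,
      IsTrapdooredFamilyFor F μ ∧ ∀ n, (F n).IsKacConjugate (T n) := by
  have hTp := hT.1.polyBounded
  have hd : ∀ n, Easy (seedFns n (T n)) (n * (4 * (n ^ 3 + 1)))
      (Set.range fun (k : Fin n) (ω : Seed n (T n)) => symmEigenvalue ω.2.1 k) := fun n =>
    Easy.eigenvalues (entryFns_subset_seedFns n (T n))
  have hM : ∀ n, Easy (seedFns n (T n)) _ (entryFns (productMat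
      (fun A (k : Fin n) => symmEigenvalue A k)
      fun ω : Seed n (T n) => (walkMat n (T n) ω.1)ᵀ)) := fun n =>
    easy_productMat (hd n) (κ' := walkCost n (T n)) (by
      rw [entryFns_transpose]
      exact Easy.walkMat n (T n) left_coin_mem_seedFns)
  have hC : ∀ n, EasyCode (seedFns n (T n)) _ (productCircuit
      (fun A (k : Fin n) => symmEigenvalue A k)
      fun ω : Seed n (T n) => walkCircuitTranspose n (T n) ω.1) := fun n =>
    easyCode_productCircuit (hd n) (EasyCode.walkCircuitTranspose n (T n) left_coin_mem_seedFns)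
  have himp : ∀ n (ω : Seed n (T n)), Implements (productCircuit
      (fun A (k : Fin n) => symmEigenvalue A k)
      (fun ω : Seed n (T n) => walkCircuitTranspose n (T n) ω.1) ω) (productMat
      (fun A (k : Fin n) => symmEigenvalue A k)
      (fun ω : Seed n (T n) => (walkMat n (T n) ω.1)ᵀ) ω) := fun n =>
    implements_product _ fun ω => implements_walkCircuitTranspose n (T n) ω.1
  have hcost : ∀ n (ω : Seed n (T n)), (productCircuit (fun A (k : Fin n) => symmEigenvalue A k)
      (fun ω : Seed n (T n) => walkCircuitTranspose n (T n) ω.1) ω).cost ≤ 16 * T n + 2 * n :=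
    fun n => cost_productCircuit_le _ fun ω => cost_walkCircuitTranspose_le n (T n) ω.1
  have hlam : ∀ n, IsProbabilityMeasure ((μ n).map eigDiag) := fun n =>
    Measure.isProbabilityMeasure_map (measurable_eigDiag n).aemeasurable
  have hmul : ∀ n, Measurable fun p : Mat n × Mat n => p.1 * p.2 * p.1ᵀ := fun n =>
    measurable_matrix_mul (measurable_matrix_mul measurable_fst measurable_snd)
      (measurable_matrix_transpose measurable_fst)
  have hpair : ∀ n, Measurable fun ω : Seed n (T n) => (walkMat n (T n) ω.1, eigDiag ω.2.1) :=
    fun n => ((measurable_walkMat n _).comp measurable_fst).prodMk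
      ((measurable_eigDiag n).comp measurable_snd.fst)
  refine ⟨fun n => trapdooredOfSeed (μ n) _ _ (hM n) (hC n) (himp n),
    ⟨⟨_, isQuasilinear_cost hT.1, hcost⟩, ?_, fun hs => ?_⟩, fun n => ?_⟩
  · have h := indistinguishable_conjugate hT.2 fun n => (μ n).map eigDiag
    simp only [(hμ _).eq_map, ← map_seedLaw_pair _ _ (measurable_eigDiag _)] at h
    simp only [Measure.map_map (hmul _) (hpair _)] at h
    exact h
  · have heig : PolyBounded fun n => n * (4 * (n ^ 3 + 1)) :=
      polyBounded_id.mul ((polyBounded_const 4).mul ((polyBounded_pow 3).add (polyBounded_const 1)))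
    exact efficientlySamplable_pairLaw hTp
      (((polyBounded_walkCost hTp).add heig).add (polyBounded_walkCost hTp) |>.add
        ((polyBounded_const 16).mul (polyBounded_pow 3)))
      (((polyBounded_walkCodeCost hTp).add heig).add (polyBounded_walkCodeCost hTp))
      (((polyBounded_const 16).mul hTp).add ((polyBounded_const 2).mul polyBounded_id))
      μ hM hC himp hcost hs
  · refine ⟨fun ω => walkMat n (T n) ω.1, fun ω => eigDiag ω.2.1, (hpair n).fst, (hpair n).snd,
      ?_, fun ω => ?_⟩
    · have e := map_seedLaw_pair (T n) (μ n) (measurable_eigDiag n)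
      rw [← map_seedLaw_middle (T n) (μ n) (measurable_eigDiag n)] at e
      exact e
    -- The walk is orthogonal on every outcome, so its transpose, which the circuit applies, is its
    -- inverse.
    · have h1 := walkMat_mul_transpose n (T n) ω.1
      refine ⟨Matrix.isUnit_det_of_right_inverse h1, Matrix.isDiag_diagonal _, ?_⟩
      rw [Matrix.inv_eq_right_inv h1]
      rfl

end

end Trapdoor

theorem mainTheorem4 (T : ℕ → ℕ) (hT : Trapdoor.KacPseudorandom T)
    (𝒟 : ∀ n : ℕ, Measure (Matrix (Fin n) (Fin n) ℝ)) (hprob : ∀ n, IsProbabilityMeasure (𝒟 n)) :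
    ((∀ n, Trapdoor.IsHaarInvariant (𝒟 n)) →
      ∃ F : ∀ n, Trapdoor.TrapdooredMatrices n,
        Trapdoor.IsTrapdooredFamilyFor F 𝒟 ∧ ∀ n, (F n).IsKacTwoSided (T n)) ∧
    ((∀ n, Trapdoor.IsSymmHaarInvariant (𝒟 n)) →
      ∃ F : ∀ n, Trapdoor.TrapdooredMatrices n,
        Trapdoor.IsTrapdooredFamilyFor F 𝒟 ∧ ∀ n, (F n).IsKacConjugate (T n)) :=
  ⟨Trapdoor.exists_twoSided hT 𝒟, Trapdoor.exists_conjugate hT 𝒟⟩
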